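/- Fix a constant $c\in\mathbb N$. Consider directed graphs $G=(V,E)$ with $n\ge 1$ vertices (loops are allowed, parallel edges are not; an undirected graph is the special case in which edges and weights are symmetric) and edge weights $w\colon E\to\{0,\dots,n^c\}$. Let $d(s,t)$ be the minimum weight of a directed path from $s$ to $t$, with $d(s,t)=\infty$ if there is none, let the degree of a vertex be its number of outgoing edges, and let $\overline\Delta$ be the average degree. The input is given as read-only adjacency lists (in arbitrary order), with constant time access to $n$ and to the degree of each vertex, on a word RAM with word size $\Omega(\log n)$ (that is, with any word size at least $K(\log n+1)$, for a constant $K$ depending on $c$), with unit-cost addition, subtraction, comparison, memory access and output, and with initially uninitialized working memory. Then no-self-APSD enumeration, i.e. the task of emitting each triple $(s,t,d(s,t))$ with $s,t\in V$, $s\neq t$, exactly once (including those with $d(s,t)=\infty$), and nothing else, can be solved with preprocessing time $O(n)$, delay $O(\overline\Delta+\log n)$ and space complexity $\Theta(n)$. Explicitly, there are a program and a constant $C$, depending only on $c$, such that on every such input the program halts and solves this task; after a preprocessing phase of at most $Cn$ steps, in which nothing is emitted, the time to the first or next output, and the time from the last output (or, if there is none, from the end of preprocessing) to the end of the computation, is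 at most $C(\overline\Delta+\log n)$; and the number of reserved words of working memory is at most $Cn$ and at least $n/C$. -/

import Mathlib

/-! ## Weighted graphs and the solutions to be enumerated

Vertices are `0, …, n - 1`. An undirected graph is the special case in which `Adj` and `w` are
symmetric. Only the values `w u v` with `G.Adj u v` matter. -/

/-- `HasWalk G w s t k`: there is a directed walk from `s` to `t` whose edge weights sum to `k`. -/
inductive HasWalk {V : Type*} (G : Digraph V) (w : V → V → ℕ) : V → V → ℕ → Prop
  | nil (s : V) : HasWalk G w s s 0
  | cons {s v t : V} {k : ℕ} (h : G.Adj s v) (p : HasWalk G w v t k) : HasWalk G w s t (w s v + k)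

/-- The shortest distance: the least weight of a walk from `s` to `t`, and `⊤` if `t` is not
reachable from `s`. -/
noncomputable def wdist {V : Type*} (G : Digraph V) (w : V → V → ℕ) (s t : V) : ℕ∞ :=
  ⨅ k ∈ {k : ℕ | HasWalk G w s t k}, (k : ℕ∞)

/-- The degree of a vertex is the number of its outgoing edges; this is the average degree. -/
noncomputable def avgDegree {n : ℕ} (G : Digraph (Fin n)) : ℝ :=
  (∑ v : Fin n, ({u : Fin n | G.Adj v u}.ncard : ℝ)) / n

/-- All distance triples `(s, t, d(s, t))` with `s ≠ t`. -/
def noSelfSolutions {n : ℕ} (G : Digraph (Fin n)) (w : Fin n → Fin n → ℕ) : Set (ℕ × ℕ × ℕ∞) :=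
  {o | ∃ s t : Fin n, s ≠ t ∧ o = ((s : ℕ), (t : ℕ), wdist G w s t)}

/-! ## The word RAM with output

A word is a `BitVec W`. There are registers (of which a program can name only finitely many), a
working memory with one word at each address, and a read-only input memory. -/

/-- The instructions; each takes one time step. Natural numbers `d a b` name registers, and `l` is
the position of an instruction of the program. -/
inductive Instr
  /-- register `d` receives the constant `k` -/
  | const (d k : ℕ)
  /-- addition modulo `2 ^ W` -/
  | add (d a b : ℕ)
  /-- subtraction modulo `2 ^ W` -/
  | sub (d a b : ℕ)
  /-- register `d` receives the cell of the working memory whose address is in register `a` -/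
  | load (d a : ℕ)
  /-- the cell whose address is in register `a` receives the content of register `b` -/
  | store (a b : ℕ)
  /-- register `d` receives the cell of the input memory whose address is in register `a` -/
  | input (d a : ℕ)
  | jump (l : ℕ)
  /-- jump to `l` if register `a` is less than register `b` (as unsigned numbers) -/
  | jumpLt (a b l : ℕ)
  /-- output the triple of the contents of registers `a`, `b`, `d` -/
  | emit (a b d : ℕ)
  /-- output the contents of registers `a`, `b` and the distance `∞` -/
  | emitInf (a b : ℕ)
  | halt

/-- A program is a finite sequence of instructions. -/
abbrev Program := List Instr

/-- A configuration: program counter, registers, working memory. -/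
structure Config (W : ℕ) where
  pc : ℕ
  reg : ℕ → BitVec W
  mem : BitVec W → BitVec W

namespace Config

variable {W : ℕ}

/-- Write `x` into register `d` and proceed to the next instruction. -/
def setReg (s : Config W) (d : ℕ) (x : BitVec W) : Config W :=
  { s with pc := s.pc + 1, reg := Function.update s.reg d x }

/-- The effect of one instruction. -/
def exec (inp : BitVec W → BitVec W) (s : Config W) : Instr → Config W
  | .const d k => s.setReg d (BitVec.ofNat W k)
  | .add d a b => s.setReg d (s.reg a + s.reg b)
  | .sub d a b => s.setReg d (s.reg a - s.reg b)
  | .load d a => s.setReg d (s.mem (s.reg a))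
  | .store a b => { s with pc := s.pc + 1, mem := Function.update s.mem (s.reg a) (s.reg b) }
  | .input d a => s.setReg d (inp (s.reg a))
  | .jump l => { s with pc := l }
  | .jumpLt a b l => { s with pc := if (s.reg a).toNat < (s.reg b).toNat then l else s.pc + 1 }
  | .emit _ _ _ => { s with pc := s.pc + 1 }
  | .emitInf _ _ => { s with pc := s.pc + 1 }
  | .halt => s

/-- The instruction to be executed next; beyond the end of the program, the machine halts. -/
def instr (P : Program) (s : Config W) : Instr := P.getD s.pc .halt

/-- The machine has halted. -/
def Halted (P : Program) (s : Config W) : Prop := s.instr P = .halt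

/-- The output, if any, made by the instruction to be executed next. -/
def output (P : Program) (s : Config W) : Option (ℕ × ℕ × ℕ∞) :=
  match s.instr P with
  | .emit a b d => some ((s.reg a).toNat, (s.reg b).toNat, ((s.reg d).toNat : ℕ∞))
  | .emitInf a b => some ((s.reg a).toNat, (s.reg b).toNat, ⊤)
  | _ => none

/-- The address of the working memory, if any, accessed by the instruction to be executed next. -/
def accessed (P : Program) (s : Config W) : Option (BitVec W) :=
  match s.instr P with
  | .load _ a => some (s.reg a)
  | .store a _ => some (s.reg a)
  | _ => none

end Config

/-- The configuration after `t` steps, started at the first instruction with all registers `0` and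
with the given (arbitrary, as it is uninitialized) content `M` of the working memory. -/
def run {W : ℕ} (P : Program) (inp M : BitVec W → BitVec W) (t : ℕ) : Config W :=
  (fun s => s.exec inp (s.instr P))^[t] ⟨0, fun _ => 0, M⟩

/-- The space used: cells `0, …, S - 1` of the working memory have to be reserved, where `S - 1` is
the largest address that is ever accessed. The boundedly many registers are not counted, nor is the
read-only input. -/
noncomputable def spaceUsed {W : ℕ} (P : Program) (inp M : BitVec W → BitVec W) : ℕ :=
  sSup {S : ℕ | ∃ (t : ℕ) (a : BitVec W),
    (run P inp M t).accessed P = some a ∧ S = a.toNat + 1}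

/-! ## Enumeration, preprocessing and delay -/

/-- The run halts, outputs only elements of `A`, and outputs each of them exactly once. -/
def Enumerates {W : ℕ} (P : Program) (inp M : BitVec W → BitVec W)
    (A : Set (ℕ × ℕ × ℕ∞)) : Prop :=
  (∃ t, (run P inp M t).Halted P) ∧
  (∀ t o, (run P inp M t).output P = some o → o ∈ A) ∧
  ∀ o ∈ A, ∃! t, (run P inp M t).output P = some o

/-- The run consists of a preprocessing phase of at most `p` steps, in which nothing is output, and
an enumeration phase, in which from each moment on the next output or, if there is none, the end
of the computation is reached within time `D`. -/
def HasDelay {W : ℕ} (P : Program) (inp M : BitVec W → BitVec W) (p D : ℝ) : Prop :=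
  ∃ t₀ : ℕ, (t₀ : ℝ) ≤ p ∧
    (∀ t < t₀, (run P inp M t).output P = none) ∧
    ∀ τ ≥ t₀, ∃ t ≥ τ, (t : ℝ) - τ ≤ D ∧
      ((run P inp M t).output P ≠ none ∨ (run P inp M t).Halted P)

/-! ## The input: adjacency lists in read-only memory -/

/-- `adj v` lists the out-neighbours of `v`, in any order and without repetition. -/
def IsAdjacencyLists {n : ℕ} (G : Digraph (Fin n)) (adj : Fin n → List (Fin n)) : Prop :=
  ∀ v, (adj v).Nodup ∧ ∀ u, u ∈ adj v ↔ G.Adj v u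

/-- The block of `v`: its degree, then for each outgoing edge its head and its weight. -/
def vertexBlock {n : ℕ} (w : Fin n → Fin n → ℕ) (adj : Fin n → List (Fin n)) (v : Fin n) :
    List ℕ :=
  (adj v).length :: (adj v).flatMap fun u : Fin n => [(u : ℕ), w v u]

/-- The input word sequence: the number `n` of vertices, then for each vertex the address at which
its block starts, then the blocks. -/
def encodeGraph {n : ℕ} (w : Fin n → Fin n → ℕ) (adj : Fin n → List (Fin n)) : List ℕ :=
  n :: (List.ofFn fun v : Fin n => 1 + n + ∑ u ∈ Finset.Iio v, (vertexBlock w adj u).length) ++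
    (List.finRange n).flatMap (vertexBlock w adj)

/-- The read-only memory holding a sequence of numbers, followed by zeros. -/
def inputMemory (W : ℕ) (x : List ℕ) (a : BitVec W) : BitVec W :=
  BitVec.ofNat W (x.getD a.toNat 0)

/-! ## Runs of the word RAM -/

/-! The pairs are emitted source by source, one target per round. While the distances from `p` are
emitted, the single-source search from `p + 1` runs in the background, `R` steps per round. Only two
arrays of keys are alive at any time, so the space stays linear. With `m` edges and an `L = O(log
n)` such that `2 ^ L` exceeds all finite distances, a search takes at most `m + n * (4 * L + 6)`
steps (`Search.Start.final_iterate`). Spread over the `n` rounds of a phase, this is `O(m / n + log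
n)` per round.

The first search does not fit into preprocessing time `O(n)`. It runs during phase `0`, whose
outputs need no search. A walk from `u` to another vertex has to leave `u` by an edge that is not a
loop, so the weight of the lightest such edge is the distance to its head, and if there is no such
edge, then every other vertex is at distance `∞` (`EncodesGraph.wdist_lightestEdge`). Finding the
edge takes time proportional to the degree, so phase `0` treats only the vertices of degree at most
`2 * R₀`, where `R₀` exceeds the average degree. By Markov's inequality these are at least half of
the vertices (`LowList.le_two_mul`), and the factor `2` in `R` lets the first search end within that
many rounds (`Layout.steps_le`). One early target per vertex is recorded and skipped later. A later
phase is therefore silent in at most two rounds, the vertex itself and its early target, which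
bounds the gaps between outputs (`Layout.exists_roundOutput_ne_nil`).

The search has to be cut into steps of constant time, in linear space and without multiplication. It
is Dijkstra's algorithm with a radix heap: the keys removed are monotone, so the unfinished vertices
can be kept as segments of one permutation, for key intervals of lengths `2 ^ lev`. The top segment
is halved until its interval is a single key. A vertex moves only towards the top, through at most
`L + 1` segments, and its level never increases; a potential turns this into the bound on the number
of steps (`Search.Inv.potential_mainStep`). Correctness rests on `Search.Inv`: on termination all
edges between reached vertices are relaxed and each finite key is the weight of a walk, so keys are
distances (`EncodesGraph.wdist_eq_distOf`). Resetting the keys is itself part of the search steps,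
and it saves each old key for output before overwriting it.

The program is written for an idealized machine with natural numbers as words and is reasoned about
by weakest preconditions of loop-free blocks. `BlockRuns.runs` transfers this to the RAM, where a
block costs at most as many steps as the program is long. `Rounds` converts a bound per round and a
bound on silent rounds into the delay. -/

/-- An output triple. -/
abbrev Output := ℕ × ℕ × ℕ∞

/-- One time step of the machine. -/
def Config.next {W : ℕ} (P : Program) (inp : BitVec W → BitVec W) (s : Config W) : Config W :=
  s.exec inp (s.instr P)

/-- `Runs P inp S s k os s'`: from `s`, the machine reaches `s'` in `k` steps, making the outputs
`os` and accessing only cells below `S`. -/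
inductive Runs {W : ℕ} (P : Program) (inp : BitVec W → BitVec W) (S : ℕ) :
    Config W → ℕ → List Output → Config W → Prop
  | refl (s) : Runs P inp S s 0 [] s
  | step {s k os s'} (acc : ∀ a, s.accessed P = some a → a.toNat < S)
      (r : Runs P inp S (s.next P inp) k os s') :
      Runs P inp S s (k + 1) ((s.output P).toList ++ os) s'

namespace Runs

variable {W : ℕ} {P : Program} {inp : BitVec W → BitVec W} {S : ℕ}

theorem trans {s s' s'' : Config W} {k k' : ℕ} {os os' : List Output}
    (h : Runs P inp S s k os s') (h' : Runs P inp S s' k' os' s'') :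
    Runs P inp S s (k + k') (os ++ os') s'' := by
  induction h with
  | refl s => simpa using h'
  | step acc r ih =>
    have := Runs.step acc (ih h')
    rw [List.append_assoc, Nat.add_right_comm]
    exact this

theorem iterate_eq {s s' : Config W} {k : ℕ} {os : List Output}
    (h : Runs P inp S s k os s') : (Config.next P inp)^[k] s = s' := by
  induction h with
  | refl s => rfl
  | step acc r ih => simpa using ih

theorem single_silent {s : Config W} (acc : ∀ a, s.accessed P = some a → a.toNat < S)
    (ho : s.output P = none) : Runs P inp S s 1 [] (s.next P inp) := by
  simpa [ho] using Runs.step acc (Runs.refl (P := P) (inp := inp) (S := S) (s.next P inp))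

theorem output_iff {s s' : Config W} {k : ℕ} {os : List Output}
    (h : Runs P inp S s k os s') (o : Output) :
    (∃ i < k, ((Config.next P inp)^[i] s).output P = some o) ↔ o ∈ os := by
  induction h with
  | refl s => simp
  | @step s k os s' acc r ih =>
    rw [List.mem_append, ← ih, Option.mem_toList]
    constructor
    · rintro ⟨i, hi, h⟩
      cases i with
      | zero => left; simpa using h
      | succ i => right; exact ⟨i, by omega, by simpa using h⟩
    · rintro (h | ⟨i, hi, h⟩)
      · exact ⟨0, by omega, by simpa using h⟩
      · exact ⟨i + 1, by omega, by simpa using h⟩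

theorem output_unique {s s' : Config W} {k : ℕ} {os : List Output}
    (h : Runs P inp S s k os s') (hn : os.Nodup) {o : Output} {i j : ℕ} (hi : i < k) (hj : j < k)
    (hoi : ((Config.next P inp)^[i] s).output P = some o)
    (hoj : ((Config.next P inp)^[j] s).output P = some o) : i = j := by
  induction h generalizing i j with
  | refl s => omega
  | @step s k os s' acc r ih =>
    rw [List.nodup_append] at hn
    have key : ∀ {i}, i < k → s.output P = some o →
        ((Config.next P inp)^[i] (s.next P inp)).output P = some o → False := by
      intro i hi h1 h2
      have := (output_iff r o).1 ⟨i, hi, h2⟩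
      exact hn.2.2 o (by simp [h1]) o this rfl
    cases i with
    | zero =>
      cases j with
      | zero => rfl
      | succ j => exact (key (i := j) (by omega) (by simpa using hoi) (by simpa using hoj)).elim
    | succ i =>
      cases j with
      | zero => exact (key (i := i) (by omega) (by simpa using hoj) (by simpa using hoi)).elim
      | succ j =>
        have := ih hn.2.1 (i := i) (j := j) (by omega) (by omega) (by simpa using hoi)
          (by simpa using hoj)
        omega

theorem accessed_lt {s s' : Config W} {k : ℕ} {os : List Output}
    (h : Runs P inp S s k os s') {i : ℕ} (hi : i < k) {a : BitVec W}
    (ha : ((Config.next P inp)^[i] s).accessed P = some a) : a.toNat < S := by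
  induction h generalizing i with
  | refl s => omega
  | step acc r ih =>
    cases i with
    | zero => exact acc a (by simpa using ha)
    | succ i => exact ih (i := i) (by omega) (by simpa using ha)

theorem event_of_ne_nil {s s' : Config W} {k : ℕ} {os : List Output}
    (h : Runs P inp S s k os s') (hne : os ≠ []) :
    ∃ i < k, ((Config.next P inp)^[i] s).output P ≠ none := by
  obtain ⟨o, ho⟩ := List.exists_mem_of_ne_nil os hne
  obtain ⟨i, hi, h⟩ := (output_iff h o).2 ho
  exact ⟨i, hi, by simp [h]⟩

end Runs

theorem run_eq_iterate {W : ℕ} (P : Program) (inp M : BitVec W → BitVec W) (t : ℕ) :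
    run P inp M t = (Config.next P inp)^[t] ⟨0, fun _ => 0, M⟩ := rfl

theorem Config.Halted.iterate {W : ℕ} {P : Program} {inp : BitVec W → BitVec W} {s : Config W}
    (h : s.Halted P) (t : ℕ) : (Config.next P inp)^[t] s = s := by
  have : s.next P inp = s := by
    unfold Config.next; rw [show s.instr P = .halt from h]; rfl
  induction t with
  | zero => rfl
  | succ t ih => rw [Function.iterate_succ_apply, this, ih]

/-! ## Programs built from blocks over an idealized memory

The idealized machine has natural numbers as words and sixteen arrays, each of them infinite; cell
`i` of array `k` has the address `16 * i + k`. -/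

/-- A state of the idealized machine. -/
structure ArrState where
  reg : ℕ → ℕ
  arr : ℕ → ℕ → ℕ

namespace ArrState

def setReg (σ : ArrState) (d x : ℕ) : ArrState := { σ with reg := Function.update σ.reg d x }

def setArr (σ : ArrState) (k i x : ℕ) : ArrState :=
  { σ with arr := Function.update σ.arr k (Function.update (σ.arr k) i x) }

end ArrState

/-- The operations of the idealized machine. -/
inductive Op
  | const (d k : ℕ)
  | add (d a b : ℕ)
  | sub (d a b : ℕ)
  /-- register `d` receives the cell of array `k` with index in register `a` -/
  | load (d k a : ℕ)
  /-- the cell of array `k` with index in register `a` receives the content of register `b` -/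
  | store (k a b : ℕ)
  | input (d a : ℕ)

namespace Op

def apply (inp : ℕ → ℕ) (σ : ArrState) : Op → ArrState
  | const d k => σ.setReg d k
  | add d a b => σ.setReg d (σ.reg a + σ.reg b)
  | sub d a b => σ.setReg d (σ.reg a - σ.reg b)
  | load d k a => σ.setReg d (σ.arr k (σ.reg a))
  | store k a b => σ.setArr k (σ.reg a) (σ.reg b)
  | input d a => σ.setReg d (inp (σ.reg a))

/-- No overflow occurs, and only the first `S` cells of each array are accessed. -/
def Safe (V S : ℕ) (σ : ArrState) : Op → Prop
  | const _ k => k < V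
  | add _ a b => σ.reg a + σ.reg b < V
  | sub _ a b => σ.reg b ≤ σ.reg a
  | load _ k a => k < 16 ∧ σ.reg a < S
  | store k a _ => k < 16 ∧ σ.reg a < S
  | input _ _ => True

/-- Registers `0` and `1` of the RAM serve for the computation of addresses. -/
def compile : Op → List Instr
  | const d k => [.const (d + 2) k]
  | add d a b => [.add (d + 2) (a + 2) (b + 2)]
  | sub d a b => [.sub (d + 2) (a + 2) (b + 2)]
  | load d k a => [.add 0 (a + 2) (a + 2), .add 0 0 0, .add 0 0 0, .add 0 0 0, .const 1 k,
      .add 0 0 1, .load (d + 2) 0]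
  | store k a b => [.add 0 (a + 2) (a + 2), .add 0 0 0, .add 0 0 0, .add 0 0 0, .const 1 k,
      .add 0 0 1, .store 0 (b + 2)]
  | input d a => [.input (d + 2) (a + 2)]

end Op

/-- Loop-free code, every path of which ends with a jump to a block or with halting. -/
inductive Code
  | goto (l : ℕ)
  | halt
  | op (o : Op) (c : Code)
  | emit (a b d : ℕ) (c : Code)
  | emitInf (a b : ℕ) (c : Code)
  | ifLt (a b : ℕ) (t e : Code)

namespace Code

def size : Code → ℕ
  | goto _ => 1
  | halt => 1
  | op o c => o.compile.length + c.size
  | emit _ _ _ c => 1 + c.size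
  | emitInf _ _ c => 1 + c.size
  | ifLt _ _ t e => 1 + e.size + t.size

def compile (off : ℕ → ℕ) (pc : ℕ) : Code → List Instr
  | goto l => [.jump (off l)]
  | halt => [.halt]
  | op o c => o.compile ++ c.compile off (pc + o.compile.length)
  | emit a b d c => .emit (a + 2) (b + 2) (d + 2) :: c.compile off (pc + 1)
  | emitInf a b c => .emitInf (a + 2) (b + 2) :: c.compile off (pc + 1)
  | ifLt a b t e => .jumpLt (a + 2) (b + 2) (pc + 1 + e.size) ::
      (e.compile off (pc + 1) ++ t.compile off (pc + 1 + e.size))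

theorem length_compile (off : ℕ → ℕ) (pc : ℕ) (c : Code) : (c.compile off pc).length = c.size := by
  induction c generalizing pc with
  | goto l => rfl
  | halt => rfl
  | op o c ih => simp [compile, size, ih]
  | emit a b d c ih => simp [compile, size, ih]; omega
  | emitInf a b c ih => simp [compile, size, ih]; omega
  | ifLt a b t e iht ihe => simp [compile, size, iht, ihe]; omega

/-- The weakest precondition: no overflow occurs, and the outputs, the label of the next block and
the state reached satisfy `Q`. -/
def wp (V S : ℕ) (inp : ℕ → ℕ) (Q : List Output → ℕ → ArrState → Prop) : Code → ArrState → Prop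
  | goto l, σ => Q [] l σ
  -- Halting satisfies no postcondition: the final block is reached by `BlockRuns` but never
  -- executed.
  | halt, _ => False
  | op o c, σ => o.Safe V S σ ∧ c.wp V S inp Q (o.apply inp σ)
  | emit a b d c, σ =>
      c.wp V S inp (fun os => Q ((σ.reg a, σ.reg b, (σ.reg d : ℕ∞)) :: os)) σ
  | emitInf a b c, σ => c.wp V S inp (fun os => Q ((σ.reg a, σ.reg b, ⊤) :: os)) σ
  | ifLt a b t e, σ => (σ.reg a < σ.reg b → t.wp V S inp Q σ) ∧
      (¬ σ.reg a < σ.reg b → e.wp V S inp Q σ)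

/-- Execution is deterministic, so a postcondition that holds can be sharpened to the exact outcome.
This is what makes a `wp` proof into one step of `BlockRuns`. -/
theorem wp_iff {V S : ℕ} {inp : ℕ → ℕ} {Q : List Output → ℕ → ArrState → Prop} {c : Code} {σ : ArrState} :
    c.wp V S inp Q σ ↔ ∃ os l σ', Q os l σ' ∧
      c.wp V S inp (fun os' l' τ => os' = os ∧ l' = l ∧ τ = σ') σ := by
  induction c generalizing Q σ with
  | goto l => simp [wp]
  | halt => simp [wp]
  | op o c ih => simp only [wp]; rw [ih]; grind
  | emit a b d c ih =>
    simp only [wp]; rw [ih]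
    constructor
    · rintro ⟨os, l, σ', h, h'⟩
      refine ⟨_, l, σ', h, ?_⟩
      simpa using h'
    · rintro ⟨os, l, σ', h, h'⟩
      rw [ih] at h'
      obtain ⟨os1, l1, σ1, ⟨rfl, rfl, rfl⟩, h2⟩ := h'
      exact ⟨_, _, _, h, h2⟩
  | emitInf a b c ih =>
    simp only [wp]; rw [ih]
    constructor
    · rintro ⟨os, l, σ', h, h'⟩
      refine ⟨_, l, σ', h, ?_⟩
      simpa using h'
    · rintro ⟨os, l, σ', h, h'⟩
      rw [ih] at h'
      obtain ⟨os1, l1, σ1, ⟨rfl, rfl, rfl⟩, h2⟩ := h'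
      exact ⟨_, _, _, h, h2⟩
  | ifLt a b t e iht ihe =>
    simp only [wp]
    by_cases h : σ.reg a < σ.reg b
    · simp only [h, true_imp_iff, not_true, false_imp_iff, and_true]; exact iht
    · simp only [h, false_imp_iff, not_false_iff, true_imp_iff, true_and]; exact ihe

end Code

/-- `l` is the part of the program `P` that starts at position `pc`. -/
def IsAt (P : Program) (pc : ℕ) (l : List Instr) : Prop := ∃ r, P.drop pc = l ++ r

namespace IsAt

variable {P : Program} {pc : ℕ}

theorem head {i : Instr} {l : List Instr} (h : IsAt P pc (i :: l)) : P.getD pc .halt = i := by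
  obtain ⟨r, h⟩ := h
  have h2 := congrArg (fun x : List Instr => x[0]?) h
  simp at h2
  simp [List.getD, h2]

theorem right {l l' : List Instr} (h : IsAt P pc (l ++ l')) : IsAt P (pc + l.length) l' := by
  obtain ⟨r, h⟩ := h
  exact ⟨r, by rw [← List.drop_drop, h]; simp⟩

theorem left {l l' : List Instr} (h : IsAt P pc (l ++ l')) : IsAt P pc l := by
  obtain ⟨r, h⟩ := h
  exact ⟨l' ++ r, by rw [h]; simp⟩

theorem tail {i : Instr} {l : List Instr} (h : IsAt P pc (i :: l)) : IsAt P (pc + 1) l :=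
  right (l := [i]) h

end IsAt

/-- The state of the RAM represents that of the idealized machine. -/
structure Represents {W : ℕ} (s : Config W) (σ : ArrState) : Prop where
  reg : ∀ r, (s.reg (r + 2)).toNat = σ.reg r
  arr : ∀ k < 16, ∀ i, 16 * i + k < 2 ^ W → (s.mem (BitVec.ofNat W (16 * i + k))).toNat = σ.arr k i

theorem BitVec.toNat_add_eq {W : ℕ} {x y : BitVec W} (h : x.toNat + y.toNat < 2 ^ W) :
    (x + y).toNat = x.toNat + y.toNat := by
  rw [BitVec.toNat_add, Nat.mod_eq_of_lt h]

namespace Represents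

variable {W : ℕ} {s : Config W} {σ : ArrState}

theorem setReg (h : Represents s σ) (d : ℕ) {x : BitVec W} {y : ℕ} (hx : x.toNat = y) :
    Represents (s.setReg (d + 2) x) (σ.setReg d y) where
  reg r := by
    by_cases hr : r = d
    · subst hr; simp [Config.setReg, ArrState.setReg, hx]
    · simp [Config.setReg, ArrState.setReg, Function.update_of_ne, hr, h.reg]
  arr k hk i hi := by simpa [Config.setReg, ArrState.setReg] using h.arr k hk i hi

theorem congr_low {s' : Config W} (h : Represents s σ) (hr : ∀ r, s'.reg (r + 2) = s.reg (r + 2))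
    (hm : s'.mem = s.mem) : Represents s' σ where
  reg r := by rw [hr, h.reg]
  arr k hk i hi := by rw [hm, h.arr k hk i hi]

end Represents

theorem Runs.add {W S : ℕ} {P : Program} {inp : BitVec W → BitVec W} {s : Config W} {d a b : ℕ}
    (h : s.instr P = .add d a b) :
    Runs P inp S s 1 [] (s.setReg d (s.reg a + s.reg b)) := by
  have := Runs.single_silent (P := P) (inp := inp) (S := S) (s := s)
    (by simp [Config.accessed, h]) (by simp [Config.output, h])
  simpa only [Config.next, h, Config.exec] using this

theorem Runs.const {W S : ℕ} {P : Program} {inp : BitVec W → BitVec W} {s : Config W} {d k : ℕ}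
    (h : s.instr P = .const d k) :
    Runs P inp S s 1 [] (s.setReg d (BitVec.ofNat W k)) := by
  have := Runs.single_silent (P := P) (inp := inp) (S := S) (s := s)
    (by simp [Config.accessed, h]) (by simp [Config.output, h])
  simpa only [Config.next, h, Config.exec] using this

/-- The register contents after the computation of the address of cell `i` of array `k`. -/
theorem runs_address {W S : ℕ} {P : Program} {inp : BitVec W → BitVec W} {s : Config W} {σ : ArrState}
    {k a : ℕ} (hrep : Represents s σ)
    (hat : IsAt P s.pc [.add 0 (a + 2) (a + 2), .add 0 0 0, .add 0 0 0, .add 0 0 0, .const 1 k,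
      .add 0 0 1]) :
    ∃ s', Runs P inp (16 * S) s 6 [] s' ∧ s'.pc = s.pc + 6 ∧
      s'.reg 0 = BitVec.ofNat W (16 * σ.reg a + k) ∧ Represents s' σ := by
  have h1 := hat.head
  have h2 := hat.tail.head
  have h3 := hat.tail.tail.head
  have h4 := hat.tail.tail.tail.head
  have h5 := hat.tail.tail.tail.tail.head
  have h6 := hat.tail.tail.tail.tail.tail.head
  have ra : s.reg (a + 2) = BitVec.ofNat W (σ.reg a) := by
    rw [← hrep.reg a]; simp
  refine ⟨_, .trans (.add h1) (.trans (.add h2) (.trans (.add h3) (.trans (.add h4)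
    (.trans (.const h5) (.add h6))))), rfl, ?_, ?_⟩
  -- Four doublings give the factor 16. Since `BitVec.ofNat` respects addition, no bound on the
  -- address is needed at this point.
  · simp only [Config.setReg, ra, Function.update_self, ne_eq, zero_ne_one, not_false_eq_true,
      Function.update_of_ne, ← BitVec.ofNat_add]
    congr 1
    ring
  · refine hrep.congr_low (fun r => ?_) rfl
    simp [Config.setReg]

theorem Op.runs {W S : ℕ} {P : Program} {inp : BitVec W → BitVec W} {inp' : ℕ → ℕ} {s : Config W}
    {σ : ArrState} (hinp : ∀ a, (inp a).toNat = inp' a.toNat)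
    (hS : 16 * S ≤ 2 ^ W) (o : Op) (hrep : Represents s σ) (hsafe : o.Safe (2 ^ W) S σ)
    (hat : IsAt P s.pc o.compile) :
    ∃ s', Runs P inp (16 * S) s o.compile.length [] s' ∧ s'.pc = s.pc + o.compile.length ∧
      Represents s' (o.apply inp' σ) := by
  cases o with
  | const d k =>
    have h1 : s.instr P = _ := hat.head
    refine ⟨_, .single_silent ?_ ?_, ?_, ?_⟩
    · simp [Config.accessed, h1]
    · simp [Config.output, h1]
    · simp [Config.next, h1, Config.exec, Config.setReg, compile]
    · simp only [Config.next, h1, Config.exec]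
      exact hrep.setReg d (by simpa using Nat.mod_eq_of_lt hsafe)
  | add d a b =>
    have h1 : s.instr P = _ := hat.head
    refine ⟨_, .single_silent ?_ ?_, ?_, ?_⟩
    · simp [Config.accessed, h1]
    · simp [Config.output, h1]
    · simp [Config.next, h1, Config.exec, Config.setReg, compile]
    · simp only [Config.next, h1, Config.exec]
      refine hrep.setReg d ?_
      rw [BitVec.toNat_add_eq, hrep.reg, hrep.reg]
      rw [hrep.reg, hrep.reg]; exact hsafe
  | sub d a b =>
    have h1 : s.instr P = _ := hat.head
    refine ⟨_, .single_silent ?_ ?_, ?_, ?_⟩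
    · simp [Config.accessed, h1]
    · simp [Config.output, h1]
    · simp [Config.next, h1, Config.exec, Config.setReg, compile]
    · simp only [Config.next, h1, Config.exec]
      refine hrep.setReg d ?_
      rw [BitVec.toNat_sub_of_le, hrep.reg, hrep.reg]
      rw [BitVec.le_def, hrep.reg, hrep.reg]; exact hsafe
  | input d a =>
    have h1 : s.instr P = _ := hat.head
    refine ⟨_, .single_silent ?_ ?_, ?_, ?_⟩
    · simp [Config.accessed, h1]
    · simp [Config.output, h1]
    · simp [Config.next, h1, Config.exec, Config.setReg, compile]
    · simp only [Config.next, h1, Config.exec]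
      exact hrep.setReg d (by rw [hinp, hrep.reg])
  | load d k a =>
    obtain ⟨hk, ha⟩ := hsafe
    obtain ⟨s1, r1, hpc, h0, hrep1⟩ := runs_address (inp := inp) hrep
      (IsAt.left (l' := [.load (d + 2) 0]) hat)
    have h1 : s1.instr P = .load (d + 2) 0 := by
      rw [Config.instr, hpc]
      exact (IsAt.right (l := [.add 0 (a + 2) (a + 2), .add 0 0 0, .add 0 0 0, .add 0 0 0,
        .const 1 k, .add 0 0 1]) hat).head
    have hlt : 16 * σ.reg a + k < 2 ^ W := by omega
    refine ⟨_, .trans r1 (.single_silent ?_ ?_), ?_, ?_⟩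
    · simp only [Config.accessed, h1, h0, Option.some.injEq]
      rintro _ rfl
      simp only [BitVec.toNat_ofNat, Nat.mod_eq_of_lt hlt]
      omega
    · simp [Config.output, h1]
    · simp [Config.next, h1, Config.exec, Config.setReg, compile, hpc]
    · simp only [Config.next, h1, Config.exec, h0]
      exact hrep1.setReg d (hrep1.arr k hk _ hlt)
  | store k a b =>
    obtain ⟨hk, ha⟩ := hsafe
    obtain ⟨s1, r1, hpc, h0, hrep1⟩ := runs_address (inp := inp) hrep
      (IsAt.left (l' := [.store 0 (b + 2)]) hat)
    have h1 : s1.instr P = .store 0 (b + 2) := by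
      rw [Config.instr, hpc]
      exact (IsAt.right (l := [.add 0 (a + 2) (a + 2), .add 0 0 0, .add 0 0 0, .add 0 0 0,
        .const 1 k, .add 0 0 1]) hat).head
    have hlt : 16 * σ.reg a + k < 2 ^ W := by omega
    refine ⟨_, .trans r1 (.single_silent ?_ ?_), ?_, ?_⟩
    · simp only [Config.accessed, h1, h0, Option.some.injEq]
      rintro _ rfl
      simp only [BitVec.toNat_ofNat, Nat.mod_eq_of_lt hlt]
      omega
    · simp [Config.output, h1]
    · simp [Config.next, h1, Config.exec, compile, hpc]
    · simp only [Config.next, h1, Config.exec, h0]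
      refine ⟨fun r => hrep1.reg r, fun k' hk' i hi => ?_⟩
      simp only [Op.apply, ArrState.setArr]
      -- Array numbers are below 16, so the address determines both the array and the index, and a
      -- store does not affect any other cell.
      by_cases he : 16 * i + k' = 16 * σ.reg a + k
      · obtain ⟨rfl, rfl⟩ : i = σ.reg a ∧ k' = k := by omega
        simp [hrep1.reg]
      · rw [Function.update_of_ne]
        · rw [hrep1.arr k' hk' i hi]
          by_cases hkk : k' = k
          · subst hkk
            rw [Function.update_self, Function.update_of_ne (by omega)]
          · rw [Function.update_of_ne hkk]
        · intro h
          have := congrArg BitVec.toNat h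
          simp only [BitVec.toNat_ofNat, Nat.mod_eq_of_lt hlt, Nat.mod_eq_of_lt hi] at this
          exact he this

/-- Loop-free code executes each of its instructions at most once, so `size` bounds the time. Every
path ends with a jump, hence takes at least one step. -/
theorem Code.runs {W S : ℕ} {P : Program} {inp : BitVec W → BitVec W} {inp' : ℕ → ℕ}
    {off : ℕ → ℕ} (hinp : ∀ a, (inp a).toNat = inp' a.toNat) (hS : 16 * S ≤ 2 ^ W)
    {Q : List Output → ℕ → ArrState → Prop} (c : Code) {s : Config W} {σ : ArrState}
    (hrep : Represents s σ) (hwp : c.wp (2 ^ W) S inp' Q σ) (hat : IsAt P s.pc (c.compile off s.pc)) :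
    ∃ k s' os l σ', Runs P inp (16 * S) s k os s' ∧ 1 ≤ k ∧ k ≤ c.size ∧ s'.pc = off l ∧
      Represents s' σ' ∧ Q os l σ' := by
  induction c generalizing s σ Q with
  | goto l =>
    have h1 : s.instr P = _ := hat.head
    refine ⟨1, _, [], l, σ, .single_silent ?_ ?_, le_rfl, le_rfl, ?_, ?_, hwp⟩
    · simp [Config.accessed, h1]
    · simp [Config.output, h1]
    · simp [Config.next, h1, Config.exec]
    · refine hrep.congr_low (fun r => ?_) ?_ <;> simp [Config.next, h1, Config.exec]
  | halt => exact hwp.elim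
  | op o c ih =>
    obtain ⟨s1, r1, hpc, hrep1⟩ := o.runs hinp hS hrep hwp.1 (IsAt.left hat)
    obtain ⟨k, s2, os, l, σ2, r2, hk1, hk, hpc2, hrep2, hQ⟩ := ih hrep1 hwp.2
      (by rw [hpc]; exact IsAt.right hat)
    exact ⟨_, s2, os, l, σ2, by simpa using r1.trans r2, by omega, by simp [size]; omega, hpc2, hrep2, hQ⟩
  | emit a b d c ih =>
    have h1 : s.instr P = _ := hat.head
    obtain ⟨k, s2, os, l, σ2, r2, hk1, hk, hpc2, hrep2, hQ⟩ := ih (s := s.next P inp) (σ := σ)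
      (hrep.congr_low (by simp [Config.next, h1, Config.exec])
        (by simp [Config.next, h1, Config.exec])) hwp
      (by simpa [Config.next, h1, Config.exec] using hat.tail)
    refine ⟨_, s2, _, l, σ2, .step ?_ r2, by omega, by simp [size]; omega, hpc2, hrep2, ?_⟩
    · simp [Config.accessed, h1]
    · simpa [Config.output, h1, hrep.reg] using hQ
  | emitInf a b c ih =>
    have h1 : s.instr P = _ := hat.head
    obtain ⟨k, s2, os, l, σ2, r2, hk1, hk, hpc2, hrep2, hQ⟩ := ih (s := s.next P inp) (σ := σ)
      (hrep.congr_low (by simp [Config.next, h1, Config.exec])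
        (by simp [Config.next, h1, Config.exec])) hwp
      (by simpa [Config.next, h1, Config.exec] using hat.tail)
    refine ⟨_, s2, _, l, σ2, .step ?_ r2, by omega, by simp [size]; omega, hpc2, hrep2, ?_⟩
    · simp [Config.accessed, h1]
    · simpa [Config.output, h1, hrep.reg] using hQ
  | ifLt a b t e iht ihe =>
    have h1 : s.instr P = _ := hat.head
    have hrep1 : Represents (s.next P inp) σ :=
      hrep.congr_low (by simp [Config.next, h1, Config.exec])
        (by simp [Config.next, h1, Config.exec])
    have r1 : Runs P inp (16 * S) s 1 [] (s.next P inp) := by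
      refine .single_silent ?_ ?_
      · simp [Config.accessed, h1]
      · simp [Config.output, h1]
    by_cases hlt : σ.reg a < σ.reg b
    · have hpc : (s.next P inp).pc = s.pc + 1 + e.size := by
        simp [Config.next, h1, Config.exec, hrep.reg, hlt]
      obtain ⟨k, s2, os, l, σ2, r2, hk1, hk, hpc2, hrep2, hQ⟩ := iht hrep1 (hwp.1 hlt)
        (by rw [hpc]; have := IsAt.right hat.tail; rwa [length_compile] at this)
      exact ⟨_, s2, os, l, σ2, by simpa using r1.trans r2, by omega, by simp [size]; omega,
        hpc2, hrep2, hQ⟩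
    · have hpc : (s.next P inp).pc = s.pc + 1 := by
        simp [Config.next, h1, Config.exec, hrep.reg, hlt]
      obtain ⟨k, s2, os, l, σ2, r2, hk1, hk, hpc2, hrep2, hQ⟩ := ihe hrep1 (hwp.2 hlt)
        (by rw [hpc]; exact IsAt.left hat.tail)
      exact ⟨_, s2, os, l, σ2, by simpa using r1.trans r2, by omega, by simp [size]; omega,
        hpc2, hrep2, hQ⟩

/-! ## Linking the blocks -/

/-- The position at which block `l` starts. -/
def blockOffset (blocks : List Code) (l : ℕ) : ℕ := ((blocks.take l).map Code.size).sum

/-- The RAM program made of the blocks. -/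
def link (blocks : List Code) : Program :=
  (List.range blocks.length).flatMap fun l =>
    (blocks.getD l .halt).compile (blockOffset blocks) (blockOffset blocks l)

/-- The length of compiled code does not depend on the jump targets, so the offsets can be fixed in
advance and used in compiling all blocks, including for forward jumps. -/
theorem isAt_link (blocks : List Code) {l : ℕ} (hl : l < blocks.length) :
    IsAt (link blocks) (blockOffset blocks l)
      ((blocks.getD l .halt).compile (blockOffset blocks) (blockOffset blocks l)) := by
  have hsplit : List.range blocks.length =
      List.range l ++ l :: (List.range' (l + 1) (blocks.length - l - 1)) := by
    rw [List.range_eq_range', List.range_eq_range', ← List.range'_succ (step := 1),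
      show blocks.length = l + (blocks.length - l - 1 + 1) by omega]
    rw [List.range'_append_1.symm]; simp
  have hlen : ((List.range l).flatMap fun l =>
      (blocks.getD l .halt).compile (blockOffset blocks) (blockOffset blocks l)).length
      = blockOffset blocks l := by
    rw [List.length_flatMap, blockOffset]
    congr 1
    apply List.ext_getElem
    · simp; omega
    · intro i h1 h2
      have : i < blocks.length := by simp at h1; omega
      simp [Code.length_compile, List.getD, this]
  refine ⟨(List.range' (l + 1) (blocks.length - l - 1)).flatMap fun l =>
    (blocks.getD l .halt).compile (blockOffset blocks) (blockOffset blocks l), ?_⟩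
  rw [link, hsplit, List.flatMap_append, List.flatMap_cons, List.drop_append_of_le_length hlen.ge,
    ← hlen, List.drop_length, List.nil_append, hlen]

/-- `BlockRuns blocks V S inp X k os Y`: the idealized machine gets from `X` (a label and a state)
to `Y` by executing `k` blocks, with outputs `os`. -/
inductive BlockRuns (blocks : List Code) (V S : ℕ) (inp : ℕ → ℕ) :
    ℕ × ArrState → ℕ → List Output → ℕ × ArrState → Prop
  | refl (X) : BlockRuns blocks V S inp X 0 [] X
  | step {l σ l' σ' os k os' Y} (hl : l < blocks.length)
      (h : (blocks.getD l .halt).wp V S inp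
        (fun os' l'' τ => os' = os ∧ l'' = l' ∧ τ = σ') σ)
      (r : BlockRuns blocks V S inp (l', σ') k os' Y) :
      BlockRuns blocks V S inp (l, σ) (k + 1) (os ++ os') Y

namespace BlockRuns

variable {blocks : List Code} {V S : ℕ} {inp : ℕ → ℕ}

theorem trans {X Y Z : ℕ × ArrState} {k k' : ℕ} {os os' : List Output}
    (h : BlockRuns blocks V S inp X k os Y) (h' : BlockRuns blocks V S inp Y k' os' Z) :
    BlockRuns blocks V S inp X (k + k') (os ++ os') Z := by
  induction h with
  | refl s => simpa using h'
  | step hl h r ih =>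
    have := BlockRuns.step hl h (ih h')
    rw [List.append_assoc, Nat.add_right_comm]
    exact this

theorem trans_silent {X Y Z : ℕ × ArrState} {k k' : ℕ} {os : List Output}
    (h : BlockRuns blocks V S inp X k [] Y) (h' : BlockRuns blocks V S inp Y k' os Z) :
    BlockRuns blocks V S inp X (k + k') os Z := h.trans h'

theorem of_wp {Q : List Output → ℕ → ArrState → Prop} {l : ℕ} {σ : ArrState} (hl : l < blocks.length)
    (h : (blocks.getD l .halt).wp V S inp Q σ) :
    ∃ os l' σ', BlockRuns blocks V S inp (l, σ) 1 os (l', σ') ∧ Q os l' σ' := by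
  obtain ⟨os, l', σ', hQ, h'⟩ := Code.wp_iff.1 h
  exact ⟨os, l', σ', by simpa using BlockRuns.step hl h' (.refl _), hQ⟩

end BlockRuns

theorem size_le_length_link (blocks : List Code) {l : ℕ} (hl : l < blocks.length) :
    (blocks.getD l .halt).size ≤ (link blocks).length := by
  obtain ⟨r, h⟩ := isAt_link blocks hl
  have := congrArg List.length h
  simp only [List.length_drop, List.length_append, Code.length_compile] at this
  omega

/-- The RAM program simulates the idealized machine. -/
theorem BlockRuns.runs {blocks : List Code} {W S : ℕ} {inp : BitVec W → BitVec W} {inp' : ℕ → ℕ}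
    (hinp : ∀ a, (inp a).toNat = inp' a.toNat) (hS : 16 * S ≤ 2 ^ W) {X Y : ℕ × ArrState} {k : ℕ}
    {os : List Output} (h : BlockRuns blocks (2 ^ W) S inp' X k os Y) {s : Config W}
    (hpc : s.pc = blockOffset blocks X.1) (hrep : Represents s X.2) :
    ∃ k' s', Runs (link blocks) inp (16 * S) s k' os s' ∧ k ≤ k' ∧
      k' ≤ (link blocks).length * k ∧ s'.pc = blockOffset blocks Y.1 ∧ Represents s' Y.2 := by
  induction h generalizing s with
  | refl X => exact ⟨0, s, .refl s, le_rfl, by simp, hpc, hrep⟩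
  | @step l σ l' σ' os k os' Y hl h r ih =>
    obtain ⟨k1, s1, os1, l1, σ1, r1, hk1, hk, hpc1, hrep1, rfl, rfl, rfl⟩ :=
      Code.runs hinp hS _ hrep h (P := link blocks) (off := blockOffset blocks)
        (by rw [hpc]; exact isAt_link blocks hl)
    obtain ⟨k2, s2, r2, hle, hle2, hpc2, hrep2⟩ := ih hpc1 hrep1
    refine ⟨k1 + k2, s2, r1.trans r2, by omega, ?_, hpc2, hrep2⟩
    have := size_le_length_link blocks hl
    rw [Nat.mul_succ]
    omega

theorem halted_of_block {blocks : List Code} {W l : ℕ} {s : Config W} (hl : l < blocks.length)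
    (hb : blocks.getD l .halt = .halt) (hpc : s.pc = blockOffset blocks l) :
    s.Halted (link blocks) := by
  have := isAt_link blocks hl
  rw [hb] at this
  unfold Config.Halted Config.instr
  rw [hpc]
  exact this.head

/-- The idealized memory represented by the initial configuration. -/
theorem rep_init {W : ℕ} (M : BitVec W → BitVec W) :
    Represents (⟨0, fun _ => 0, M⟩ : Config W)
      ⟨fun _ => 0, fun k i => (M (BitVec.ofNat W (16 * i + k))).toNat⟩ :=
  ⟨fun _ => by simp, fun _ _ _ _ => rfl⟩

/-! ## Single-source shortest distances in small steps

The search is Dijkstra's algorithm with a radix heap. The vertices are kept in an array `ord`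
(with inverse `idx`) that is divided into segments: first the finished vertices, then segment
`top`, then segment `top - 1`, and so on up to segment `0`. Segment `p` occupies the positions from
`bd (p + 1)` to `bd p` and is meant for the vertices whose keys lie in the interval from `lo p` to
`lo (p - 1)`, of length `2 ^ lev p`; segment `0` is for vertices not reached so far. A vertex moves
to the next segment by being swapped to the front of its own. The number `n` serves as a dummy
vertex. -/

/-- The state of the search. -/
structure Search where
  key : ℕ → ℕ
  buf : ℕ → ℕ
  ord : ℕ → ℕ
  idx : ℕ → ℕ
  pos : ℕ → ℕ
  bd : ℕ → ℕ
  lo : ℕ → ℕ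
  lev : ℕ → ℕ
  top : ℕ
  -- `i` and `iend` delimit the part of a split segment still to be scanned, `e` and `eend` the
  -- unread edges of the current vertex `cu`. The vertex `v` is the one that may have to move, and
  -- `z` counts the initialized cells. The array `buf` keeps the keys of the previous search.
  i : ℕ
  iend : ℕ
  e : ℕ
  eend : ℕ
  cu : ℕ
  v : ℕ
  z : ℕ

/-- The address of the block of vertex `u`. -/
def blockAddr (inp : ℕ → ℕ) (u : ℕ) : ℕ := inp (u + 1)

def degreeOf (inp : ℕ → ℕ) (u : ℕ) : ℕ := inp (blockAddr inp u)

/-- The head of edge number `k` of vertex `u`. -/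
def headOf (inp : ℕ → ℕ) (u k : ℕ) : ℕ := inp (blockAddr inp u + 1 + 2 * k)

def weightOf (inp : ℕ → ℕ) (u k : ℕ) : ℕ := inp (blockAddr inp u + 1 + 2 * k + 1)

namespace Search

open Function (update)

/-- Initialization of one cell. -/
def initStep (n L src : ℕ) (S : Search) : Search :=
  { S with
    -- The old key is saved before it is reset. Cell `n`, that of the dummy, comes last, and only
    -- then is the key of the source set to `0`, its own cell having been reset by then.
    buf := update S.buf S.z (S.key S.z)
    key := if S.z < n then update S.key S.z (2 ^ L) else update (update S.key S.z (2 ^ L)) src 0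
    pos := update S.pos S.z 0
    z := S.z + 1 }

/-- Vertex `v` moves to the next segment. -/
def moveStep (S : Search) : Search :=
  { S with
    ord := update (update S.ord (S.idx S.v) (S.ord (S.bd (S.pos S.v + 1)))) (S.bd (S.pos S.v + 1)) S.v
    idx := update (update S.idx (S.ord (S.bd (S.pos S.v + 1))) (S.idx S.v)) S.v (S.bd (S.pos S.v + 1))
    bd := update S.bd (S.pos S.v + 1) (S.bd (S.pos S.v + 1) + 1)
    pos := update S.pos S.v (S.pos S.v + 1) }

/-- The next vertex of a segment that has been split is considered. -/
def scanStep (S : Search) : Search := { S with v := S.ord S.i, i := S.i + 1 }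

/-- The next edge of the current vertex is relaxed. -/
def relaxStep (inp : ℕ → ℕ) (S : Search) : Search :=
  if S.key S.cu + inp (S.e + 1) < S.key (inp S.e) then
    { S with
      e := S.e + 2
      key := update S.key (inp S.e) (S.key S.cu + inp (S.e + 1))
      v := inp S.e }
  else { S with e := S.e + 2 }

/-- The top segment is split. -/
def splitStep (n : ℕ) (S : Search) : Search :=
  { S with
    -- The lower half of the interval becomes a new top segment, empty at first. The vertices all
    -- stay in the upper half, which keeps the index `S.top`, until the scan reaches them.
    lo := update (update S.lo (S.top + 1) (S.lo S.top)) S.top (S.lo S.top + 2 ^ (S.lev S.top - 1))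
    lev := update (update S.lev (S.top + 1) (S.lev S.top - 1)) S.top (S.lev S.top - 1)
    bd := update S.bd (S.top + 2) (S.bd (S.top + 1))
    i := S.bd (S.top + 1)
    iend := S.bd S.top
    top := S.top + 1
    -- The dummy is never moved: its key `2 ^ L` equals `lo 0`, the lower end of its segment.
    v := n }

/-- A vertex of the top segment is finished, and becomes the current one. -/
def popStep (n : ℕ) (inp : ℕ → ℕ) (S : Search) : Search :=
  { S with
    bd := update S.bd (S.top + 1) (S.bd (S.top + 1) + 1)
    cu := S.ord (S.bd (S.top + 1))
    e := blockAddr inp (S.ord (S.bd (S.top + 1))) + 1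
    eend := blockAddr inp (S.ord (S.bd (S.top + 1))) + 1 +
      2 * degreeOf inp (S.ord (S.bd (S.top + 1)))
    v := n }

/-- The empty top segment is dropped. -/
def dropStep (S : Search) : Search := { S with top := S.top - 1 }

/-- The order of the tests sets the priorities: a misplaced vertex moves before the next one is
scanned, a scan ends before an edge is relaxed, and all edges of the current vertex are relaxed
before the top segment is touched. -/
def mainStep (n : ℕ) (inp : ℕ → ℕ) (S : Search) : Search :=
  if S.key S.v < S.lo (S.pos S.v) then S.moveStep
  else if S.i < S.iend then S.scanStep
  else if S.e < S.eend then S.relaxStep inp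
  else if 0 < S.top then
    if S.bd (S.top + 1) < S.bd S.top then
      if 0 < S.lev S.top then S.splitStep n else S.popStep n inp
    else S.dropStep
  else S

def step (n L src : ℕ) (inp : ℕ → ℕ) (S : Search) : Search :=
  if n < S.z then S.mainStep n inp else S.initStep n L src

/-- What the search needs to know about the graph; `Walk u k` says that there is a walk of weight
`k` from the source to `u`. -/
structure Setting (n L src wmax : ℕ) (inp : ℕ → ℕ) (Walk : ℕ → ℕ → Prop) : Prop where
  src_lt : src < n
  walk_src : Walk src 0
  head_lt : ∀ u < n, ∀ k < degreeOf inp u, headOf inp u k < n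
  weight_le : ∀ u < n, ∀ k < degreeOf inp u, weightOf inp u k ≤ wmax
  walk_head : ∀ u < n, ∀ k < degreeOf inp u, ∀ x, Walk u x →
    Walk (headOf inp u k) (x + weightOf inp u k)
  -- Finite distances are at most `n * wmax`, so `2 ^ L` can serve as the key of an unreached
  -- vertex.
  lt_pow : n * wmax < 2 ^ L

/-- The invariant of the search after initialization. -/
structure Inv (n L src wmax : ℕ) (inp : ℕ → ℕ) (Walk : ℕ → ℕ → Prop) (S : Search) : Prop where
  ord_lt : ∀ q < n, S.ord q < n
  idx_lt : ∀ u < n, S.idx u < n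
  ord_idx : ∀ u < n, S.ord (S.idx u) = u
  idx_ord : ∀ q < n, S.idx (S.ord q) = q
  bd_zero : S.bd 0 = n
  bd_anti : ∀ p ≤ S.top, S.bd (p + 1) ≤ S.bd p
  -- The condition `S.bd (S.top + 1) ≤ S.idx u` says that `u` is unfinished; `S.bd (S.top + 1)` is
  -- also the number of finished vertices.
  seg : ∀ u < n, S.bd (S.top + 1) ≤ S.idx u →
    S.pos u ≤ S.top ∧ S.bd (S.pos u + 1) ≤ S.idx u ∧ S.idx u < S.bd (S.pos u)
  lo_zero : S.lo 0 = 2 ^ L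
  lo_succ : ∀ p < S.top, S.lo (p + 1) + 2 ^ S.lev (p + 1) = S.lo p
  lev_zero : S.lev 0 = L
  lev_anti : ∀ p < S.top, S.lev (p + 1) ≤ S.lev p
  -- This bounds the number of segments, and with it both the space for the segment tables and the
  -- number of moves of a vertex.
  lev_add : ∀ p ≤ S.top, p + S.lev p ≤ L + 1
  key_le : ∀ u ≤ n, S.key u ≤ 2 ^ L
  le_key : ∀ u < n, S.bd (S.top + 1) ≤ S.idx u → S.lo S.top ≤ S.key u
  key_lt : ∀ u < n, S.bd (S.top + 1) ≤ S.idx u → ∀ p, S.pos u = p + 1 → S.key u < S.lo p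
  -- A key can violate only the lower end of its segment, as `key_lt` holds throughout; a misplaced
  -- vertex thus moves towards the top only. The exceptions allowed are the vertex `v` and the part
  -- of a split segment not yet scanned.
  placed : ∀ u < n, S.bd (S.top + 1) ≤ S.idx u →
    S.lo (S.pos u) ≤ S.key u ∨ u = S.v ∨ (S.i ≤ S.idx u ∧ S.idx u < S.iend)
  scan : S.i < S.iend → S.bd (S.top + 1) ≤ S.i ∧ S.iend ≤ n ∧ (S.v = n ∨ S.idx S.v < S.i)
  v_eq : S.v = n ∨ (S.v < n ∧ S.bd (S.top + 1) ≤ S.idx S.v)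
  key_dummy : S.key n = 2 ^ L
  pos_dummy : S.pos n = 0
  z_eq : S.z = n + 1
  key_src : S.key src = 0
  walk : ∀ u < n, S.key u < 2 ^ L → Walk u (S.key u)
  -- Each finished vertex adds at most one edge to the walks behind the keys. This keeps the keys of
  -- reached vertices below `2 ^ L`.
  key_bound : ∀ u < n, S.key u < 2 ^ L → S.key u ≤ S.bd (S.top + 1) * wmax
  finished : ∀ u < n, S.idx u < S.bd (S.top + 1) → S.key u ≤ S.lo S.top ∧ S.key u < 2 ^ L
  current : S.e < S.eend → S.cu < n ∧ S.idx S.cu < S.bd (S.top + 1) ∧ S.key S.cu = S.lo S.top ∧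
    S.key S.cu + wmax ≤ S.bd (S.top + 1) * wmax ∧ ∃ k < degreeOf inp S.cu,
      S.e = blockAddr inp S.cu + 1 + 2 * k ∧
      S.eend = blockAddr inp S.cu + 1 + 2 * degreeOf inp S.cu
  relaxed : ∀ u < n, S.idx u < S.bd (S.top + 1) → ∀ k < degreeOf inp u,
    S.key (headOf inp u k) ≤ S.key u + weightOf inp u k ∨
      (u = S.cu ∧ S.e ≤ blockAddr inp u + 1 + 2 * k ∧ S.e < S.eend)

variable {n L src wmax : ℕ} {inp : ℕ → ℕ} {Walk : ℕ → ℕ → Prop} {S : Search}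

/-! ### The steps of the search preserve the invariant -/

namespace Inv

theorem bd_le (h : Inv n L src wmax inp Walk S) {p p' : ℕ} (hpp : p ≤ p') (hp : p' ≤ S.top + 1) :
    S.bd p' ≤ S.bd p := by
  induction p', hpp using Nat.le_induction with
  | base => rfl
  | succ m hm ih => exact (h.bd_anti m (by omega)).trans (ih (by omega))

theorem lo_le (h : Inv n L src wmax inp Walk S) {p p' : ℕ} (hpp : p ≤ p') (hp : p' ≤ S.top) :
    S.lo p' ≤ S.lo p := by
  induction p', hpp using Nat.le_induction with
  | base => rfl
  | succ m hm ih =>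
    exact (Nat.le.intro (h.lo_succ m (by omega))).trans (ih (by omega))

theorem bd_le_n (h : Inv n L src wmax inp Walk S) {p : ℕ} (hp : p ≤ S.top + 1) : S.bd p ≤ n :=
  h.bd_zero ▸ h.bd_le (Nat.zero_le p) hp

/-- The position determines the segment. -/
theorem pos_eq (h : Inv n L src wmax inp Walk S) {u p : ℕ} (hu : u < n) (hp : p ≤ S.top)
    (h1 : S.bd (p + 1) ≤ S.idx u) (h2 : S.idx u < S.bd p) : S.pos u = p := by
  obtain ⟨h3, h4, h5⟩ := h.seg u hu ((h.bd_le (by omega) le_rfl).trans h1)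
  rcases lt_trichotomy (S.pos u) p with hlt | rfl | hlt
  · have := h.bd_le (p := S.pos u + 1) (p' := p) hlt (by omega)
    omega
  · rfl
  · have := h.bd_le (p := p + 1) (p' := S.pos u) hlt (by omega)
    omega

/-- The facts that make moving `v` possible. -/
theorem move_facts (h : Inv n L src wmax inp Walk S) (hv : S.key S.v < S.lo (S.pos S.v)) :
    S.v < n ∧ S.bd (S.top + 1) ≤ S.idx S.v ∧ S.pos S.v < S.top ∧
    S.bd (S.pos S.v + 1) ≤ S.idx S.v ∧ S.idx S.v < S.bd (S.pos S.v) ∧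
    S.bd (S.pos S.v) ≤ n ∧ S.bd (S.top + 1) ≤ S.bd (S.pos S.v + 1) ∧
    S.ord (S.bd (S.pos S.v + 1)) < n ∧
    S.idx (S.ord (S.bd (S.pos S.v + 1))) = S.bd (S.pos S.v + 1) ∧
    S.pos (S.ord (S.bd (S.pos S.v + 1))) = S.pos S.v := by
  have hvn : S.v < n ∧ S.bd (S.top + 1) ≤ S.idx S.v := by
    rcases h.v_eq with hv' | hv'
    · rw [hv', h.key_dummy, h.pos_dummy, h.lo_zero] at hv
      exact (lt_irrefl _ hv).elim
    · exact hv'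
  obtain ⟨hvn, hvd⟩ := hvn
  obtain ⟨h1, h2, h3⟩ := h.seg _ hvn hvd
  have hlt : S.pos S.v < S.top := by
    refine lt_of_le_of_ne h1 fun he => ?_
    have := h.le_key _ hvn hvd
    rw [he] at hv
    omega
  have h4 := h.bd_le_n (p := S.pos S.v) (by omega)
  have h5 := h.bd_le (p := S.pos S.v + 1) (p' := S.top + 1) (by omega) le_rfl
  have h6 := h.idx_ord (S.bd (S.pos S.v + 1)) (by omega)
  have h7 := h.ord_lt (S.bd (S.pos S.v + 1)) (by omega)
  exact ⟨hvn, hvd, hlt, h2, h3, h4, h5, h7, h6, h.pos_eq h7 hlt.le (by omega) (by omega)⟩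

/-- Exchanging `v` with the vertex `x` at the front of its segment and advancing the boundary past
the front hands `v` alone over to the next segment. The vertex `x` keeps its segment, and finished
vertices are not affected. -/
theorem moveStep (h : Inv n L src wmax inp Walk S) (hv : S.key S.v < S.lo (S.pos S.v)) :
    Inv n L src wmax inp Walk S.moveStep := by
  obtain ⟨hvn, hvd, hlt, h1, h2, h3, h4, h5, h6, h7⟩ := h.move_facts hv
  have hov := h.ord_idx _ hvn
  have hivn := h.idx_lt _ hvn
  unfold Search.moveStep
  generalize hp : S.pos S.v = p at *
  generalize hq : S.bd (p + 1) = q at *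
  generalize hx : S.ord q = x at *
  generalize hr : S.idx S.v = r at *
  have htop : S.top + 1 ≠ p + 1 := by omega
  have hD : update S.bd (p + 1) (q + 1) (S.top + 1) = S.bd (S.top + 1) := by
    rw [Function.update_of_ne htop]
  have hidx : ∀ u, update (update S.idx x r) S.v q u =
      if u = S.v then q else if u = x then r else S.idx u := by
    intro u; simp only [Function.update_apply]
  have hpos : ∀ u, update S.pos S.v (p + 1) u = if u = S.v then p + 1 else S.pos u := by
    intro u; simp only [Function.update_apply]
  have hord : ∀ u, update (update S.ord r x) q S.v u =
      if u = q then S.v else if u = r then x else S.ord u := by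
    intro u; simp only [Function.update_apply]
  have hbd : ∀ u, update S.bd (p + 1) (q + 1) u = if u = p + 1 then q + 1 else S.bd u := by
    intro u; simp only [Function.update_apply]
  -- The exchange takes place among unfinished positions, so the set of finished vertices stays the
  -- same.
  have hdone : ∀ u < n, S.bd (S.top + 1) ≤ (if u = S.v then q else if u = x then r else S.idx u) ↔
      S.bd (S.top + 1) ≤ S.idx u := by
    intro u hu
    split_ifs with ha hb
    · subst ha; omega
    · subst hb; omega
    · rfl
  have hvx : S.v = x → q = r := by rintro rfl; omega
  have hinj : ∀ u < n, ∀ w < n, S.idx u = S.idx w → u = w := fun u hu w hw he => by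
    rw [← h.ord_idx u hu, he, h.ord_idx w hw]
  constructor
  all_goals simp only [hD, hidx, hpos, hord, hbd]
  · intro q' hq'
    have := h.ord_lt q' hq'
    split_ifs <;> assumption
  · intro u hu
    have := h.idx_lt u hu
    split_ifs <;> omega
  · intro u hu
    have := h.ord_idx u hu
    have := hinj u hu
    grind
  · intro q' hq'
    have := h.idx_ord q' hq'
    have := h.ord_lt q' hq'
    grind
  · simpa using h.bd_zero
  · intro p' hp'
    have hp'' := h.bd_anti p' hp'
    have := h.bd_anti p (by omega)
    split_ifs with ha hb hb
    · omega
    · have : p' = p := by omega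
      subst this; omega
    · subst hb; omega
    · exact hp''
  · intro u hu hd
    have hd' := (hdone u hu).1 (by simpa using hd)
    obtain ⟨h8, h9, h10⟩ := h.seg u hu hd'
    by_cases huv : u = S.v
    · subst huv
      have := h.bd_anti (p + 1) (by omega)
      simp
      omega
    · have hne : S.idx u ≠ r := fun he => huv (hinj u hu _ hvn (by omega))
      by_cases hux : u = x
      · subst hux
        have : q ≠ r := by omega
        simp only [if_neg huv, if_true, h7]
        rw [if_neg (by omega : ¬ p = p + 1)]
        omega
      · have : S.idx u ≠ q := fun he => hux (hinj u hu x h5 (by omega))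
        simp only [if_neg huv, if_neg hux]
        refine ⟨h8, ?_, ?_⟩
        · split_ifs with ha
          · have : S.pos u = p := by omega
            rw [this] at h9
            omega
          · exact h9
        · split_ifs with ha
          · rw [ha] at h10; omega
          · exact h10
  · exact h.lo_zero
  · exact h.lo_succ
  · exact h.lev_zero
  · exact h.lev_anti
  · exact h.lev_add
  · exact h.key_le
  · intro u hu hd
    exact h.le_key u hu ((hdone u hu).1 (by simpa using hd))
  · intro u hu hd p' hp'
    have := h.key_lt u hu ((hdone u hu).1 (by simpa using hd)) p'
    split_ifs at hp' with ha
    · subst ha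
      obtain rfl : p = p' := by omega
      exact hv
    · exact this hp'
  · intro u hu hd
    have hd' := (hdone u hu).1 (by simpa using hd)
    by_cases huv : u = S.v
    · exact Or.inr (Or.inl huv)
    · rcases h.placed u hu hd' with h8 | h8 | h8
      · left; simpa [huv] using h8
      · exact Or.inr (Or.inl h8)
      · right; right
        obtain ⟨h9, h10, h11⟩ := h.scan (by omega)
        by_cases hux : u = x
        · subst hux
          rw [h6] at h8
          -- The exchange cannot throw `x` out of the range to be scanned, since `x` was not in it:
          -- its position `q` is at most `r`, the position of `v`, which has been scanned already.
          rcases h11 with h11 | h11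
          · omega
          · omega
        · simpa [huv, hux] using h8
  · intro hi
    obtain ⟨h9, h10, h11⟩ := h.scan hi
    refine ⟨h9, h10, ?_⟩
    rcases h11 with h11 | h11
    · exact Or.inl h11
    · right; simp; omega
  · right; simp; omega
  · exact h.key_dummy
  · rw [if_neg (by omega)]; exact h.pos_dummy
  · exact h.z_eq
  · exact h.key_src
  · exact h.walk
  · exact h.key_bound
  · intro u hu hd
    refine h.finished u hu ?_
    have := hdone u hu
    omega
  · intro he
    obtain ⟨c1, c2, c3⟩ := h.current he
    refine ⟨c1, ?_, c3⟩
    have := hdone _ c1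
    omega
  · intro u hu hd
    refine h.relaxed u hu ?_
    have := hdone u hu
    omega

/-- The old `v` has just passed the test, so it needs no exemption from `placed`. The exemption
passes to the vertex at position `i`, which leaves the range. -/
theorem scanStep (h : Inv n L src wmax inp Walk S) (hv : ¬ S.key S.v < S.lo (S.pos S.v))
    (hi : S.i < S.iend) : Inv n L src wmax inp Walk S.scanStep := by
  obtain ⟨h1, h2, h3⟩ := h.scan hi
  refine { h with placed := ?_, scan := ?_, v_eq := ?_ }
  · intro u hu hd
    rcases h.placed u hu hd with h8 | h8 | h8
    · exact Or.inl h8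
    · left; subst h8; exact not_lt.1 hv
    · right
      by_cases he : S.idx u = S.i
      · left
        change u = S.ord S.i
        rw [← he, h.ord_idx u hu]
      · right
        change S.i + 1 ≤ S.idx u ∧ _
        exact ⟨by omega, h8.2⟩
  · intro hi'
    change S.bd (S.top + 1) ≤ S.i + 1 ∧ S.iend ≤ n ∧ (_ ∨ S.idx (S.ord S.i) < S.i + 1)
    rw [h.idx_ord S.i (by omega)]
    omega
  · right
    change S.ord S.i < n ∧ S.bd (S.top + 1) ≤ S.idx (S.ord S.i)
    rw [h.idx_ord S.i (by omega)]
    exact ⟨h.ord_lt _ (by omega), h1⟩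

/-- Finished keys are at most `lo top`, the key of the current vertex, so a vertex whose key is
improved is unfinished. Its new key is still at least `lo top`; if this is too small for its
segment, the exemption for `v` covers it. -/
theorem relaxStep (hs : Setting n L src wmax inp Walk) (h : Inv n L src wmax inp Walk S)
    (hv : ¬ S.key S.v < S.lo (S.pos S.v))
    (hi : ¬ S.i < S.iend) (he : S.e < S.eend) : Inv n L src wmax inp Walk (S.relaxStep inp) := by
  obtain ⟨c1, c2, c3, c4, k, hk, c5, c6⟩ := h.current he
  have hx : inp S.e = headOf inp S.cu k := by rw [c5]; rfl
  have hw : inp (S.e + 1) = weightOf inp S.cu k := by rw [c5]; rfl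
  have hxn := hs.head_lt _ c1 k hk
  have hwm := hs.weight_le _ c1 k hk
  unfold Search.relaxStep
  rw [hx, hw]
  have hcur : S.e + 2 < S.eend → S.cu < n ∧ S.idx S.cu < S.bd (S.top + 1) ∧
      S.key S.cu = S.lo S.top ∧
      S.key S.cu + wmax ≤ S.bd (S.top + 1) * wmax ∧ ∃ k < degreeOf inp S.cu,
      S.e + 2 = blockAddr inp S.cu + 1 + 2 * k ∧
      S.eend = blockAddr inp S.cu + 1 + 2 * degreeOf inp S.cu := by
    intro he'
    exact ⟨c1, c2, c3, c4, k + 1, by omega, by omega, c6⟩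
  split_ifs with hlt
  · generalize hX : headOf inp S.cu k = x at *
    generalize hnk : S.key S.cu + weightOf inp S.cu k = nk at *
    have hxd : S.bd (S.top + 1) ≤ S.idx x := by
      by_contra hc
      have := (h.finished x hxn (by omega)).1
      omega
    have hkey : ∀ u, update S.key x nk u = if u = x then nk else S.key u := by
      intro u; simp only [Function.update_apply]
    have hle : ∀ u, update S.key x nk u ≤ S.key u := by
      intro u; rw [hkey]; split_ifs with hu
      · subst hu; omega
      · rfl
    have hdn : ∀ u, S.idx u < S.bd (S.top + 1) → update S.key x nk u = S.key u := by
      intro u hu; rw [hkey, if_neg]; rintro rfl; omega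
    have hD := h.bd_le_n (p := S.top + 1) le_rfl
    have hDn : S.bd (S.top + 1) * wmax ≤ n * wmax := Nat.mul_le_mul_right _ hD
    have hpw := hs.lt_pow
    refine { h with
      key_le := fun u hu => (hle u).trans (h.key_le u hu)
      le_key := ?_, key_lt := ?_, placed := ?_, scan := fun hi' => absurd hi' hi
      v_eq := Or.inr ⟨hxn, hxd⟩, key_dummy := ?_, key_src := ?_
      walk := ?_, key_bound := ?_, finished := ?_, current := ?_, relaxed := ?_ }
    · intro u hu hd
      have := h.le_key u hu hd
      change _ ≤ update S.key x nk u
      rw [hkey]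
      split_ifs <;> simp <;> omega
    · intro u hu hd p hp
      exact (hle u).trans_lt (h.key_lt u hu hd p hp)
    · intro u hu hd
      by_cases hux : u = x
      · exact Or.inr (Or.inl hux)
      · left
        change S.lo (S.pos u) ≤ update S.key x nk u
        rw [hkey, if_neg hux]
        rcases h.placed u hu hd with h8 | h8 | h8
        · exact h8
        · subst h8; exact not_lt.1 hv
        · omega
    · change update S.key x nk n = _
      rw [hkey, if_neg (by omega)]; exact h.key_dummy
    · change update S.key x nk src = _
      have := hle src
      rw [h.key_src] at this
      omega
    · intro u hu hlt'
      change Walk u (update S.key x nk u)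
      change update S.key x nk u < _ at hlt'
      rw [hkey] at hlt' ⊢
      split_ifs with hux
      · subst hux
        have := hs.walk_head _ c1 k hk _ (h.walk _ c1 (h.finished _ c1 c2).2)
        rwa [hX, hnk] at this
      · rw [if_neg hux] at hlt'
        exact h.walk u hu hlt'
    · intro u hu hlt'
      change update S.key x nk u ≤ _
      change update S.key x nk u < _ at hlt'
      rw [hkey] at hlt' ⊢
      split_ifs with hux
      · change nk ≤ S.bd (S.top + 1) * wmax
        omega
      · rw [if_neg hux] at hlt'
        exact h.key_bound u hu hlt'
    · intro u hu hd
      change update S.key x nk u ≤ _ ∧ update S.key x nk u < _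
      rw [hdn u hd]
      exact h.finished u hu hd
    · intro he'
      change S.cu < n ∧ S.idx S.cu < S.bd (S.top + 1) ∧ update S.key x nk S.cu = S.lo S.top ∧
        update S.key x nk S.cu + wmax ≤ S.bd (S.top + 1) * wmax ∧ _
      rw [hdn _ c2]
      exact hcur he'
    · intro u hu hd k' hk'
      change update S.key x nk _ ≤ update S.key x nk u + _ ∨ _
      rw [hdn u hd]
      rcases h.relaxed u hu hd k' hk' with h8 | ⟨rfl, h8, h9⟩
      · exact Or.inl ((hle _).trans h8)
      · by_cases hkk : k' = k
        · left
          subst hkk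
          rw [hX, hkey, if_pos rfl, hnk]
        · right
          refine ⟨rfl, ?_, ?_⟩
          · change S.e + 2 ≤ _
            omega
          · change S.e + 2 < S.eend
            omega
  · refine { h with
      scan := fun hi' => absurd hi' hi
      current := hcur, relaxed := ?_ }
    intro u hu hd k' hk'
    rcases h.relaxed u hu hd k' hk' with h8 | ⟨rfl, h8, h9⟩
    · exact Or.inl h8
    · by_cases hkk : k' = k
      · left
        subst hkk
        exact not_lt.1 hlt
      · right
        refine ⟨rfl, ?_, ?_⟩
        · change S.e + 2 ≤ _
          omega
        · change S.e + 2 < S.eend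
          omega

/-- Nothing is misplaced at this moment and the top segment is empty, so the unfinished keys respect
the lower end of the segment below it. -/
theorem dropStep (h : Inv n L src wmax inp Walk S)
    (hv : ¬ S.key S.v < S.lo (S.pos S.v)) (hi : ¬ S.i < S.iend) (he : ¬ S.e < S.eend)
    (ht : 0 < S.top) (hb : ¬ S.bd (S.top + 1) < S.bd S.top) :
    Inv n L src wmax inp Walk S.dropStep := by
  have hD : S.bd (S.top - 1 + 1) = S.bd (S.top + 1) := by
    rw [Nat.sub_add_cancel ht]
    have := h.bd_anti S.top le_rfl
    omega
  have hseg : ∀ u < n, S.bd (S.top + 1) ≤ S.idx u → S.pos u ≤ S.top - 1 := by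
    intro u hu hd
    obtain ⟨h1, h2, h3⟩ := h.seg u hu hd
    have : S.pos u ≠ S.top := fun h => by rw [h] at h3; omega
    omega
  have hpl : ∀ u < n, S.bd (S.top + 1) ≤ S.idx u → S.lo (S.pos u) ≤ S.key u := by
    intro u hu hd
    rcases h.placed u hu hd with h8 | h8 | h8
    · exact h8
    · subst h8; exact not_lt.1 hv
    · omega
  have hlo : S.lo S.top ≤ S.lo (S.top - 1) := h.lo_le (by omega) le_rfl
  unfold Search.dropStep
  constructor
  all_goals simp only [hD]
  · exact h.ord_lt
  · exact h.idx_lt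
  · exact h.ord_idx
  · exact h.idx_ord
  · exact h.bd_zero
  · exact fun p hp => h.bd_anti p (by omega)
  · exact fun u hu hd => ⟨hseg u hu hd, (h.seg u hu hd).2⟩
  · exact h.lo_zero
  · exact fun p hp => h.lo_succ p (by omega)
  · exact h.lev_zero
  · exact fun p hp => h.lev_anti p (by omega)
  · exact fun p hp => h.lev_add p (by omega)
  · exact h.key_le
  · exact fun u hu hd => (h.lo_le (hseg u hu hd) (by omega)).trans (hpl u hu hd)
  · exact h.key_lt
  · exact h.placed
  · exact h.scan
  · exact h.v_eq
  · exact h.key_dummy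
  · exact h.pos_dummy
  · exact h.z_eq
  · exact h.key_src
  · exact h.walk
  · exact h.key_bound
  · exact fun u hu hd => ⟨(h.finished u hu hd).1.trans hlo, (h.finished u hu hd).2⟩
  · exact fun he' => absurd he' he
  · exact h.relaxed

/-- The range to be scanned is exactly the segment that is split, so it exempts all vertices that
raising the lower end of the upper half may have misplaced. -/
theorem splitStep (h : Inv n L src wmax inp Walk S) (he : ¬ S.e < S.eend)
    (hv : ¬ S.key S.v < S.lo (S.pos S.v)) (hi : ¬ S.i < S.iend)
    (ht : 0 < S.top) (hl : 0 < S.lev S.top) :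
    Inv n L src wmax inp Walk (S.splitStep n) := by
  obtain ⟨l, hl'⟩ : ∃ l, S.lev S.top = l + 1 := ⟨_, (Nat.sub_add_cancel hl).symm⟩
  unfold Search.splitStep
  rw [hl']
  simp only [Nat.add_sub_cancel]
  generalize htt : S.top = t at *
  have hbd : ∀ p, update S.bd (t + 2) (S.bd (t + 1)) p =
      if p = t + 2 then S.bd (t + 1) else S.bd p := by
    intro u; simp only [Function.update_apply]
  have hlo : ∀ p, update (update S.lo (t + 1) (S.lo t)) t (S.lo t + 2 ^ l) p =
      if p = t then S.lo t + 2 ^ l else if p = t + 1 then S.lo t else S.lo p := by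
    intro u; simp only [Function.update_apply]
  have hlev : ∀ p, update (update S.lev (t + 1) l) t l p =
      if p = t then l else if p = t + 1 then l else S.lev p := by
    intro u; simp only [Function.update_apply]
  have hpl : ∀ u < n, S.bd (t + 1) ≤ S.idx u → S.lo (S.pos u) ≤ S.key u := by
    intro u hu hd
    rcases h.placed u hu (by rwa [htt]) with h8 | h8 | h8
    · exact h8
    · subst h8; exact not_lt.1 hv
    · omega
  have hseg := h.seg
  have hanti := h.lev_anti
  have hadd := h.lev_add
  rw [htt] at hseg hanti hadd
  have hDn : S.bd t ≤ n := h.bd_le_n (by omega)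
  have hD : update S.bd (t + 2) (S.bd (t + 1)) (t + 1 + 1) = S.bd (t + 1) := by simp
  constructor
  all_goals simp only [hD]
  · exact h.ord_lt
  · exact h.idx_lt
  · exact h.ord_idx
  · exact h.idx_ord
  · simpa using h.bd_zero
  · intro p hp
    have := h.bd_anti p
    simp only [hbd]
    split_ifs with h1 h2 h2
    · omega
    · have : p = t + 1 := by omega
      subst this; rfl
    · omega
    · exact this (by omega)
  · intro u hu hd
    obtain ⟨h1, h2, h3⟩ := hseg u hu hd
    simp only [hbd]
    rw [if_neg (by omega), if_neg (by omega)]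
    exact ⟨by omega, h2, h3⟩
  · rw [hlo, if_neg (by omega), if_neg (by omega)]; exact h.lo_zero
  · intro p hp
    simp only [hlo, hlev]
    have h1 := h.lo_succ p
    rw [htt] at h1
    rcases lt_trichotomy (p + 1) t with h2 | h2 | h2
    · rw [if_neg (by omega), if_neg (by omega), if_neg (by omega), if_neg (by omega),
        if_neg (by omega), if_neg (by omega)]
      exact h1 (by omega)
    · rw [if_pos h2, if_pos h2, if_neg (by omega), if_neg (by omega), ← h1 (by omega), h2, hl',
        pow_succ]
      omega
    · have : p = t := by omega
      subst this
      simp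
  · rw [hlev, if_neg (by omega), if_neg (by omega)]; exact h.lev_zero
  · intro p hp
    simp only [hlev]
    have h1 := hanti p
    split_ifs with h2 h3 h3 h4 h5 h6
    all_goals first | omega | skip
    have : p + 1 = t := by omega
    rw [this] at h1
    have := h1 (by omega)
    omega
  · intro p hp
    simp only [hlev]
    have h1 := hadd p
    have h2 := hadd t le_rfl
    split_ifs <;> omega
  · exact h.key_le
  · intro u hu hd
    rw [hlo, if_neg (by omega), if_pos rfl]
    have := h.le_key u hu
    rw [htt] at this
    exact this hd
  · intro u hu hd p hp
    have h1 := h.key_lt u hu (by rwa [htt]) p hp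
    have h2 := (hseg u hu hd).1
    rw [hlo]
    rw [if_neg (by omega), if_neg (by omega)]
    exact h1
  · intro u hu hd
    obtain ⟨h1, h2, h3⟩ := hseg u hu hd
    by_cases hp : S.pos u = t
    · right; right
      rw [hp] at h2 h3
      exact ⟨h2, h3⟩
    · left
      rw [hlo, if_neg hp, if_neg (by omega)]
      exact hpl u hu hd
  · intro _
    exact ⟨le_rfl, hDn, Or.inl trivial⟩
  · exact Or.inl trivial
  · exact h.key_dummy
  · exact h.pos_dummy
  · exact h.z_eq
  · exact h.key_src
  · exact h.walk
  · have := h.key_bound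
    rwa [htt] at this
  · rw [hlo, if_neg (by omega), if_pos rfl]
    have := h.finished
    rwa [htt] at this
  · exact fun he' => absurd he' he
  · have := h.relaxed
    rwa [htt] at this

/-- The facts about the vertex that is finished next. -/
theorem pop_facts (h : Inv n L src wmax inp Walk S)
    (ht : 0 < S.top) (hb : S.bd (S.top + 1) < S.bd S.top) (hl : ¬ 0 < S.lev S.top) :
    S.ord (S.bd (S.top + 1)) < n ∧ S.idx (S.ord (S.bd (S.top + 1))) = S.bd (S.top + 1) ∧
    S.key (S.ord (S.bd (S.top + 1))) = S.lo S.top ∧ S.lo S.top < 2 ^ L := by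
  have h1 := h.bd_le_n (p := S.top) (by omega)
  have h2 := h.ord_lt (S.bd (S.top + 1)) (by omega)
  have h3 := h.idx_ord (S.bd (S.top + 1)) (by omega)
  have h4 := h.pos_eq h2 le_rfl h3.ge (by omega)
  obtain ⟨t, htt⟩ : ∃ t, S.top = t + 1 := ⟨_, (Nat.sub_add_cancel ht).symm⟩
  have h5 := h.key_lt _ h2 h3.ge t (by omega)
  have h6 := h.lo_succ t (by omega)
  have h7 := h.le_key _ h2 h3.ge
  have h8 := h.lo_le (p := 0) (p' := t) (by omega) (by omega)
  rw [← htt, Nat.eq_zero_of_not_pos hl] at h6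
  rw [h.lo_zero] at h8
  exact ⟨h2, h3, by omega, by omega⟩

/-- At level `0` the interval of the top segment is a single key, so each vertex in it attains the
minimum of the unfinished keys. This is Dijkstra's choice, made without comparing vertices. -/
theorem popStep (h : Inv n L src wmax inp Walk S) (he : ¬ S.e < S.eend)
    (hv : ¬ S.key S.v < S.lo (S.pos S.v)) (hi : ¬ S.i < S.iend) (ht : 0 < S.top)
    (hb : S.bd (S.top + 1) < S.bd S.top) (hl : ¬ 0 < S.lev S.top) :
    Inv n L src wmax inp Walk (S.popStep n inp) := by
  obtain ⟨h1, h2, h3, h4⟩ := h.pop_facts ht hb hl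
  unfold Search.popStep
  generalize hD : S.bd (S.top + 1) = D at *
  generalize hu : S.ord D = u at *
  have hbd : ∀ p, update S.bd (S.top + 1) (D + 1) p = if p = S.top + 1 then D + 1 else S.bd p := by
    intro u; simp only [Function.update_apply]
  have hD' : update S.bd (S.top + 1) (D + 1) (S.top + 1) = D + 1 := by simp
  have hlow : ∀ w < n, S.idx w < D + 1 → S.idx w < D ∨ w = u := by
    intro w hw hlt
    rcases Nat.lt_succ_iff_lt_or_eq.1 hlt with h5 | h5
    · exact Or.inl h5
    · right; rw [← h.ord_idx w hw, h5, hu]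
  constructor
  all_goals simp only [hD']
  · exact h.ord_lt
  · exact h.idx_lt
  · exact h.ord_idx
  · exact h.idx_ord
  · simpa using h.bd_zero
  · intro p hp
    have := h.bd_anti p hp
    simp only [hbd]
    split_ifs with h5 h6 h6
    · omega
    · have : p = S.top := by omega
      subst this; omega
    · omega
    · exact this
  · intro w hw hd
    obtain ⟨h5, h6, h7⟩ := h.seg w hw (by omega)
    simp only [hbd]
    refine ⟨h5, ?_, ?_⟩
    · split_ifs <;> omega
    · rw [if_neg (by omega)]; exact h7
  · exact h.lo_zero
  · exact h.lo_succ
  · exact h.lev_zero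
  · exact h.lev_anti
  · exact h.lev_add
  · exact h.key_le
  · exact fun w hw hd => h.le_key w hw (by omega)
  · exact fun w hw hd => h.key_lt w hw (by omega)
  · intro w hw hd
    rcases h.placed w hw (by omega) with h8 | h8 | h8
    · exact Or.inl h8
    · left; subst h8; exact not_lt.1 hv
    · exact Or.inr (Or.inr h8)
  · exact fun hi' => absurd hi' hi
  · exact Or.inl trivial
  · exact h.key_dummy
  · exact h.pos_dummy
  · exact h.z_eq
  · exact h.key_src
  · exact h.walk
  · intro w hw hlt
    have h5 := h.key_bound w hw hlt
    rw [hD] at h5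
    rw [Nat.succ_mul]; omega
  · intro w hw hd
    rcases hlow w hw hd with h5 | rfl
    · exact h.finished w hw (by omega)
    · omega
  · intro he'
    -- The key was bounded with the old number `D` of finished vertices. Counting `u` as well leaves
    -- room for one more edge.
    have h5 := h.key_bound u h1 (by omega)
    rw [hD] at h5
    refine ⟨h1, by omega, h3, ?_, 0, by omega, by omega, trivial⟩
    rw [Nat.succ_mul]; omega
  · intro w hw hd k hk
    rcases hlow w hw hd with h5 | rfl
    · rcases h.relaxed w hw (by omega) k hk with h6 | h6
      · exact Or.inl h6
      · exact absurd h6.2.2 he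
    · right
      exact ⟨rfl, by omega, by omega⟩

theorem mainStep (hs : Setting n L src wmax inp Walk) (h : Inv n L src wmax inp Walk S) :
    Inv n L src wmax inp Walk (S.mainStep n inp) := by
  unfold Search.mainStep
  split_ifs with h1 h2 h3 h4 h5 h6
  · exact h.moveStep h1
  · exact h.scanStep h1 h2
  · exact h.relaxStep hs h1 h2 h3
  · exact h.splitStep h3 h1 h2 h4 h6
  · exact h.popStep h3 h1 h2 h4 h5 h6
  · exact h.dropStep h1 h2 h3 h4 h5
  · exact h

end Inv

end Search

namespace Search

open Function (update)

variable {n L src wmax : ℕ} {inp : ℕ → ℕ} {Walk : ℕ → ℕ → Prop} {S : Search}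

/-! ### The number of steps -/

/-- The contribution of a vertex to the potential. -/
def vertexPotential (L : ℕ) (inp : ℕ → ℕ) (S : Search) (u : ℕ) : ℕ :=
  if S.idx u < S.bd (S.top + 1) then 0
  -- The summands pay for finishing the vertex, for its moves through the segments, for the splits
  -- of its segment at three units each, and for relaxing its edges.
  else 1 + (L + 2 - S.pos u) + 3 * S.lev (S.pos u) + degreeOf inp u

/-- An upper bound for the number of steps to be made. -/
def potential (n L : ℕ) (inp : ℕ → ℕ) (S : Search) : ℕ :=
  ∑ u ∈ Finset.range n, S.vertexPotential L inp u + (S.iend - S.i) + (S.eend - S.e) / 2 + S.top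

/-- The search has come to its end. -/
def Final (S : Search) : Prop :=
  ¬ S.key S.v < S.lo (S.pos S.v) ∧ ¬ S.i < S.iend ∧ ¬ S.e < S.eend ∧ S.top = 0

theorem Final.mainStep (h : S.Final) : S.mainStep n inp = S := by
  obtain ⟨h1, h2, h3, h4⟩ := h
  simp [Search.mainStep, h1, h2, h3, h4]

theorem sum_add_le_sum {f g : ℕ → ℕ} {u c : ℕ} (hu : u < n)
    (h : ∀ w < n, w ≠ u → f w ≤ g w) (hc : f u + c ≤ g u) :
    ∑ w ∈ Finset.range n, f w + c ≤ ∑ w ∈ Finset.range n, g w := by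
  have hu' := Finset.mem_range.2 hu
  rw [← Finset.add_sum_erase _ f hu', ← Finset.add_sum_erase _ g hu']
  have : ∑ w ∈ (Finset.range n).erase u, f w ≤ ∑ w ∈ (Finset.range n).erase u, g w := by
    refine Finset.sum_le_sum fun w hw => ?_
    rw [Finset.mem_erase, Finset.mem_range] at hw
    exact h w hw.2 hw.1
  omega

namespace Inv

theorem potential_moveStep (h : Inv n L src wmax inp Walk S)
    (hv : S.key S.v < S.lo (S.pos S.v)) :
    S.moveStep.potential n L inp < S.potential n L inp := by
  obtain ⟨hvn, hvd, hlt, h1, h2, h3, h4, h5, h6, h7⟩ := h.move_facts hv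
  have hov := h.ord_idx _ hvn
  have hadd := h.lev_add S.top le_rfl
  have hanti := h.lev_anti (S.pos S.v) hlt
  have hmain : ∑ u ∈ Finset.range n, S.moveStep.vertexPotential L inp u + 1 ≤
      ∑ u ∈ Finset.range n, S.vertexPotential L inp u := by
    unfold vertexPotential Search.moveStep
    generalize hp : S.pos S.v = p at *
    generalize hq : S.bd (p + 1) = q at *
    generalize hx : S.ord q = x at *
    generalize hr : S.idx S.v = r at *
    have htop : S.top + 1 ≠ p + 1 := by omega
    have hD : update S.bd (p + 1) (q + 1) (S.top + 1) = S.bd (S.top + 1) := by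
      rw [Function.update_of_ne htop]
    simp only [hD]
    refine sum_add_le_sum hvn (fun w hw hwv => ?_) ?_
    · rw [Function.update_of_ne hwv, Function.update_of_ne hwv]
      by_cases hwx : w = x
      · subst hwx
        rw [Function.update_self, if_neg (by omega), if_neg (by omega)]
      · rw [Function.update_of_ne hwx]
    · rw [Function.update_self, Function.update_self, if_neg (by omega), if_neg (by omega), hp]
      omega
  unfold potential
  change _ + (S.iend - S.i) + (S.eend - S.e) / 2 + S.top < _
  omega

theorem potential_scanStep (hi : S.i < S.iend) :
    S.scanStep.potential n L inp < S.potential n L inp := by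
  unfold potential
  change ∑ u ∈ Finset.range n, S.vertexPotential L inp u + (S.iend - (S.i + 1)) +
    (S.eend - S.e) / 2 + S.top < _
  omega

theorem potential_relaxStep (h : Inv n L src wmax inp Walk S) (he : S.e < S.eend) :
    (S.relaxStep inp).potential n L inp < S.potential n L inp := by
  obtain ⟨c1, c2, c3, c4, k, hk, c5, c6⟩ := h.current he
  have : (S.relaxStep inp).potential n L inp = ∑ u ∈ Finset.range n, S.vertexPotential L inp u +
      (S.iend - S.i) + (S.eend - (S.e + 2)) / 2 + S.top := by
    unfold Search.relaxStep
    split_ifs <;> rfl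
  rw [this, potential]
  omega

/-- If the segment has `s ≥ 1` vertices, the drop of their level frees `3 * s` units, whereas the
new scan costs `s` and the additional segment costs `1`. -/
theorem potential_splitStep (h : Inv n L src wmax inp Walk S)
    (hi : ¬ S.i < S.iend) (hb : S.bd (S.top + 1) < S.bd S.top) (hl : 0 < S.lev S.top) :
    (S.splitStep n).potential n L inp < S.potential n L inp := by
  have hn := h.bd_le_n (p := S.top) (by omega)
  have hcard : S.bd S.top - S.bd (S.top + 1) ≤ ((Finset.range n).filter
      fun u => S.bd (S.top + 1) ≤ S.idx u ∧ S.idx u < S.bd S.top).card := by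
    rw [← Nat.card_Ico]
    refine Finset.card_le_card_of_injOn S.ord (fun q hq => ?_) (fun q hq q' hq' he => ?_)
    · have hq' := Finset.mem_Ico.1 hq
      simp only [Finset.coe_filter, Finset.mem_range, Set.mem_ofPred_eq]
      rw [h.idx_ord q (by omega)]
      exact ⟨h.ord_lt q (by omega), hq'⟩
    · rw [Finset.mem_coe, Finset.mem_Ico] at hq hq'
      rw [← h.idx_ord q (by omega), he, h.idx_ord q' (by omega)]
  have hsum : ∑ u ∈ Finset.range n, (S.splitStep n).vertexPotential L inp u +
      3 * (S.bd S.top - S.bd (S.top + 1)) ≤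
      ∑ u ∈ Finset.range n, S.vertexPotential L inp u := by
    have : ∑ u ∈ Finset.range n, ((S.splitStep n).vertexPotential L inp u +
        if S.bd (S.top + 1) ≤ S.idx u ∧ S.idx u < S.bd S.top then 3 else 0) ≤
        ∑ u ∈ Finset.range n, S.vertexPotential L inp u := by
      refine Finset.sum_le_sum fun u hu => ?_
      have hu' := Finset.mem_range.1 hu
      unfold vertexPotential Search.splitStep
      simp only [Function.update_self]
      by_cases hd : S.idx u < S.bd (S.top + 1)
      · rw [if_pos hd, if_pos hd, if_neg (by omega)]
      · obtain ⟨h1, h2, h3⟩ := h.seg u hu' (not_lt.1 hd)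
        rw [if_neg hd, if_neg hd]
        by_cases hp : S.pos u = S.top
        · rw [hp] at h2 h3 ⊢
          rw [Function.update_self, if_pos ⟨h2, h3⟩]
          omega
        · rw [Function.update_of_ne hp, Function.update_of_ne (by omega),
            if_neg fun h4 => hp (h.pos_eq hu' le_rfl h4.1 h4.2), add_zero]
    rw [Finset.sum_add_distrib, ← Finset.sum_filter, Finset.sum_const, smul_eq_mul] at this
    omega
  unfold potential
  change _ + (S.bd S.top - S.bd (S.top + 1)) + (S.eend - S.e) / 2 + (S.top + 1) < _
  omega

theorem potential_popStep (h : Inv n L src wmax inp Walk S) (ht : 0 < S.top)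
    (hb : S.bd (S.top + 1) < S.bd S.top) (hl : ¬ 0 < S.lev S.top) :
    (S.popStep n inp).potential n L inp < S.potential n L inp := by
  obtain ⟨h1, h2, h3, h4⟩ := h.pop_facts ht hb hl
  have hsum : ∑ u ∈ Finset.range n, (S.popStep n inp).vertexPotential L inp u +
      (degreeOf inp (S.ord (S.bd (S.top + 1))) + 1) ≤
      ∑ u ∈ Finset.range n, S.vertexPotential L inp u := by
    unfold vertexPotential Search.popStep
    simp only [Function.update_self]
    refine sum_add_le_sum h1 (fun w hw hwv => ?_) ?_
    · split_ifs <;> omega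
    · rw [if_pos (by omega), if_neg (by omega)]
      omega
  unfold potential
  have he' : (S.popStep n inp).eend - (S.popStep n inp).e =
      2 * degreeOf inp (S.ord (S.bd (S.top + 1))) := by
    simp [Search.popStep]
  rw [he']
  change _ + (S.iend - S.i) + _ + S.top < _
  omega

theorem potential_dropStep (h : Inv n L src wmax inp Walk S) (ht : 0 < S.top)
    (hb : ¬ S.bd (S.top + 1) < S.bd S.top) :
    S.dropStep.potential n L inp < S.potential n L inp := by
  have hD : S.bd (S.top - 1 + 1) = S.bd (S.top + 1) := by
    rw [Nat.sub_add_cancel ht]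
    have := h.bd_anti S.top le_rfl
    omega
  unfold potential vertexPotential Search.dropStep
  simp only [hD]
  omega

theorem potential_mainStep (h : Inv n L src wmax inp Walk S) (hf : ¬ S.Final) :
    (S.mainStep n inp).potential n L inp < S.potential n L inp := by
  unfold Search.mainStep
  split_ifs with h1 h2 h3 h4 h5 h6
  · exact h.potential_moveStep h1
  · exact potential_scanStep h2
  · exact h.potential_relaxStep h3
  · exact h.potential_splitStep h2 h5 h6
  · exact h.potential_popStep h4 h5 h6
  · exact h.potential_dropStep h4 h5
  · exact absurd ⟨h1, h2, h3, by omega⟩ hf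

theorem step_eq (h : Inv n L src wmax inp Walk S) :
    S.step n L src inp = S.mainStep n inp := by
  rw [Search.step, if_pos (by have := h.z_eq; omega)]

theorem iterate (hs : Setting n L src wmax inp Walk) (h : Inv n L src wmax inp Walk S) (t : ℕ) :
    Inv n L src wmax inp Walk ((step n L src inp)^[t] S) := by
  induction t with
  | zero => exact h
  | succ t ih =>
    rw [Function.iterate_succ_apply', ih.step_eq]
    exact ih.mainStep hs

theorem final_iterate (hs : Setting n L src wmax inp Walk) (h : Inv n L src wmax inp Walk S)
    {t : ℕ} (ht : S.potential n L inp ≤ t) : ((step n L src inp)^[t] S).Final := by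
  induction t generalizing S with
  | zero =>
    by_contra hf
    have := h.potential_mainStep hf
    omega
  | succ t ih =>
    rw [Function.iterate_succ_apply, h.step_eq]
    by_cases hf : S.Final
    · rw [hf.mainStep]
      have : ∀ t, (step n L src inp)^[t] S = S := by
        intro t
        induction t with
        | zero => rfl
        | succ t ih => rw [Function.iterate_succ_apply, h.step_eq, hf.mainStep, ih]
      rwa [this]
    · have := h.potential_mainStep hf
      exact ih (h.mainStep hs) (by omega)

/-- At the end, every edge whose tail has been reached is relaxed. -/
theorem relaxed_of_final (h : Inv n L src wmax inp Walk S) (hf : S.Final) {u : ℕ} (hu : u < n)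
    (hlt : S.key u < 2 ^ L) {k : ℕ} (hk : k < degreeOf inp u) :
    S.key (headOf inp u k) ≤ S.key u + weightOf inp u k := by
  obtain ⟨h1, h2, h3, h4⟩ := hf
  have hd : S.idx u < S.bd (S.top + 1) := by
    by_contra hd
    have := h.le_key u hu (not_lt.1 hd)
    rw [h4, h.lo_zero] at this
    omega
  rcases h.relaxed u hu hd k hk with h5 | h5
  · exact h5
  · exact absurd h5.2.2 h3

end Inv

/-! ### Initialization -/

/-- A state from which the search can be started. -/
structure Start (n L src : ℕ) (S : Search) : Prop where
  ord_lt : ∀ q < n, S.ord q < n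
  idx_lt : ∀ u < n, S.idx u < n
  ord_idx : ∀ u < n, S.ord (S.idx u) = u
  idx_ord : ∀ q < n, S.idx (S.ord q) = q
  bd_zero : S.bd 0 = n
  bd_one : S.bd 1 = 0
  bd_two : S.bd 2 = 0
  lo_zero : S.lo 0 = 2 ^ L
  lo_one : S.lo 1 = 0
  lev_zero : S.lev 0 = L
  lev_one : S.lev 1 = L
  top_eq : S.top = 1
  i_eq : S.i = 0
  iend_eq : S.iend = 0
  e_eq : S.e = 0
  eend_eq : S.eend = 0
  v_eq : S.v = src
  z_eq : S.z = 0

namespace Start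

theorem iterate_init (n L src : ℕ) (inp : ℕ → ℕ) {S₀ : Search} (hz : S₀.z = 0) {t : ℕ} (ht : t ≤ n) :
    ∃ key buf pos, (step n L src inp)^[t] S₀ =
      { S₀ with key := key, buf := buf, pos := pos, z := t } ∧
      (∀ u < t, key u = 2 ^ L) ∧ (∀ u < t, pos u = 0) ∧ (∀ u < t, buf u = S₀.key u) ∧
      (∀ u, t ≤ u → key u = S₀.key u) := by
  induction t with
  | zero => exact ⟨S₀.key, S₀.buf, S₀.pos, by rw [Function.iterate_zero, ← hz]; rfl, by simp, by simp, by simp, by simp⟩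
  | succ t ih =>
    obtain ⟨key, buf, pos, he, h1, h2, h3, h4⟩ := ih (by omega)
    refine ⟨update key t (2 ^ L), update buf t (key t), update pos t 0, ?_, ?_, ?_, ?_, ?_⟩
    · rw [Function.iterate_succ_apply', he, step, if_neg (by simp; omega)]
      simp only [initStep]
      rw [if_pos (by omega)]
    · intro u hu
      by_cases hut : u = t
      · simp [hut]
      · rw [Function.update_of_ne hut]; exact h1 u (by omega)
    · intro u hu
      by_cases hut : u = t
      · simp [hut]
      · rw [Function.update_of_ne hut]; exact h2 u (by omega)
    · intro u hu
      by_cases hut : u = t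
      · subst hut; simp [h4]
      · rw [Function.update_of_ne hut]; exact h3 u (by omega)
    · intro u hu
      rw [Function.update_of_ne (by omega)]; exact h4 u (by omega)

/-- At first all vertices are in segment `0` of level `L`, so each contributes `4 * L + 3` and its
degree; the last unit is `top`. The source, with key `0`, is the only misplaced vertex, and it is
`v`. -/
theorem iterate_start (hs : Setting n L src wmax inp Walk) {S₀ : Search}
    (h : Start n L src S₀) :
    Inv n L src wmax inp Walk ((step n L src inp)^[n + 1] S₀) ∧
    ((step n L src inp)^[n + 1] S₀).potential n L inp ≤
      ∑ u ∈ Finset.range n, degreeOf inp u + n * (4 * L + 3) + 1 ∧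
    ∀ u < n, ((step n L src inp)^[n + 1] S₀).buf u = S₀.key u := by
  obtain ⟨key, buf, pos, he, h1, h2, h3, h4⟩ := iterate_init n L src inp h.z_eq (le_refl n)
  have hsrc := hs.src_lt
  have hstep : (step n L src inp)^[n + 1] S₀ = { S₀ with
      key := update (update key n (2 ^ L)) src 0
      buf := update buf n (key n)
      pos := update pos n 0
      z := n + 1 } := by
    rw [Function.iterate_succ_apply', he, step, if_neg (by simp)]
    simp only [initStep]
    rw [if_neg (by omega)]
  have hkey : ∀ u ≤ n, update (update key n (2 ^ L)) src 0 u = if u = src then 0 else 2 ^ L := by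
    intro u hu
    simp only [Function.update_apply]
    split_ifs
    · rfl
    · rfl
    · exact h1 u (by omega)
  have hpos : ∀ u ≤ n, update pos n 0 u = 0 := by
    intro u hu
    simp only [Function.update_apply]
    split_ifs
    · rfl
    · exact h2 u (by omega)
  rw [hstep]
  have hL : 0 < 2 ^ L := by positivity
  have hbd1 := h.bd_one
  have hbd2 := h.bd_two
  refine ⟨?_, ?_, ?_⟩
  · constructor
    all_goals simp only [h.top_eq, h.i_eq, h.iend_eq, h.e_eq, h.eend_eq, h.v_eq, Nat.reduceAdd,
      hbd2, lt_irrefl, false_imp_iff, not_lt_zero, implies_true]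
    · exact h.ord_lt
    · exact h.idx_lt
    · exact h.ord_idx
    · exact h.idx_ord
    · exact h.bd_zero
    · intro p hp
      interval_cases p <;> simp [hbd1, hbd2]
    · intro u hu _
      rw [hpos u hu.le, h.bd_zero]
      exact ⟨by omega, by simp [hbd1], h.idx_lt u hu⟩
    · exact h.lo_zero
    · intro p hp
      interval_cases p
      simp [h.lo_zero, h.lo_one, h.lev_one]
    · exact h.lev_zero
    · intro p hp
      interval_cases p
      simp [h.lev_zero, h.lev_one]
    · intro p hp
      interval_cases p <;> (simp [h.lev_zero, h.lev_one]; try omega)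
    · intro u hu
      rw [hkey u hu]
      split_ifs <;> omega
    · intro u hu _
      simp [h.lo_one]
    · intro u hu _ p hp
      rw [hpos u hu.le] at hp
      omega
    · intro u hu _
      rw [hkey u hu.le, hpos u hu.le, h.lo_zero]
      by_cases hus : u = src
      · right; left; exact hus
      · left; simp [hus]
    · exact Or.inr ⟨hsrc, Nat.zero_le _⟩
    · rw [hkey n le_rfl, if_neg (by omega)]
    · rw [hpos n le_rfl]
    · rw [hkey src hsrc.le, if_pos rfl]
    · intro u hu hlt
      rw [hkey u hu.le] at hlt ⊢
      split_ifs at hlt ⊢ with hus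
      · subst hus; exact hs.walk_src
      · omega
    · intro u hu hlt
      rw [hkey u hu.le] at hlt ⊢
      split_ifs at hlt ⊢ with hus
      · omega
      · omega
  · unfold potential vertexPotential
    simp only [h.top_eq, h.i_eq, h.iend_eq, h.e_eq, h.eend_eq, Nat.reduceAdd, hbd2, not_lt_zero,
      if_false]
    have : ∑ u ∈ Finset.range n, (1 + (L + 2 - update pos n 0 u) + 3 * S₀.lev (update pos n 0 u) +
        degreeOf inp u) = ∑ u ∈ Finset.range n, ((4 * L + 3) + degreeOf inp u) := by
      refine Finset.sum_congr rfl fun u hu => ?_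
      rw [hpos u (Finset.mem_range.1 hu).le, h.lev_zero]
      omega
    rw [this, Finset.sum_add_distrib]
    simp
    omega
  · intro u hu
    change update buf n (key n) u = _
    rw [Function.update_of_ne (by omega), h3 u hu]

/-- After initialization, the invariant holds. -/
theorem inv_iterate (hs : Setting n L src wmax inp Walk) {S₀ : Search} (h : Start n L src S₀)
    {t : ℕ} (ht : n < t) : Inv n L src wmax inp Walk ((step n L src inp)^[t] S₀) := by
  obtain ⟨t', rfl⟩ := Nat.exists_eq_add_of_le' ht
  rw [Function.iterate_add_apply]
  exact (h.iterate_start hs).1.iterate hs t'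

theorem z_iterate (hs : Setting n L src wmax inp Walk) {S₀ : Search} (h : Start n L src S₀)
    (t : ℕ) : ((step n L src inp)^[t] S₀).z = min t (n + 1) := by
  rcases Nat.lt_or_ge n t with ht | ht
  · rw [(h.inv_iterate hs ht).z_eq]; omega
  · obtain ⟨key, buf, pos, he, h1⟩ := iterate_init n L src inp h.z_eq ht
    rw [he]
    change t = _
    omega

theorem mainStep_buf (S : Search) : (S.mainStep n inp).buf = S.buf := by
  unfold mainStep relaxStep
  split_ifs <;> rfl

/-- Only initialization writes to the buffer. The saved key of `u` is thus available as soon as step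
`u` has been made, and remains so throughout this search. -/
theorem buf_iterate (hs : Setting n L src wmax inp Walk) {S₀ : Search} (h : Start n L src S₀)
    {t u : ℕ} (hu : u < n) (ht : u < t) : ((step n L src inp)^[t] S₀).buf u = S₀.key u := by
  rcases Nat.lt_or_ge n t with hn | hn
  · induction t, hn using Nat.le_induction with
    | base => exact (h.iterate_start hs).2.2 u hu
    | succ t ht' ih =>
      rw [Function.iterate_succ_apply', (h.inv_iterate hs ht').step_eq, mainStep_buf]
      exact ih (by omega)
  · obtain ⟨key, buf, pos, he, -, -, h3, -⟩ := iterate_init n L src inp h.z_eq hn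
    rw [he]
    exact h3 u ht

/-- Add the `n + 1` steps of initialization to the initial potential; `n ≥ 1` absorbs the additive
constants. -/
theorem final_iterate (hs : Setting n L src wmax inp Walk) {S₀ : Search} (h : Start n L src S₀)
    {t : ℕ} (ht : ∑ u ∈ Finset.range n, degreeOf inp u + n * (4 * L + 6) ≤ t) :
    ((step n L src inp)^[t] S₀).Final := by
  obtain ⟨h1, h2, -⟩ := h.iterate_start hs
  have hn : 0 < n := Nat.zero_lt_of_lt hs.src_lt
  obtain ⟨t', rfl⟩ : ∃ t', t = t' + (n + 1) :=
    ⟨t - (n + 1), by rw [Nat.sub_add_cancel]; nlinarith⟩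
  rw [Function.iterate_add_apply]
  refine h1.final_iterate hs (h2.trans ?_)
  nlinarith

end Start

end Search

/-! ## The program

The arrays are: `0` keys, `1` buffer, `2` `ord`, `3` `idx`, `4` `pos`, `5` `bd`, `6` `lo`, `7` `lev`,
`8` powers of two, `9` the target of each vertex that is not to be emitted (again), `10` the vertices
of low degree.

The registers are: `0` zero, `1` one, `2` `n`, `3` the key of unreached vertices, `4` `L`, `5` the
number of search steps per round, `6` the phase, `7` the round, `8` the number of rounds of the
phase, `9` the number of search steps made in the round, `10` the source of the search, `11` to `18`
the scalar components of the search. -/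

namespace Code

def ops (l : List Op) (c : Code) : Code := l.foldr Code.op c

def ifEq (a b : ℕ) (t e : Code) : Code := ifLt a b e (ifLt b a e t)

theorem wp_ifEq {V S : ℕ} {inp : ℕ → ℕ} {Q : List Output → ℕ → ArrState → Prop} {a b : ℕ}
    {t e : Code} {σ : ArrState} : (ifEq a b t e).wp V S inp Q σ ↔
      (σ.reg a = σ.reg b → t.wp V S inp Q σ) ∧ (σ.reg a ≠ σ.reg b → e.wp V S inp Q σ) := by
  simp only [ifEq, wp]
  rcases lt_trichotomy (σ.reg a) (σ.reg b) with h | h | h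
  · simp [h, h.ne]
  · simp [h]
  · simp [h, h.ne', h.not_gt]

end Code

namespace ArrState

@[simp] theorem reg_setReg (σ : ArrState) (d x r : ℕ) :
    (σ.setReg d x).reg r = if r = d then x else σ.reg r := by
  simp [setReg, Function.update_apply]

@[simp] theorem arr_setReg (σ : ArrState) (d x : ℕ) : (σ.setReg d x).arr = σ.arr := rfl

@[simp] theorem reg_setArr (σ : ArrState) (k i x : ℕ) : (σ.setArr k i x).reg = σ.reg := rfl

@[simp] theorem arr_setArr (σ : ArrState) (k i x k' : ℕ) :
    (σ.setArr k i x).arr k' = if k' = k then Function.update (σ.arr k) i x else σ.arr k' := by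
  simp [setArr, Function.update_apply]

/-- The search state held in the memory. -/
def search (σ : ArrState) : Search where
  key := σ.arr 0
  buf := σ.arr 1
  ord := σ.arr 2
  idx := σ.arr 3
  pos := σ.arr 4
  bd := σ.arr 5
  lo := σ.arr 6
  lev := σ.arr 7
  top := σ.reg 11
  i := σ.reg 12
  iend := σ.reg 13
  e := σ.reg 14
  eend := σ.reg 15
  cu := σ.reg 16
  v := σ.reg 17
  z := σ.reg 18

end ArrState

/-- The part of the state that is not changed by the search. -/
structure Control where
  zero : ℕ
  one : ℕ
  n : ℕ
  inf : ℕ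
  L : ℕ
  R : ℕ
  p : ℕ
  j : ℕ
  jend : ℕ
  src : ℕ
  pow : ℕ → ℕ
  skip : ℕ → ℕ
  low : ℕ → ℕ

def ArrState.control (σ : ArrState) : Control where
  zero := σ.reg 0
  one := σ.reg 1
  n := σ.reg 2
  inf := σ.reg 3
  L := σ.reg 4
  R := σ.reg 5
  p := σ.reg 6
  j := σ.reg 7
  jend := σ.reg 8
  src := σ.reg 10
  pow := σ.arr 8
  skip := σ.arr 9
  low := σ.arr 10

namespace ArrState

@[simp] theorem control_setReg (σ : ArrState) {d : ℕ} (x : ℕ) (hd : 11 ≤ d ∨ d = 9) :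
    (σ.setReg d x).control = σ.control := by
  simp only [control, reg_setReg, arr_setReg]
  repeat rw [if_neg (by omega)]

@[simp] theorem control_setArr (σ : ArrState) {k : ℕ} (i x : ℕ) (hk : k < 8 ∨ 10 < k) :
    (σ.setArr k i x).control = σ.control := by
  simp only [control, reg_setArr, arr_setArr]
  repeat rw [if_neg (by omega)]

end ArrState

namespace Block

open Code Op

attribute [simp] Code.ops Code.wp Op.Safe Op.apply Code.wp_ifEq

/-- One search step has been made. -/
def tick : Code := op (add 9 9 1) (goto 7)

def initCode : Code :=
  ops [load 19 0 18, store 1 18 19, store 0 18 3, store 4 18 0]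
    (ifLt 18 2
      (ops [add 18 18 1] tick)
      (ops [store 0 10 0, add 18 18 1] tick))

def moveCode : Code :=
  ops [add 20 20 1, load 22 5 20, load 23 2 22, load 24 3 17, store 2 24 23, store 2 22 17,
    store 3 23 24, store 3 17 22, add 22 22 1, store 5 20 22, store 4 17 20] tick

def scanCode : Code := ops [load 17 2 12, add 12 12 1] tick

def relaxCode : Code :=
  ops [input 19 14, add 14 14 1, input 20 14, add 14 14 1, load 21 0 16, add 21 21 20, load 22 0 19]
    (ifLt 21 22
      (ops [store 0 19 21, add 17 19 0] tick)
      tick)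

def splitCode : Code :=
  ops [sub 22 22 1, load 23 8 22, load 24 6 11, store 6 19 24, add 24 24 23, store 6 11 24,
    store 7 19 22, store 7 11 22, add 25 19 1, store 5 25 20, add 12 20 0, add 13 21 0,
    add 11 19 0, add 17 2 0] tick

def popCode : Code :=
  ops [load 16 2 20, add 21 20 1, store 5 19 21, add 21 16 1, input 21 21, input 22 21,
    add 14 21 1, add 23 22 22, add 15 14 23, add 17 2 0] tick

def dropCode : Code := op (sub 11 11 1) tick

/-- The subprograms rely on registers loaded here: register `20` holds the segment of `v` when
`moveCode` starts, and registers `19` to `22` hold the index of the new segment and the two bounds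
and the level of the top segment when `splitCode` or `popCode` starts. -/
def mainCode : Code :=
  ops [load 19 0 17, load 20 4 17, load 21 6 20]
    (ifLt 19 21 moveCode
      (ifLt 12 13 scanCode
        (ifLt 14 15 relaxCode
          (ifLt 0 11
            (ops [add 19 11 1, load 20 5 19, load 21 5 11]
              (ifLt 20 21
                (op (load 22 7 11) (ifLt 0 22 splitCode popCode))
                dropCode))
            tick))))

def stepCode : Code := ifLt 2 18 mainCode initCode

/-- Make a search step, or finish the round. -/
def micro : Code := ifLt 9 5 stepCode (op (const 9 0) (goto 8))

/-- Initialize the scalar components of the search. -/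
def setup : Code :=
  -- Any permutation left in `ord` and `idx` by the last search will do, and the entries of segment
  -- `0` never change. Only segment `1`, with the interval from `0` to `2 ^ L`, and its boundaries
  -- are set anew, so starting a search takes constant time.
  ops [const 11 1, const 12 0, const 13 0, const 14 0, const 15 0, add 17 10 0, const 18 0,
    const 9 0, const 19 1, store 5 19 0, const 20 2, store 5 20 0, store 6 19 0, store 7 19 4]
    (goto 7)

/-- Emit the distance of a pair of vertices or, in phase `0`, start to search for the lightest edge
of the next vertex of low degree. -/
def emitNext : Code :=
  ifLt 6 1
    (ops [load 31 10 7, add 19 31 1, input 20 19, input 21 20, add 32 20 1, add 21 21 21,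
      add 33 32 21, add 34 3 0]
      -- The default target is some vertex other than the one considered, to be emitted with
      -- distance `∞` if every edge is a loop.
      (ifLt 0 31 (op (const 35 0) (goto 9)) (op (const 35 1) (goto 9))))
    (ops [sub 19 6 1, load 20 9 19]
      (ifEq 7 19 (goto 10)
        (ifEq 7 20 (goto 10)
          (op (load 21 1 7)
            (ifLt 21 3 (emit 19 7 21 (goto 10)) (emitInf 19 7 (goto 10)))))))

/-- Find the lightest edge, other than loops, of a vertex. -/
def lightest : Code :=
  ifLt 32 33
    (ops [input 19 32, add 32 32 1, input 20 32, add 32 32 1]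
      (ifEq 19 31 (goto 9)
        (ifLt 20 34 (ops [add 34 20 0, add 35 19 0] (goto 9)) (goto 9))))
    (op (store 9 31 35)
      (ifLt 34 3 (emit 31 35 34 (goto 10)) (emitInf 31 35 (goto 10))))

/-- Go to the next round. -/
def nextRound : Code :=
  op (add 7 7 1)
    (ifLt 7 8 (goto 7)
      (ifLt 6 2
        (ops [add 6 6 1, const 7 0, add 8 2 0]
          -- In the last phase there is no further source. The search from `n - 1` is repeated and
          -- its result ignored, which keeps the phases uniform.
          (ifLt 6 2 (op (add 10 6 0) (goto 6)) (goto 6)))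
        (goto 11)))

def entry (c : ℕ) : Code :=
  -- The value loaded is never used. The access to the cell with address `16 * n` guarantees the
  -- linear lower bound for the space, even when `n = 1`.
  ops [const 1 1, input 2 0, load 19 0 2, const 37 1, const 38 (c + 1)]
    (ifLt 1 2 (goto 1) (goto 11))

/-- Compute `L`. -/
def doubling : Code :=
  -- Register `37` runs through the powers of two until it exceeds `n`, while `L` grows by `c + 1`
  -- each time.
  ifLt 2 37
    (ops [store 8 0 1, const 39 0] (goto 2))
    (ops [add 37 37 37, add 4 4 38] (goto 1))

/-- Compute the powers of two. -/
def powers : Code :=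
  ifLt 39 4
    (ops [load 19 8 39, add 19 19 19, add 39 39 1, store 8 39 19] (goto 2))
    (ops [load 3 8 39, store 5 0 2, store 6 0 3, store 7 0 4, const 39 0] (goto 3))

/-- Compute the number of edges. -/
def countEdges : Code :=
  ifLt 39 2
    (ops [store 2 39 39, store 3 39 39, store 9 39 39, add 19 39 1, input 20 19, input 21 20,
      add 36 36 21, add 39 39 1] (goto 3))
    (goto 4)

/-- Divide by `n`; compute the number of search steps per round. -/
def division : Code :=
  -- Repeated subtraction is fast enough: there are at most `n ^ 2` edges, so the quotient is at
  -- most `n`. Register `41` receives the threshold for low degree.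
  ifLt 36 2
    (ops [add 40 40 1, add 41 40 40, add 19 4 4, add 19 19 19, const 20 6, add 19 19 20,
      add 19 19 40, add 5 19 19, const 39 0] (goto 5))
    (ops [sub 36 36 2, add 40 40 1] (goto 4))

/-- Collect the vertices of low degree. -/
def collect : Code :=
  ifLt 39 2
    (ops [add 19 39 1, input 20 19, input 21 20]
      (ifLt 41 21 (op (add 39 39 1) (goto 5))
        (ops [store 10 8 39, add 8 8 1, add 39 39 1] (goto 5))))
    (goto 6)

end Block

open Block in
/-- The blocks of the program. -/
def blocks (c : ℕ) : List Code :=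
  [entry c, doubling, powers, countEdges, division, collect, setup, micro, emitNext, lightest,
    nextRound, .halt]

/-- The sizes that are needed to exclude overflows. -/
structure Sizes (V Sz n L R : ℕ) (inp : ℕ → ℕ) : Prop where
  cells : n + L + 4 ≤ Sz
  pow_lt : 2 ^ L < V
  lin_lt : n + L + R + 10 < V
  addr_lt : ∀ u < n, blockAddr inp u + 2 * degreeOf inp u + 5 < V

/-- The values of registers and of the table that are constant after preprocessing. -/
structure Constants (n L R : ℕ) (s : Control) : Prop where
  zero_eq : s.zero = 0
  one_eq : s.one = 1
  n_eq : s.n = n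
  inf_eq : s.inf = 2 ^ L
  L_eq : s.L = L
  R_eq : s.R = R
  pow_eq : ∀ l ≤ L, s.pow l = 2 ^ l


/-! ### Correctness of the code for one search step -/

set_option linter.unusedSimpArgs false

section wp

open Code Block ArrState

variable {V Sz n L R src wmax r : ℕ} {inp : ℕ → ℕ} {Walk : ℕ → ℕ → Prop} {σ : ArrState}
  {S : Search} {C : Control}

/-- The memory holds the search state `S` and the control state `C`; `r` steps of the round have
been made. -/
structure Holds (S : Search) (C : Control) (r : ℕ) (σ : ArrState) : Prop where
  search_eq : σ.search = S
  control_eq : σ.control = C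
  count_eq : σ.reg 9 = r

namespace Holds

theorem setReg (h : Holds S C r σ) {d : ℕ} (x : ℕ) (hd : 19 ≤ d) : Holds S C r (σ.setReg d x) where
  search_eq := by
    rw [← h.search_eq]
    simp only [search, reg_setReg, arr_setReg]
    repeat rw [if_neg (by omega)]
  control_eq := by rw [control_setReg _ _ (by omega), h.control_eq]
  count_eq := by rw [reg_setReg, if_neg (by omega), h.count_eq]

theorem arr0 (h : Holds S C r σ) : σ.arr 0 = S.key := by rw [← h.search_eq]; rfl
theorem arr1 (h : Holds S C r σ) : σ.arr 1 = S.buf := by rw [← h.search_eq]; rfl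
theorem arr2 (h : Holds S C r σ) : σ.arr 2 = S.ord := by rw [← h.search_eq]; rfl
theorem arr3 (h : Holds S C r σ) : σ.arr 3 = S.idx := by rw [← h.search_eq]; rfl
theorem arr4 (h : Holds S C r σ) : σ.arr 4 = S.pos := by rw [← h.search_eq]; rfl
theorem arr5 (h : Holds S C r σ) : σ.arr 5 = S.bd := by rw [← h.search_eq]; rfl
theorem arr6 (h : Holds S C r σ) : σ.arr 6 = S.lo := by rw [← h.search_eq]; rfl
theorem arr7 (h : Holds S C r σ) : σ.arr 7 = S.lev := by rw [← h.search_eq]; rfl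
theorem reg11 (h : Holds S C r σ) : σ.reg 11 = S.top := by rw [← h.search_eq]; rfl
theorem reg12 (h : Holds S C r σ) : σ.reg 12 = S.i := by rw [← h.search_eq]; rfl
theorem reg13 (h : Holds S C r σ) : σ.reg 13 = S.iend := by rw [← h.search_eq]; rfl
theorem reg14 (h : Holds S C r σ) : σ.reg 14 = S.e := by rw [← h.search_eq]; rfl
theorem reg15 (h : Holds S C r σ) : σ.reg 15 = S.eend := by rw [← h.search_eq]; rfl
theorem reg16 (h : Holds S C r σ) : σ.reg 16 = S.cu := by rw [← h.search_eq]; rfl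
theorem reg17 (h : Holds S C r σ) : σ.reg 17 = S.v := by rw [← h.search_eq]; rfl
theorem reg18 (h : Holds S C r σ) : σ.reg 18 = S.z := by rw [← h.search_eq]; rfl
theorem reg0 (h : Holds S C r σ) (hc : Constants n L R C) : σ.reg 0 = 0 := by
  have := hc.zero_eq; rw [← h.control_eq] at this; exact this
theorem reg1 (h : Holds S C r σ) (hc : Constants n L R C) : σ.reg 1 = 1 := by
  have := hc.one_eq; rw [← h.control_eq] at this; exact this
theorem reg2 (h : Holds S C r σ) (hc : Constants n L R C) : σ.reg 2 = n := by
  have := hc.n_eq; rw [← h.control_eq] at this; exact this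
theorem reg3 (h : Holds S C r σ) (hc : Constants n L R C) : σ.reg 3 = 2 ^ L := by
  have := hc.inf_eq; rw [← h.control_eq] at this; exact this
theorem reg4 (h : Holds S C r σ) (hc : Constants n L R C) : σ.reg 4 = L := by
  have := hc.L_eq; rw [← h.control_eq] at this; exact this
theorem reg5 (h : Holds S C r σ) (hc : Constants n L R C) : σ.reg 5 = R := by
  have := hc.R_eq; rw [← h.control_eq] at this; exact this
theorem reg6 (h : Holds S C r σ) : σ.reg 6 = C.p := by rw [← h.control_eq]; rfl
theorem reg7 (h : Holds S C r σ) : σ.reg 7 = C.j := by rw [← h.control_eq]; rfl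
theorem reg8 (h : Holds S C r σ) : σ.reg 8 = C.jend := by rw [← h.control_eq]; rfl
theorem reg10 (h : Holds S C r σ) : σ.reg 10 = C.src := by rw [← h.control_eq]; rfl
theorem arr8 (h : Holds S C r σ) : σ.arr 8 = C.pow := by rw [← h.control_eq]; rfl
theorem arr9 (h : Holds S C r σ) : σ.arr 9 = C.skip := by rw [← h.control_eq]; rfl
theorem arr10 (h : Holds S C r σ) : σ.arr 10 = C.low := by rw [← h.control_eq]; rfl

end Holds

/-- The result of a search step. -/
def StepPost (S : Search) (C : Control) (r : ℕ) (os : List Output) (l : ℕ) (σ : ArrState) : Prop :=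
  os = [] ∧ l = 7 ∧ Holds S C (r + 1) σ

theorem wp_initCode (hz : Sizes V Sz n L R inp) (hc : Constants n L R C)
    (hsrc : C.src = src) (hsn : src < n) (hr : r < R) (hh : Holds S C r σ) (hzn : ¬ n < S.z) :
    initCode.wp V Sz inp (StepPost (S.initStep n L src) C r) σ := by
  obtain ⟨z1, z2, z3, -⟩ := hz
  simp [initCode, tick, StepPost, hh.reg0 hc, hh.reg1 hc, hh.reg2 hc, hh.reg3 hc, hh.reg10, hsrc,
    hh.reg18, hh.arr0, hh.arr1, hh.arr4, hh.count_eq]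
  refine ⟨by omega, fun h => ⟨by omega, by omega, ?_⟩, fun h => ⟨by omega, by omega, by omega, ?_⟩⟩
  · constructor
    · simp [search, hh.reg11, hh.reg12, hh.reg13, hh.reg14, hh.reg15, hh.reg16, hh.reg17, hh.arr0,
        hh.arr1, hh.arr2, hh.arr3, hh.arr4, hh.arr5, hh.arr6, hh.arr7, Search.initStep, h]
    · simp [hh.control_eq]
    · simp
  · constructor
    · simp [search, hh.reg11, hh.reg12, hh.reg13, hh.reg14, hh.reg15, hh.reg16, hh.reg17, hh.arr0,
        hh.arr1, hh.arr2, hh.arr3, hh.arr4, hh.arr5, hh.arr6, hh.arr7, Search.initStep, h]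
    · simp [hh.control_eq]
    · simp

theorem wp_moveCode (hz : Sizes V Sz n L R inp) (hc : Constants n L R C)
    (hi : Search.Inv n L src wmax inp Walk S) (hr : r < R) (hh : Holds S C r σ)
    (hv : S.key S.v < S.lo (S.pos S.v)) (h20 : σ.reg 20 = S.pos S.v) :
    moveCode.wp V Sz inp (StepPost S.moveStep C r) σ := by
  obtain ⟨z1, z2, z3, -⟩ := hz
  obtain ⟨f1, f2, f3, f4, f5, f6, f7, f8, f9, f10⟩ := hi.move_facts hv
  have f11 := hi.lev_add S.top le_rfl
  simp [moveCode, tick, StepPost, hh.reg1 hc,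
    hh.reg17, hh.arr2, hh.arr3, hh.arr4, hh.arr5, hh.count_eq, h20]
  repeat refine And.intro (by omega) ?_
  constructor
  · simp [search, hh.reg11, hh.reg12, hh.reg13, hh.reg14, hh.reg15, hh.reg16, hh.reg17, hh.reg18,
      hh.arr0, hh.arr1, hh.arr2, hh.arr3, hh.arr4, hh.arr5, hh.arr6, hh.arr7, Search.moveStep]
  · simp [hh.control_eq]
  · simp

theorem wp_scanCode (hz : Sizes V Sz n L R inp) (hc : Constants n L R C)
    (hi : Search.Inv n L src wmax inp Walk S) (hr : r < R) (hh : Holds S C r σ)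
    (hv : S.i < S.iend) :
    scanCode.wp V Sz inp (StepPost S.scanStep C r) σ := by
  obtain ⟨z1, z2, z3, -⟩ := hz
  obtain ⟨f1, f2, f3⟩ := hi.scan hv
  simp [scanCode, tick, StepPost, hh.reg1 hc, hh.reg12, hh.arr2, hh.count_eq]
  repeat refine And.intro (by omega) ?_
  constructor
  · simp [search, hh.reg11, hh.reg12, hh.reg13, hh.reg14, hh.reg15, hh.reg16, hh.reg17, hh.reg18,
      hh.arr0, hh.arr1, hh.arr2, hh.arr3, hh.arr4, hh.arr5, hh.arr6, hh.arr7, Search.scanStep]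
  · simp [hh.control_eq]
  · simp

theorem wp_relaxCode (hz : Sizes V Sz n L R inp) (hc : Constants n L R C)
    (hs : Search.Setting n L src wmax inp Walk)
    (hi : Search.Inv n L src wmax inp Walk S) (hr : r < R) (hh : Holds S C r σ)
    (he : S.e < S.eend) :
    relaxCode.wp V Sz inp (StepPost (S.relaxStep inp) C r) σ := by
  obtain ⟨z1, z2, z3, z4⟩ := hz
  obtain ⟨c1, c2, c3, c4, k, hk, c5, c6⟩ := hi.current he
  have hx : inp S.e = headOf inp S.cu k := by rw [c5]; rfl
  have hw : inp (S.e + 1) = weightOf inp S.cu k := by rw [c5]; rfl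
  have hxn := hs.head_lt _ c1 k hk
  have hwm := hs.weight_le _ c1 k hk
  have hpw := hs.lt_pow
  have hD := hi.bd_le_n (p := S.top + 1) le_rfl
  have hDn : S.bd (S.top + 1) * wmax ≤ n * wmax := Nat.mul_le_mul_right _ hD
  have h4 := z4 _ c1
  simp [relaxCode, tick, StepPost, hh.reg0 hc, hh.reg1 hc, hh.reg14, hh.reg16, hh.arr0, hh.count_eq]
  refine ⟨by omega, by omega, by omega, by omega, by omega, fun h => ⟨by omega, by omega, by omega, ?_⟩,
    fun h => ⟨by omega, ?_⟩⟩
  · constructor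
    · simp [search, hh.reg11, hh.reg12, hh.reg13, hh.reg14, hh.reg15, hh.reg16, hh.reg17, hh.reg18,
        hh.arr0, hh.arr1, hh.arr2, hh.arr3, hh.arr4, hh.arr5, hh.arr6, hh.arr7, Search.relaxStep, h]
    · simp [hh.control_eq]
    · simp
  · constructor
    · simp [search, hh.reg11, hh.reg12, hh.reg13, hh.reg14, hh.reg15, hh.reg16, hh.reg17, hh.reg18,
        hh.arr0, hh.arr1, hh.arr2, hh.arr3, hh.arr4, hh.arr5, hh.arr6, hh.arr7, Search.relaxStep,
        not_lt.2 h]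
    · simp [hh.control_eq]
    · simp

theorem wp_splitCode (hz : Sizes V Sz n L R inp) (hc : Constants n L R C)
    (hi : Search.Inv n L src wmax inp Walk S) (hr : r < R) (hh : Holds S C r σ)
    (ht : 0 < S.top) (hl : 0 < S.lev S.top) (h19 : σ.reg 19 = S.top + 1)
    (h20 : σ.reg 20 = S.bd (S.top + 1)) (h21 : σ.reg 21 = S.bd S.top)
    (h22 : σ.reg 22 = S.lev S.top) :
    splitCode.wp V Sz inp (StepPost (S.splitStep n) C r) σ := by
  obtain ⟨z1, z2, z3, z4⟩ := hz
  have f11 := hi.lev_add S.top le_rfl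
  obtain ⟨t, htt⟩ : ∃ t, S.top = t + 1 := ⟨_, (Nat.sub_add_cancel ht).symm⟩
  have f1 := hi.lo_succ t (by omega)
  have f2 := hi.lo_le (p := 0) (p' := t) (by omega) (by omega)
  rw [hi.lo_zero] at f2
  rw [← htt] at f1
  have f3 : 2 ^ (S.lev S.top - 1) ≤ 2 ^ S.lev S.top := Nat.pow_le_pow_right (by norm_num) (by omega)
  have f4 := hi.bd_le_n (p := S.top) (by omega)
  have f5 := hi.bd_le_n (p := S.top + 1) (by omega)
  have f6 := hc.pow_eq (S.lev S.top - 1) (by omega)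
  simp [splitCode, tick, StepPost, hh.reg0 hc, hh.reg1 hc, hh.reg2 hc, hh.reg11, hh.arr6, hh.arr8,
    hh.count_eq, h19, h20, h21, h22, f6]
  repeat refine And.intro (by omega) ?_
  constructor
  · simp [search, hh.reg11, hh.reg12, hh.reg13, hh.reg14, hh.reg15, hh.reg16, hh.reg17, hh.reg18,
      hh.arr0, hh.arr1, hh.arr2, hh.arr3, hh.arr4, hh.arr5, hh.arr6, hh.arr7, Search.splitStep]
  · simp [hh.control_eq]
  · simp

theorem wp_popCode (hz : Sizes V Sz n L R inp) (hc : Constants n L R C)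
    (hi : Search.Inv n L src wmax inp Walk S) (hr : r < R) (hh : Holds S C r σ)
    (ht : 0 < S.top) (hb : S.bd (S.top + 1) < S.bd S.top) (hl : ¬ 0 < S.lev S.top)
    (h19 : σ.reg 19 = S.top + 1) (h20 : σ.reg 20 = S.bd (S.top + 1)) :
    popCode.wp V Sz inp (StepPost (S.popStep n inp) C r) σ := by
  obtain ⟨z1, z2, z3, z4⟩ := hz
  obtain ⟨h1, h2, h3, h4⟩ := hi.pop_facts ht hb hl
  have f11 := hi.lev_add S.top le_rfl
  have f4 := hi.bd_le_n (p := S.top) (by omega)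
  have h5 := z4 _ h1
  simp only [degreeOf, blockAddr] at h5
  simp [popCode, tick, StepPost, hh.reg0 hc, hh.reg1 hc, hh.reg2 hc, hh.arr2,
    hh.count_eq, h19, h20]
  repeat refine And.intro (by omega) ?_
  constructor
  · simp [search, hh.reg11, hh.reg12, hh.reg13, hh.reg14, hh.reg15, hh.reg16, hh.reg17, hh.reg18,
      hh.arr0, hh.arr1, hh.arr2, hh.arr3, hh.arr4, hh.arr5, hh.arr6, hh.arr7, Search.popStep,
      degreeOf, blockAddr, two_mul]
  · simp [hh.control_eq]
  · simp

theorem wp_dropCode (hz : Sizes V Sz n L R inp) (hc : Constants n L R C) (hr : r < R)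
    (hh : Holds S C r σ) (ht : 0 < S.top) :
    dropCode.wp V Sz inp (StepPost S.dropStep C r) σ := by
  obtain ⟨z1, z2, z3, z4⟩ := hz
  simp [dropCode, tick, StepPost, hh.reg1 hc, hh.reg11, hh.count_eq]
  repeat refine And.intro (by omega) ?_
  constructor
  · simp [search, hh.reg11, hh.reg12, hh.reg13, hh.reg14, hh.reg15, hh.reg16, hh.reg17, hh.reg18,
      hh.arr0, hh.arr1, hh.arr2, hh.arr3, hh.arr4, hh.arr5, hh.arr6, hh.arr7, Search.dropStep]
  · simp [hh.control_eq]
  · simp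

theorem wp_tick (hz : Sizes V Sz n L R inp) (hc : Constants n L R C) (hr : r < R)
    (hh : Holds S C r σ) : tick.wp V Sz inp (StepPost S C r) σ := by
  obtain ⟨z1, z2, z3, z4⟩ := hz
  simp [tick, StepPost, hh.reg1 hc, hh.count_eq]
  repeat refine And.intro (by omega) ?_
  constructor
  · simp [search, ← hh.search_eq]
  · simp [hh.control_eq]
  · simp

theorem wp_mainCode (hz : Sizes V Sz n L R inp) (hc : Constants n L R C)
    (hs : Search.Setting n L src wmax inp Walk)
    (hi : Search.Inv n L src wmax inp Walk S) (hr : r < R) (hh : Holds S C r σ) :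
    mainCode.wp V Sz inp (StepPost (S.mainStep n inp) C r) σ := by
  have f0 := hz.cells
  have f1 : S.v ≤ n := by rcases hi.v_eq with h | h <;> omega
  have f2 : S.pos S.v ≤ S.top := by
    rcases hi.v_eq with h | h
    · rw [h, hi.pos_dummy]; omega
    · exact (hi.seg _ h.1 h.2).1
  have f3 := hi.lev_add S.top le_rfl
  have f4 := hz.lin_lt
  unfold Search.mainStep
  simp only [mainCode, ops, List.foldr, Code.wp, Op.Safe, Op.apply, hh.reg17, hh.arr0]
  refine ⟨⟨by omega, by omega⟩, ?_⟩
  have hh1 := hh.setReg (d := 19) (S.key S.v) le_rfl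
  simp only [hh1.reg17, hh1.arr4]
  refine ⟨⟨by omega, by omega⟩, ?_⟩
  have hh2 := hh1.setReg (d := 20) (S.pos S.v) (by omega)
  have e20 : ((σ.setReg 19 (S.key S.v)).setReg 20 (S.pos S.v)).reg 20 = S.pos S.v := by simp
  simp only [hh2.arr6, e20]
  refine ⟨⟨by omega, by omega⟩, ?_⟩
  have hh3 := hh2.setReg (d := 21) (S.lo (S.pos S.v)) (by omega)
  have e19 : (((σ.setReg 19 (S.key S.v)).setReg 20 (S.pos S.v)).setReg 21
      (S.lo (S.pos S.v))).reg 19 = S.key S.v := by simp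
  have e20' : (((σ.setReg 19 (S.key S.v)).setReg 20 (S.pos S.v)).setReg 21
      (S.lo (S.pos S.v))).reg 20 = S.pos S.v := by simp
  have e21 : (((σ.setReg 19 (S.key S.v)).setReg 20 (S.pos S.v)).setReg 21
      (S.lo (S.pos S.v))).reg 21 = S.lo (S.pos S.v) := by simp
  generalize ((σ.setReg 19 (S.key S.v)).setReg 20 (S.pos S.v)).setReg 21
      (S.lo (S.pos S.v)) = σ₁ at *
  simp only [e19, e21, hh3.reg0 hc, hh3.reg1 hc, hh3.reg11, hh3.reg12, hh3.reg13, hh3.reg14,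
    hh3.reg15]
  refine ⟨fun h1 => ?_, fun h1 => ⟨fun h2 => ?_, fun h2 => ⟨fun h3 => ?_, fun h3 =>
    ⟨fun h4 => ?_, fun h4 => ?_⟩⟩⟩⟩
  · rw [if_pos h1]
    exact wp_moveCode hz hc hi hr hh3 h1 e20'
  · rw [if_neg h1, if_pos h2]
    exact wp_scanCode hz hc hi hr hh3 h2
  · rw [if_neg h1, if_neg h2, if_pos h3]
    exact wp_relaxCode hz hc hs hi hr hh3 h3
  · rw [if_neg h1, if_neg h2, if_neg h3, if_pos h4]
    refine ⟨by omega, ?_⟩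
    have hh4 := hh3.setReg (d := 19) (S.top + 1) (by omega)
    have e1 : (σ₁.setReg 19 (S.top + 1)).reg 19 = S.top + 1 := by simp
    simp only [hh4.arr5, e1]
    refine ⟨⟨by omega, by omega⟩, ?_⟩
    have hh5 := hh4.setReg (d := 20) (S.bd (S.top + 1)) (by omega)
    simp only [hh5.arr5, hh5.reg11]
    refine ⟨⟨by omega, by omega⟩, ?_⟩
    have hh6 := hh5.setReg (d := 21) (S.bd S.top) (by omega)
    have a19 : (((σ₁.setReg 19 (S.top + 1)).setReg 20 (S.bd (S.top + 1))).setReg 21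
      (S.bd S.top)).reg 19 = S.top + 1 := by simp
    have a20 : (((σ₁.setReg 19 (S.top + 1)).setReg 20 (S.bd (S.top + 1))).setReg 21
      (S.bd S.top)).reg 20 = S.bd (S.top + 1) := by simp
    have a21 : (((σ₁.setReg 19 (S.top + 1)).setReg 20 (S.bd (S.top + 1))).setReg 21
      (S.bd S.top)).reg 21 = S.bd S.top := by simp
    generalize ((σ₁.setReg 19 (S.top + 1)).setReg 20 (S.bd (S.top + 1))).setReg 21
      (S.bd S.top) = σ₂ at *
    simp only [a20, a21, hh6.reg11, hh6.arr7]
    refine ⟨fun h5 => ⟨⟨by omega, by omega⟩, ?_⟩, fun h5 => ?_⟩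
    · have hh7 := hh6.setReg (d := 22) (S.lev S.top) (by omega)
      have b22 : (σ₂.setReg 22 (S.lev S.top)).reg 22 = S.lev S.top := by simp
      simp only [b22, hh7.reg0 hc]
      rw [if_pos h5]
      refine ⟨fun h6 => ?_, fun h6 => ?_⟩
      · rw [if_pos h6]
        exact wp_splitCode hz hc hi hr hh7 h4 h6 (by simpa) (by simpa) (by simpa) b22
      · rw [if_neg h6]
        exact wp_popCode hz hc hi hr hh7 h4 h5 h6 (by simpa) (by simpa)
    · rw [if_neg h5]
      exact wp_dropCode hz hc hr hh6 h4
  · rw [if_neg h1, if_neg h2, if_neg h3, if_neg h4]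
    exact wp_tick hz hc hr hh3

end wp

/-! ### Rounds, outputs and changes of phase -/

set_option linter.unusedSimpArgs false

section wp

open Code Block ArrState

variable {V Sz n L R src wmax r c : ℕ} {inp : ℕ → ℕ} {Walk : ℕ → ℕ → Prop} {σ : ArrState}
  {S S₀ : Search} {C : Control}

theorem wp_stepCode (hz : Sizes V Sz n L R inp) (hc : Constants n L R C)
    (hsrc : C.src = src) (hs : Search.Setting n L src wmax inp Walk) (h₀ : Search.Start n L src S₀)
    {t : ℕ} (hr : r < R) (hh : Holds ((Search.step n L src inp)^[t] S₀) C r σ) :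
    stepCode.wp V Sz inp (StepPost ((Search.step n L src inp)^[t + 1] S₀) C r) σ := by
  have hzt := h₀.z_iterate hs t
  rw [Function.iterate_succ_apply']
  simp only [stepCode, Code.wp, hh.reg2 hc, hh.reg18]
  refine ⟨fun h => ?_, fun h => ?_⟩
  · rw [Search.step, if_pos h]
    exact wp_mainCode hz hc hs (h₀.inv_iterate hs (by omega)) hr hh
  · rw [Search.step, if_neg h]
    exact wp_initCode hz hc hsrc hs.src_lt hr hh h

/-- A round of search steps. -/
theorem runs_round (hz : Sizes V Sz n L R inp) (hc : Constants n L R C)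
    (hsrc : C.src = src) (hs : Search.Setting n L src wmax inp Walk) (h₀ : Search.Start n L src S₀)
    {t : ℕ} (hh : Holds ((Search.step n L src inp)^[t] S₀) C 0 σ) :
    ∃ σ', BlockRuns (blocks c) V Sz inp (7, σ) (R + 1) [] (8, σ') ∧
      Holds ((Search.step n L src inp)^[t + R] S₀) C 0 σ' := by
  have key : ∀ k ≤ R, ∃ σ', BlockRuns (blocks c) V Sz inp (7, σ) k [] (7, σ') ∧
      Holds ((Search.step n L src inp)^[t + k] S₀) C k σ' := by
    intro k hk
    induction k with
    | zero => exact ⟨σ, .refl _, hh⟩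
    | succ k ih =>
      obtain ⟨σ₁, r1, hh1⟩ := ih (by omega)
      have hwp : micro.wp V Sz inp (StepPost ((Search.step n L src inp)^[t + k + 1] S₀) C k) σ₁ := by
        simp only [micro, Code.wp, hh1.count_eq, hh1.reg5 hc]
        exact ⟨fun _ => wp_stepCode hz hc hsrc hs h₀ (by omega) hh1, fun h => absurd hk h⟩
      obtain ⟨os, l, σ₂, r2, rfl, rfl, hh2⟩ :=
        BlockRuns.of_wp (blocks := blocks c) (l := 7) (by simp [blocks]) hwp
      exact ⟨σ₂, r1.trans_silent r2, hh2⟩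
  obtain ⟨σ₁, r1, hh1⟩ := key R le_rfl
  have hwp : micro.wp V Sz inp (fun os l σ' => os = [] ∧ l = 8 ∧ σ' = σ₁.setReg 9 0) σ₁ := by
    simp only [micro, Code.wp, hh1.count_eq, hh1.reg5 hc]
    have := hz.lin_lt
    simp
    omega
  obtain ⟨os, l, σ₂, r2, rfl, rfl, rfl⟩ :=
    BlockRuns.of_wp (blocks := blocks c) (l := 7) (by simp [blocks]) hwp
  refine ⟨_, r1.trans_silent r2, ?_, ?_, ?_⟩
  · rw [← hh1.search_eq]; simp [search]
  · simp [hh1.control_eq]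
  · simp

/-- The components that have to be in order when a new search is set up. -/
structure Search.Idle (n L : ℕ) (S : Search) : Prop where
  ord_lt : ∀ q < n, S.ord q < n
  idx_lt : ∀ u < n, S.idx u < n
  ord_idx : ∀ u < n, S.ord (S.idx u) = u
  idx_ord : ∀ q < n, S.idx (S.ord q) = q
  bd_zero : S.bd 0 = n
  lo_zero : S.lo 0 = 2 ^ L
  lev_zero : S.lev 0 = L

theorem Search.Inv.idle (h : Search.Inv n L src wmax inp Walk S) : S.Idle n L :=
  ⟨h.ord_lt, h.idx_lt, h.ord_idx, h.idx_ord, h.bd_zero, h.lo_zero, h.lev_zero⟩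

/-- The keys have to survive the setup, as they are the distances from the previous source; the
initialization steps of the new search carry them into the buffer. -/
theorem runs_setup (hz : Sizes V Sz n L R inp) (hc : Constants n L R σ.control)
    (hsrc : σ.control.src = src) (hsn : src < n) (hi : σ.search.Idle n L) :
    ∃ σ' S', BlockRuns (blocks c) V Sz inp (6, σ) 1 [] (7, σ') ∧ Holds S' σ.control 0 σ' ∧
      Search.Start n L src S' ∧ S'.key = σ.search.key := by
  have hh : Holds σ.search σ.control (σ.reg 9) σ := ⟨rfl, rfl, rfl⟩
  obtain ⟨z1, z2, z3, -⟩ := hz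
  have hwp : setup.wp V Sz inp (fun os l σ' => os = [] ∧ l = 7 ∧ Holds σ'.search σ.control 0 σ' ∧
      Search.Start n L src σ'.search ∧ σ'.search.key = σ.search.key) σ := by
    have h10 : σ.reg 10 = src := hsrc
    simp [setup, hh.reg0 hc, hh.reg4 hc, h10]
    repeat refine And.intro (by omega) ?_
    refine ⟨⟨rfl, by simp, by simp⟩, ?_, by simp [search]⟩
    constructor
    all_goals simp [search]
    · exact hi.ord_lt
    · exact hi.idx_lt
    · exact hi.ord_idx
    · exact hi.idx_ord
    · exact hi.bd_zero
    · exact hi.lo_zero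
    · exact hi.lev_zero
  obtain ⟨os, l, σ₂, r2, rfl, rfl, h⟩ :=
    BlockRuns.of_wp (blocks := blocks c) (l := 6) (by simp [blocks]) hwp
  exact ⟨_, _, r2, h⟩

/-- The distance that is meant by a key. -/
def distOf (L x : ℕ) : ℕ∞ := if x < 2 ^ L then x else ⊤

theorem runs_emitNext (hz : Sizes V Sz n L R inp) (hc : Constants n L R C)
    (hh : Holds S C 0 σ) (hp : 1 ≤ C.p) (hpn : C.p ≤ n) (hj : C.j < n) :
    ∃ σ', BlockRuns (blocks c) V Sz inp (8, σ) 1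
      (if C.j = C.p - 1 ∨ C.j = C.skip (C.p - 1) then []
        else [(C.p - 1, C.j, distOf L (S.buf C.j))]) (10, σ') ∧ Holds S C 0 σ' := by
  obtain ⟨z1, z2, z3, -⟩ := hz
  have hwp : emitNext.wp V Sz inp (fun os l σ' =>
      os = (if C.j = C.p - 1 ∨ C.j = C.skip (C.p - 1) then []
        else [(C.p - 1, C.j, distOf L (S.buf C.j))]) ∧ l = 10 ∧ Holds S C 0 σ') σ := by
    simp only [emitNext, Code.wp, Code.ops, List.foldr, Op.Safe, Op.apply, Code.wp_ifEq, hh.reg6,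
      hh.reg1 hc]
    refine ⟨fun h => by omega, fun _ => ⟨hp, ?_⟩⟩
    have hh1 := hh.setReg (d := 19) (C.p - 1) le_rfl
    have e1 : (σ.setReg 19 (C.p - 1)).reg 19 = C.p - 1 := by simp
    simp only [hh1.arr9, e1]
    refine ⟨⟨by omega, by omega⟩, ?_⟩
    have hh2 := hh1.setReg (d := 20) (C.skip (C.p - 1)) (by omega)
    have e19 : ((σ.setReg 19 (C.p - 1)).setReg 20 (C.skip (C.p - 1))).reg 19 = C.p - 1 := by simp
    have e20 : ((σ.setReg 19 (C.p - 1)).setReg 20 (C.skip (C.p - 1))).reg 20 =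
      C.skip (C.p - 1) := by simp
    generalize (σ.setReg 19 (C.p - 1)).setReg 20 (C.skip (C.p - 1)) = σ₁ at *
    simp only [e19, e20, hh2.reg7, hh2.arr1]
    refine ⟨fun h1 => ⟨by rw [if_pos (Or.inl h1)], trivial, hh2⟩, fun h1 =>
      ⟨fun h2 => ⟨by rw [if_pos (Or.inr h2)], trivial, hh2⟩, fun h2 => ⟨⟨by omega, by omega⟩, ?_⟩⟩⟩
    have hh3 := hh2.setReg (d := 21) (S.buf C.j) (by omega)
    have a19 : (σ₁.setReg 21 (S.buf C.j)).reg 19 = C.p - 1 := by simpa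
    have a21 : (σ₁.setReg 21 (S.buf C.j)).reg 21 = S.buf C.j := by simp
    simp only [a19, a21, hh3.reg7, hh3.reg3 hc]
    rw [if_neg (by tauto)]
    refine ⟨fun h3 => ⟨?_, trivial, hh3⟩, fun h3 => ⟨?_, trivial, hh3⟩⟩
    · rw [distOf, if_pos h3]
    · rw [distOf, if_neg h3]
  obtain ⟨os, l, σ₂, r2, rfl, rfl, h⟩ :=
    BlockRuns.of_wp (blocks := blocks c) (l := 8) (by simp [blocks]) hwp
  exact ⟨_, r2, h⟩

/-- The weight and the head of the lightest among the first `k` edges of `u` that are not loops; if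
there are none, `2 ^ L` and some other vertex. -/
def lightestEdge (L : ℕ) (inp : ℕ → ℕ) (u : ℕ) : ℕ → ℕ × ℕ
  | 0 => (2 ^ L, if 0 < u then 0 else 1)
  | k + 1 =>
    if headOf inp u k ≠ u ∧ weightOf inp u k < (lightestEdge L inp u k).1 then
      (weightOf inp u k, headOf inp u k)
    else lightestEdge L inp u k

theorem runs_lightest (hz : Sizes V Sz n L R inp) (hc : Constants n L R C)
    (hh : Holds S C 0 σ) (hp : C.p = 0) {u : ℕ} (hj : C.j < n) (hlow : C.low C.j = u) (hu : u < n)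
    (hhead : ∀ k < degreeOf inp u, headOf inp u k < n) :
    ∃ σ', BlockRuns (blocks c) V Sz inp (8, σ) (degreeOf inp u + 2)
      [(u, (lightestEdge L inp u (degreeOf inp u)).2,
        distOf L (lightestEdge L inp u (degreeOf inp u)).1)] (10, σ') ∧
      Holds S { C with skip := Function.update C.skip u (lightestEdge L inp u (degreeOf inp u)).2 }
        0 σ' := by
  obtain ⟨z1, z2, z3, z4⟩ := hz
  have z5 := z4 u hu
  have hstart : emitNext.wp V Sz inp (fun os l σ' => os = [] ∧ l = 9 ∧ Holds S C 0 σ' ∧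
      σ'.reg 31 = u ∧ σ'.reg 32 = blockAddr inp u + 1 ∧
      σ'.reg 33 = blockAddr inp u + 1 + 2 * degreeOf inp u ∧ σ'.reg 34 = 2 ^ L ∧
      σ'.reg 35 = if 0 < u then 0 else 1) σ := by
    simp [emitNext, hh.reg0 hc, hh.reg1 hc, hh.reg3 hc, hh.reg6, hh.reg7, hh.arr10, hp, hlow]
    simp only [degreeOf, blockAddr] at *
    repeat refine And.intro (by omega) ?_
    refine ⟨fun h => ⟨by omega, ?_, trivial, by omega, by omega⟩,
      fun h => ⟨by omega, ?_, trivial, by omega, by omega⟩⟩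
    all_goals
      constructor
      · simpa [search] using hh.search_eq
      · simpa using hh.control_eq
      · simpa using hh.count_eq
  obtain ⟨os, l, σ₁, r1, rfl, rfl, hh1, h31, h32, h33, h34, h35⟩ :=
    BlockRuns.of_wp (blocks := blocks c) (l := 8) (by simp [blocks]) hstart
  have loop : ∀ k ≤ degreeOf inp u, ∃ σ', BlockRuns (blocks c) V Sz inp (9, σ₁) k [] (9, σ') ∧
      Holds S C 0 σ' ∧ σ'.reg 31 = u ∧ σ'.reg 32 = blockAddr inp u + 1 + 2 * k ∧
      σ'.reg 33 = blockAddr inp u + 1 + 2 * degreeOf inp u ∧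
      σ'.reg 34 = (lightestEdge L inp u k).1 ∧ σ'.reg 35 = (lightestEdge L inp u k).2 := by
    intro k hk
    induction k with
    | zero => exact ⟨σ₁, .refl _, hh1, h31, h32, h33, h34, h35⟩
    | succ k ih =>
      obtain ⟨σ₂, r2, hh2, g31, g32, g33, g34, g35⟩ := ih (by omega)
      have hwp : lightest.wp V Sz inp (fun os l σ' => os = [] ∧ l = 9 ∧ Holds S C 0 σ' ∧
          σ'.reg 31 = u ∧ σ'.reg 32 = blockAddr inp u + 1 + 2 * (k + 1) ∧
          σ'.reg 33 = blockAddr inp u + 1 + 2 * degreeOf inp u ∧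
          σ'.reg 34 = (lightestEdge L inp u (k + 1)).1 ∧
          σ'.reg 35 = (lightestEdge L inp u (k + 1)).2) σ₂ := by
        have hle : 2 ^ L < V := z2
        have hk' := hhead k (by omega)
        have hbest : (lightestEdge L inp u k).1 ≤ 2 ^ L := by
          clear * -
          induction k with
          | zero => simp [lightestEdge]
          | succ k ih =>
            rw [lightestEdge]
            split_ifs with h
            · exact h.2.le.trans ih
            · exact ih
        have e1 : inp (blockAddr inp u + 1 + 2 * k) = headOf inp u k := rfl
        have e2 : inp (blockAddr inp u + 1 + 2 * k + 1) = weightOf inp u k := rfl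
        simp [lightest, hh2.reg0 hc, hh2.reg1 hc, g31, g32, g33, g34, g35, e1, e2]
        refine ⟨fun h1 => ⟨by omega, by omega, fun h2 => ?_, fun h2 => ⟨fun h3 => ⟨by omega, ?_⟩,
          fun h3 => ?_⟩⟩, fun h1 => by omega⟩
        · have hcond : ¬ (headOf inp u k ≠ u ∧ weightOf inp u k < (lightestEdge L inp u k).1) := by
            tauto
          rw [lightestEdge, if_neg hcond]
          refine ⟨⟨?_, ?_, ?_⟩, by omega, rfl, rfl⟩
          · simpa [search] using hh2.search_eq
          · simpa using hh2.control_eq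
          · simpa using hh2.count_eq
        · rw [lightestEdge, if_pos ⟨h2, h3⟩]
          refine ⟨by omega, ⟨?_, ?_, ?_⟩, by omega, rfl, rfl⟩
          · simpa [search] using hh2.search_eq
          · simpa using hh2.control_eq
          · simpa using hh2.count_eq
        · have hcond : ¬ (headOf inp u k ≠ u ∧ weightOf inp u k < (lightestEdge L inp u k).1) := by
            omega
          rw [lightestEdge, if_neg hcond]
          refine ⟨⟨?_, ?_, ?_⟩, by omega, rfl, rfl⟩
          · simpa [search] using hh2.search_eq
          · simpa using hh2.control_eq
          · simpa using hh2.count_eq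
      obtain ⟨os, l, σ₃, r3, rfl, rfl, h⟩ :=
        BlockRuns.of_wp (blocks := blocks c) (l := 9) (by simp [blocks]) hwp
      exact ⟨σ₃, r2.trans_silent r3, h⟩
  obtain ⟨σ₂, r2, hh2, g31, g32, g33, g34, g35⟩ := loop _ le_rfl
  have hwp : lightest.wp V Sz inp (fun os l σ' =>
      os = [(u, (lightestEdge L inp u (degreeOf inp u)).2,
        distOf L (lightestEdge L inp u (degreeOf inp u)).1)] ∧ l = 10 ∧
      Holds S { C with skip := Function.update C.skip u (lightestEdge L inp u (degreeOf inp u)).2 }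
        0 σ') σ₂ := by
    simp [lightest, hh2.reg3 hc, g31, g32, g33, g34, g35]
    refine ⟨by omega, fun h => ⟨?_, ?_, ?_, ?_⟩, fun h => ⟨?_, ?_, ?_, ?_⟩⟩
    · rw [distOf, if_pos h]
    · simpa [search] using hh2.search_eq
    · rw [← hh2.control_eq]; simp [ArrState.control]
    · simpa using hh2.count_eq
    · rw [distOf, if_neg (by omega)]
    · simpa [search] using hh2.search_eq
    · rw [← hh2.control_eq]; simp [ArrState.control]
    · simpa using hh2.count_eq
  obtain ⟨os, l, σ₃, r3, rfl, rfl, h⟩ :=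
    BlockRuns.of_wp (blocks := blocks c) (l := 9) (by simp [blocks]) hwp
  refine ⟨σ₃, ?_, h⟩
  have := r1.trans_silent (r2.trans_silent r3)
  rwa [show 1 + (degreeOf inp u + 1) = degreeOf inp u + 2 by omega] at this

theorem runs_nextRound_same (hz : Sizes V Sz n L R inp) (hc : Constants n L R C)
    (hh : Holds S C 0 σ) (hj : C.j + 1 < C.jend) (hjn : C.jend ≤ n) :
    ∃ σ', BlockRuns (blocks c) V Sz inp (10, σ) 1 [] (7, σ') ∧
      Holds S { C with j := C.j + 1 } 0 σ' := by
  obtain ⟨z1, z2, z3, z4⟩ := hz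
  have hwp : nextRound.wp V Sz inp (fun os l σ' => os = [] ∧ l = 7 ∧
      Holds S { C with j := C.j + 1 } 0 σ') σ := by
    simp [nextRound, hh.reg1 hc, hh.reg7, hh.reg8]
    refine ⟨by omega, fun _ => ⟨?_, ?_, ?_⟩, fun h => by omega⟩
    · simpa [search] using hh.search_eq
    · rw [← hh.control_eq]; simp [ArrState.control]
    · simpa using hh.count_eq
  obtain ⟨os, l, σ₃, r3, rfl, rfl, h⟩ :=
    BlockRuns.of_wp (blocks := blocks c) (l := 10) (by simp [blocks]) hwp
  exact ⟨σ₃, r3, h⟩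

theorem runs_nextRound_phase (hz : Sizes V Sz n L R inp) (hc : Constants n L R C)
    (hh : Holds S C 0 σ) (hj : C.j + 1 = C.jend) (hjn : C.jend ≤ n) (hp : C.p < n) :
    ∃ σ', BlockRuns (blocks c) V Sz inp (10, σ) 1 [] (6, σ') ∧
      Holds S { C with
        p := C.p + 1
        j := 0
        jend := n
        src := if C.p + 1 < n then C.p + 1 else C.src } 0 σ' := by
  obtain ⟨z1, z2, z3, z4⟩ := hz
  have hwp : nextRound.wp V Sz inp (fun os l σ' => os = [] ∧ l = 6 ∧
      Holds S { C with
        p := C.p + 1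
        j := 0
        jend := n
        src := if C.p + 1 < n then C.p + 1 else C.src } 0 σ') σ := by
    simp [nextRound, hh.reg0 hc, hh.reg1 hc, hh.reg2 hc, hh.reg6, hh.reg7, hh.reg8]
    refine ⟨by omega, by omega, fun _ => ⟨fun _ => ⟨by omega, by omega, by omega,
      fun h => ⟨by omega, ?_, ?_, ?_⟩, fun h => ⟨?_, ?_, ?_⟩⟩, hp⟩⟩
    · simpa [search] using hh.search_eq
    · rw [← hh.control_eq] at h ⊢
      simp only [ArrState.control] at h
      simp [ArrState.control, h, hh.reg2 hc]
    · simpa using hh.count_eq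
    · simpa [search] using hh.search_eq
    · rw [← hh.control_eq] at h ⊢
      simp only [ArrState.control] at h
      simp [ArrState.control, h, hh.reg2 hc]
    · simpa using hh.count_eq
  obtain ⟨os, l, σ₃, r3, rfl, rfl, h⟩ :=
    BlockRuns.of_wp (blocks := blocks c) (l := 10) (by simp [blocks]) hwp
  exact ⟨σ₃, r3, h⟩

theorem runs_nextRound_end (hz : Sizes V Sz n L R inp) (hc : Constants n L R C)
    (hh : Holds S C 0 σ) (hj : C.j + 1 = C.jend) (hjn : C.jend ≤ n) (hp : C.p = n) :
    ∃ σ', BlockRuns (blocks c) V Sz inp (10, σ) 1 [] (11, σ') := by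
  obtain ⟨z1, z2, z3, z4⟩ := hz
  have hwp : nextRound.wp V Sz inp (fun os l _ => os = [] ∧ l = 11) σ := by
    simp [nextRound, hh.reg0 hc, hh.reg1 hc, hh.reg2 hc, hh.reg6, hh.reg7, hh.reg8]
    exact ⟨by omega, by omega, fun _ => by omega⟩
  obtain ⟨os, l, σ₃, r3, rfl, rfl⟩ :=
    BlockRuns.of_wp (blocks := blocks c) (l := 10) (by simp [blocks]) hwp
  exact ⟨σ₃, r3⟩

end wp

/-! ### Correctness of preprocessing -/

set_option linter.unusedSimpArgs false

section preprocessing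

open Code Block ArrState

variable {V Sz n L R c ℓ R₀ : ℕ} {inp : ℕ → ℕ} {σ : ArrState}

/-- The registers that are constant after the first block. -/
structure Basic (n : ℕ) (σ : ArrState) : Prop where
  reg0 : σ.reg 0 = 0
  reg1 : σ.reg 1 = 1
  reg2 : σ.reg 2 = n
  reg6 : σ.reg 6 = 0
  reg7 : σ.reg 7 = 0
  reg10 : σ.reg 10 = 0

theorem runs_entry (hV : c + n + 10 < V) (hSz : n < Sz) (hinp : inp 0 = n) (hσ : ∀ r, σ.reg r = 0)
    (hn : 2 ≤ n) :
    ∃ σ', BlockRuns (blocks c) V Sz inp (0, σ) 1 [] (1, σ') ∧ Basic n σ' ∧ σ'.reg 4 = 0 ∧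
      σ'.reg 8 = 0 ∧ σ'.reg 36 = 0 ∧ σ'.reg 37 = 1 ∧ σ'.reg 38 = c + 1 ∧ σ'.reg 40 = 0 := by
  have hwp : (entry c).wp V Sz inp (fun os l σ' => os = [] ∧ l = 1 ∧ Basic n σ' ∧ σ'.reg 4 = 0 ∧
      σ'.reg 8 = 0 ∧ σ'.reg 36 = 0 ∧ σ'.reg 37 = 1 ∧ σ'.reg 38 = c + 1 ∧ σ'.reg 40 = 0) σ := by
    simp [entry, hσ, hinp]
    refine ⟨by omega, by omega, by omega, by omega, fun _ => ?_, by omega⟩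
    constructor <;> simp [hσ, hinp]
  obtain ⟨os, l, σ', r, rfl, rfl, h⟩ :=
    BlockRuns.of_wp (blocks := blocks c) (l := 0) (by simp [blocks]) hwp
  exact ⟨σ', r, h⟩

theorem runs_entry_one (hV : c + 10 < V) (hSz : 1 < Sz) (hinp : inp 0 = 1) (hσ : ∀ r, σ.reg r = 0) :
    ∃ σ', BlockRuns (blocks c) V Sz inp (0, σ) 1 [] (11, σ') := by
  have hwp : (entry c).wp V Sz inp (fun os l _ => os = [] ∧ l = 11) σ := by
    simp [entry, hσ, hinp]
    omega
  obtain ⟨os, l, σ', r, rfl, rfl⟩ :=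
    BlockRuns.of_wp (blocks := blocks c) (l := 0) (by simp [blocks]) hwp
  exact ⟨σ', r⟩

theorem runs_doubling (hV : 2 * n + (c + 1) * ℓ < V) (hSz : 0 < Sz) (hn : 1 ≤ n)
    (h1 : 2 ^ ℓ ≤ 2 * n) (h2 : n < 2 ^ ℓ) (hb : Basic n σ)
    (g4 : σ.reg 4 = 0) (g8 : σ.reg 8 = 0) (g36 : σ.reg 36 = 0) (g37 : σ.reg 37 = 1)
    (g38 : σ.reg 38 = c + 1) (g40 : σ.reg 40 = 0) :
    ∃ σ', BlockRuns (blocks c) V Sz inp (1, σ) (ℓ + 1) [] (2, σ') ∧ Basic n σ' ∧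
      σ'.reg 4 = (c + 1) * ℓ ∧ σ'.reg 8 = 0 ∧ σ'.reg 36 = 0 ∧ σ'.reg 40 = 0 ∧ σ'.reg 39 = 0 ∧
      σ'.arr 8 0 = 1 := by
  have loop : ∀ q ≤ ℓ, ∃ σ', BlockRuns (blocks c) V Sz inp (1, σ) q [] (1, σ') ∧ Basic n σ' ∧
      σ'.reg 4 = (c + 1) * q ∧ σ'.reg 8 = 0 ∧ σ'.reg 36 = 0 ∧ σ'.reg 37 = 2 ^ q ∧
      σ'.reg 38 = c + 1 ∧ σ'.reg 40 = 0 := by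
    intro q hq
    induction q with
    | zero => exact ⟨σ, .refl _, hb, by simpa using g4, g8, g36, by simpa using g37, g38, g40⟩
    | succ q ih =>
      obtain ⟨σ₁, r1, b1, k4, k8, k36, k37, k38, k40⟩ := ih (by omega)
      have e1 : 2 ^ (q + 1) ≤ 2 ^ ℓ := Nat.pow_le_pow_right (by norm_num) hq
      rw [pow_succ] at e1
      have e2 : (c + 1) * (q + 1) ≤ (c + 1) * ℓ := Nat.mul_le_mul_left _ hq
      rw [Nat.mul_succ] at e2
      have hwp : doubling.wp V Sz inp (fun os l σ' => os = [] ∧ l = 1 ∧ Basic n σ' ∧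
          σ'.reg 4 = (c + 1) * (q + 1) ∧ σ'.reg 8 = 0 ∧ σ'.reg 36 = 0 ∧ σ'.reg 37 = 2 ^ (q + 1) ∧
          σ'.reg 38 = c + 1 ∧ σ'.reg 40 = 0) σ₁ := by
        simp [doubling, b1.reg2, k4, k8, k36, k37, k38, k40]
        refine ⟨by omega, fun _ => ⟨by omega, by omega, ?_, by ring, by ring⟩⟩
        constructor <;> simp [b1.reg0, b1.reg1, b1.reg2, b1.reg6, b1.reg7, b1.reg10]
      obtain ⟨os, l, σ', r, rfl, rfl, h⟩ :=
        BlockRuns.of_wp (blocks := blocks c) (l := 1) (by simp [blocks]) hwp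
      exact ⟨σ', r1.trans_silent r, h⟩
  obtain ⟨σ₁, r1, b1, k4, k8, k36, k37, k38, k40⟩ := loop ℓ le_rfl
  have hwp : doubling.wp V Sz inp (fun os l σ' => os = [] ∧ l = 2 ∧ Basic n σ' ∧
      σ'.reg 4 = (c + 1) * ℓ ∧ σ'.reg 8 = 0 ∧ σ'.reg 36 = 0 ∧ σ'.reg 40 = 0 ∧ σ'.reg 39 = 0 ∧
      σ'.arr 8 0 = 1) σ₁ := by
    simp [doubling, b1.reg0, b1.reg1, b1.reg2, k4, k8, k36, k37, k38, k40]
    refine ⟨fun _ => ⟨by omega, by omega, ?_⟩, by omega⟩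
    constructor <;> simp [b1.reg0, b1.reg1, b1.reg2, b1.reg6, b1.reg7, b1.reg10]
  obtain ⟨os, l, σ', r, rfl, rfl, h⟩ :=
    BlockRuns.of_wp (blocks := blocks c) (l := 1) (by simp [blocks]) hwp
  exact ⟨σ', r1.trans_silent r, h⟩

theorem runs_powers (hz : Sizes V Sz n L R inp) (hb : Basic n σ) (g4 : σ.reg 4 = L)
    (g8 : σ.reg 8 = 0) (g36 : σ.reg 36 = 0) (g40 : σ.reg 40 = 0) (g39 : σ.reg 39 = 0)
    (ga : σ.arr 8 0 = 1) :
    ∃ σ', BlockRuns (blocks c) V Sz inp (2, σ) (L + 1) [] (3, σ') ∧ Basic n σ' ∧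
      σ'.reg 3 = 2 ^ L ∧ σ'.reg 4 = L ∧ σ'.reg 8 = 0 ∧ σ'.reg 36 = 0 ∧ σ'.reg 40 = 0 ∧
      σ'.reg 39 = 0 ∧ σ'.arr 5 0 = n ∧ σ'.arr 6 0 = 2 ^ L ∧ σ'.arr 7 0 = L ∧
      ∀ l ≤ L, σ'.arr 8 l = 2 ^ l := by
  obtain ⟨z1, z2, z3, -⟩ := hz
  have loop : ∀ q ≤ L, ∃ σ', BlockRuns (blocks c) V Sz inp (2, σ) q [] (2, σ') ∧ Basic n σ' ∧
      σ'.reg 4 = L ∧ σ'.reg 8 = 0 ∧ σ'.reg 36 = 0 ∧ σ'.reg 40 = 0 ∧ σ'.reg 39 = q ∧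
      ∀ l ≤ q, σ'.arr 8 l = 2 ^ l := by
    intro q hq
    induction q with
    | zero => exact ⟨σ, .refl _, hb, g4, g8, g36, g40, g39, by simpa using ga⟩
    | succ q ih =>
      obtain ⟨σ₁, r1, b1, k4, k8, k36, k40, k39, ka⟩ := ih (by omega)
      have e1 : 2 ^ (q + 1) ≤ 2 ^ L := Nat.pow_le_pow_right (by norm_num) hq
      rw [pow_succ] at e1
      have e3 := ka q le_rfl
      have hwp : powers.wp V Sz inp (fun os l σ' => os = [] ∧ l = 2 ∧ Basic n σ' ∧
          σ'.reg 4 = L ∧ σ'.reg 8 = 0 ∧ σ'.reg 36 = 0 ∧ σ'.reg 40 = 0 ∧ σ'.reg 39 = q + 1 ∧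
          ∀ l ≤ q + 1, σ'.arr 8 l = 2 ^ l) σ₁ := by
        simp [powers, b1.reg1, b1.reg2, k4, k8, k36, k40, k39, e3]
        refine ⟨fun _ => ⟨by omega, by omega, by omega, by omega, ?_, ?_⟩, by omega⟩
        · constructor <;> simp [b1.reg0, b1.reg1, b1.reg2, b1.reg6, b1.reg7, b1.reg10]
        · intro l hl
          rw [Function.update_apply]
          split_ifs with h
          · rw [h, pow_succ]; ring
          · exact ka l (by omega)
      obtain ⟨os, l, σ', r, rfl, rfl, h⟩ :=
        BlockRuns.of_wp (blocks := blocks c) (l := 2) (by simp [blocks]) hwp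
      exact ⟨σ', r1.trans_silent r, h⟩
  obtain ⟨σ₁, r1, b1, k4, k8, k36, k40, k39, ka⟩ := loop L le_rfl
  have e3 := ka L le_rfl
  have hwp : powers.wp V Sz inp (fun os l σ' => os = [] ∧ l = 3 ∧ Basic n σ' ∧
      σ'.reg 3 = 2 ^ L ∧ σ'.reg 4 = L ∧ σ'.reg 8 = 0 ∧ σ'.reg 36 = 0 ∧ σ'.reg 40 = 0 ∧
      σ'.reg 39 = 0 ∧ σ'.arr 5 0 = n ∧ σ'.arr 6 0 = 2 ^ L ∧ σ'.arr 7 0 = L ∧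
      ∀ l ≤ L, σ'.arr 8 l = 2 ^ l) σ₁ := by
    simp [powers, b1.reg0, b1.reg1, b1.reg2, k4, k8, k36, k40, k39, e3]
    repeat refine And.intro (by omega) ?_
    refine ⟨?_, ka⟩
    constructor <;> simp [b1.reg0, b1.reg1, b1.reg2, b1.reg6, b1.reg7, b1.reg10]
  obtain ⟨os, l, σ', r, rfl, rfl, h⟩ :=
    BlockRuns.of_wp (blocks := blocks c) (l := 2) (by simp [blocks]) hwp
  exact ⟨σ', r1.trans_silent r, h⟩

theorem runs_countEdges (hz : Sizes V Sz n L R inp)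
    (hm : ∑ u ∈ Finset.range n, degreeOf inp u < V) (hb : Basic n σ) (g3 : σ.reg 3 = 2 ^ L)
    (g4 : σ.reg 4 = L) (g8 : σ.reg 8 = 0) (g36 : σ.reg 36 = 0) (g40 : σ.reg 40 = 0)
    (g39 : σ.reg 39 = 0) (ga5 : σ.arr 5 0 = n) (ga6 : σ.arr 6 0 = 2 ^ L) (ga7 : σ.arr 7 0 = L)
    (ga8 : ∀ l ≤ L, σ.arr 8 l = 2 ^ l) :
    ∃ σ', BlockRuns (blocks c) V Sz inp (3, σ) (n + 1) [] (4, σ') ∧ Basic n σ' ∧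
      σ'.reg 3 = 2 ^ L ∧ σ'.reg 4 = L ∧ σ'.reg 8 = 0 ∧
      σ'.reg 36 = ∑ u ∈ Finset.range n, degreeOf inp u ∧ σ'.reg 40 = 0 ∧
      σ'.search.Idle n L ∧ (∀ l ≤ L, σ'.arr 8 l = 2 ^ l) ∧ (∀ u < n, σ'.arr 9 u = u) := by
  obtain ⟨z1, z2, z3, z4⟩ := hz
  have loop : ∀ q ≤ n, ∃ σ', BlockRuns (blocks c) V Sz inp (3, σ) q [] (3, σ') ∧ Basic n σ' ∧
      σ'.reg 3 = 2 ^ L ∧ σ'.reg 4 = L ∧ σ'.reg 8 = 0 ∧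
      σ'.reg 36 = ∑ u ∈ Finset.range q, degreeOf inp u ∧ σ'.reg 40 = 0 ∧ σ'.reg 39 = q ∧
      σ'.arr 5 0 = n ∧ σ'.arr 6 0 = 2 ^ L ∧ σ'.arr 7 0 = L ∧ (∀ l ≤ L, σ'.arr 8 l = 2 ^ l) ∧
      (∀ u < q, σ'.arr 2 u = u) ∧ (∀ u < q, σ'.arr 3 u = u) ∧ (∀ u < q, σ'.arr 9 u = u) := by
    intro q hq
    induction q with
    | zero =>
      exact ⟨σ, .refl _, hb, g3, g4, g8, by simpa using g36, g40, g39, ga5, ga6, ga7, ga8,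
        by simp, by simp, by simp⟩
    | succ q ih =>
      obtain ⟨σ₁, r1, b1, k3, k4, k8, k36, k40, k39, a5, a6, a7, a8, a2, a3, a9⟩ := ih (by omega)
      have e1 : ∑ u ∈ Finset.range (q + 1), degreeOf inp u ≤
          ∑ u ∈ Finset.range n, degreeOf inp u :=
        Finset.sum_le_sum_of_subset (Finset.range_mono hq)
      rw [Finset.sum_range_succ] at e1
      have e2 : inp (inp (q + 1)) = degreeOf inp q := rfl
      have hupd : ∀ f : ℕ → ℕ, (∀ u < q, f u = u) →
          ∀ u < q + 1, Function.update f q q u = u := by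
        intro f hf u hu
        rw [Function.update_apply]
        split_ifs with h
        · exact h.symm
        · exact hf u (by omega)
      have hwp : countEdges.wp V Sz inp (fun os l σ' => os = [] ∧ l = 3 ∧ Basic n σ' ∧
          σ'.reg 3 = 2 ^ L ∧ σ'.reg 4 = L ∧ σ'.reg 8 = 0 ∧
          σ'.reg 36 = ∑ u ∈ Finset.range (q + 1), degreeOf inp u ∧ σ'.reg 40 = 0 ∧
          σ'.reg 39 = q + 1 ∧
          σ'.arr 5 0 = n ∧ σ'.arr 6 0 = 2 ^ L ∧ σ'.arr 7 0 = L ∧ (∀ l ≤ L, σ'.arr 8 l = 2 ^ l) ∧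
          (∀ u < q + 1, σ'.arr 2 u = u) ∧ (∀ u < q + 1, σ'.arr 3 u = u) ∧
          (∀ u < q + 1, σ'.arr 9 u = u)) σ₁ := by
        simp only [countEdges, Code.wp, Code.ops, List.foldr, Op.Safe, Op.apply]
        simp [b1.reg1, b1.reg2, k3, k4, k8, k36, k40, k39, a5, a6, a7, e2,
          Finset.sum_range_succ]
        refine ⟨fun _ => ⟨by omega, by omega, by omega, by omega, ?_, a8,
          fun u hu => hupd _ a2 u (by omega), fun u hu => hupd _ a3 u (by omega),
          fun u hu => hupd _ a9 u (by omega)⟩, by omega⟩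
        constructor <;> simp [b1.reg0, b1.reg1, b1.reg2, b1.reg6, b1.reg7, b1.reg10]
      obtain ⟨os, l, σ', r, rfl, rfl, h⟩ :=
        BlockRuns.of_wp (blocks := blocks c) (l := 3) (by simp [blocks]) hwp
      exact ⟨σ', r1.trans_silent r, h⟩
  obtain ⟨σ₁, r1, b1, k3, k4, k8, k36, k40, k39, a5, a6, a7, a8, a2, a3, a9⟩ := loop n le_rfl
  have hwp : countEdges.wp V Sz inp (fun os l σ' => os = [] ∧ l = 4 ∧ σ' = σ₁) σ₁ := by
    simp [countEdges, b1.reg2, k39]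
  obtain ⟨os, l, σ', r, rfl, rfl, rfl⟩ :=
    BlockRuns.of_wp (blocks := blocks c) (l := 3) (by simp [blocks]) hwp
  refine ⟨σ', r1.trans_silent r, b1, k3, k4, k8, k36, k40, ?_, a8, a9⟩
  constructor
  all_goals simp only [search]
  · intro q hq; rw [a2 q hq]; exact hq
  · intro q hq; rw [a3 q hq]; exact hq
  · intro q hq; rw [a3 q hq, a2 q hq]
  · intro q hq; rw [a2 q hq, a3 q hq]
  · exact a5
  · exact a6
  · exact a7

theorem runs_division {m : ℕ} (hz : Sizes V Sz n L R inp)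
    (hn : 1 ≤ n) (hR₀ : R₀ = m / n + 1) (hR : R = 2 * (R₀ + (4 * L + 6)))
    (hb : Basic n σ) (g3 : σ.reg 3 = 2 ^ L) (g4 : σ.reg 4 = L) (g8 : σ.reg 8 = 0)
    (g36 : σ.reg 36 = m) (g40 : σ.reg 40 = 0)
    (hi : σ.search.Idle n L) (ga8 : ∀ l ≤ L, σ.arr 8 l = 2 ^ l) (ga9 : ∀ u < n, σ.arr 9 u = u) :
    ∃ σ', BlockRuns (blocks c) V Sz inp (4, σ) R₀ [] (5, σ') ∧ Basic n σ' ∧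
      σ'.reg 3 = 2 ^ L ∧ σ'.reg 4 = L ∧ σ'.reg 5 = R ∧ σ'.reg 8 = 0 ∧ σ'.reg 39 = 0 ∧
      σ'.reg 41 = 2 * R₀ ∧
      σ'.search.Idle n L ∧ (∀ l ≤ L, σ'.arr 8 l = 2 ^ l) ∧ (∀ u < n, σ'.arr 9 u = u) := by
  obtain ⟨z1, z2, z3, z4⟩ := hz
  have hsearch : ∀ τ τ' : ArrState, τ'.arr = τ.arr → τ.search.Idle n L → τ'.search.Idle n L := by
    intro τ τ' h hi
    obtain ⟨h1, h2, h3, h4, h5, h6, h7⟩ := hi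
    simp only [search, ← h] at h1 h2 h3 h4 h5 h6 h7
    exact ⟨h1, h2, h3, h4, h5, h6, h7⟩
  have loop : ∀ q ≤ m / n, ∃ σ', BlockRuns (blocks c) V Sz inp (4, σ) q [] (4, σ') ∧ Basic n σ' ∧
      σ'.reg 3 = 2 ^ L ∧ σ'.reg 4 = L ∧ σ'.reg 8 = 0 ∧ σ'.reg 36 = m - q * n ∧ σ'.reg 40 = q ∧
      σ'.arr = σ.arr := by
    intro q hq
    induction q with
    | zero => exact ⟨σ, .refl _, hb, g3, g4, g8, by simpa using g36, g40, rfl⟩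
    | succ q ih =>
      obtain ⟨σ₁, r1, b1, k3, k4, k8, k36, k40, ka⟩ := ih (by omega)
      have e1 : (q + 1) * n ≤ m := (Nat.le_div_iff_mul_le hn).1 hq
      rw [Nat.succ_mul] at e1
      have hwp : division.wp V Sz inp (fun os l σ' => os = [] ∧ l = 4 ∧ Basic n σ' ∧
          σ'.reg 3 = 2 ^ L ∧ σ'.reg 4 = L ∧ σ'.reg 8 = 0 ∧ σ'.reg 36 = m - (q + 1) * n ∧
          σ'.reg 40 = q + 1 ∧ σ'.arr = σ.arr) σ₁ := by
        simp [division, b1.reg1, b1.reg2, k3, k4, k8, k36, k40, ka, Nat.succ_mul]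
        refine ⟨by omega, fun _ => ⟨by omega, by omega, ?_, by omega⟩⟩
        constructor <;> simp [b1.reg0, b1.reg1, b1.reg2, b1.reg6, b1.reg7, b1.reg10]
      obtain ⟨os, l, σ', r, rfl, rfl, h⟩ :=
        BlockRuns.of_wp (blocks := blocks c) (l := 4) (by simp [blocks]) hwp
      exact ⟨σ', r1.trans_silent r, h⟩
  obtain ⟨σ₁, r1, b1, k3, k4, k8, k36, k40, ka⟩ := loop (m / n) le_rfl
  have e1 : m - m / n * n < n := by
    have := Nat.mod_lt m hn
    have := Nat.mod_add_div m n
    rw [mul_comm] at this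
    omega
  have hwp : division.wp V Sz inp (fun os l σ' => os = [] ∧ l = 5 ∧ Basic n σ' ∧
      σ'.reg 3 = 2 ^ L ∧ σ'.reg 4 = L ∧ σ'.reg 5 = R ∧ σ'.reg 8 = 0 ∧ σ'.reg 39 = 0 ∧
      σ'.reg 41 = 2 * R₀ ∧ σ'.arr = σ.arr) σ₁ := by
    simp [division, b1.reg1, b1.reg2, k3, k4, k8, k36, k40, ka]
    generalize m / n * n = d at e1 ⊢
    generalize m / n = f at *
    refine ⟨fun _ => ⟨by omega, by omega, by omega, by omega, by omega, by omega, by omega,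
      by omega, by omega, ?_, by omega, by omega⟩, e1⟩
    constructor <;> simp [b1.reg0, b1.reg1, b1.reg2, b1.reg6, b1.reg7, b1.reg10]
  obtain ⟨os, l, σ', r, rfl, rfl, b2, l3, l4, l5, l8, l39, l41, la⟩ :=
    BlockRuns.of_wp (blocks := blocks c) (l := 4) (by simp [blocks]) hwp
  refine ⟨σ', hR₀ ▸ r1.trans_silent r, b2, l3, l4, l5, l8, l39, l41, hsearch _ _ la hi, ?_, ?_⟩
  · rwa [la]
  · rwa [la]

/-- `low 0, …, low (k - 1)` are the vertices below `q` of degree at most `D`. -/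
structure LowList (inp : ℕ → ℕ) (D q k : ℕ) (low : ℕ → ℕ) : Prop where
  le : k ≤ q
  lt : ∀ j < k, low j < q
  degree : ∀ j < k, degreeOf inp (low j) ≤ D
  inj : ∀ i < k, ∀ j < k, low i = low j → i = j
  surj : ∀ u < q, degreeOf inp u ≤ D → ∃ j < k, low j = u

theorem runs_collect {D : ℕ} (hz : Sizes V Sz n L R inp) (hb : Basic n σ) (g3 : σ.reg 3 = 2 ^ L)
    (g4 : σ.reg 4 = L) (g5 : σ.reg 5 = R) (g8 : σ.reg 8 = 0) (g39 : σ.reg 39 = 0)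
    (g41 : σ.reg 41 = D) (hi : σ.search.Idle n L) (ga8 : ∀ l ≤ L, σ.arr 8 l = 2 ^ l)
    (ga9 : ∀ u < n, σ.arr 9 u = u) :
    ∃ σ', BlockRuns (blocks c) V Sz inp (5, σ) (n + 1) [] (6, σ') ∧
      Constants n L R σ'.control ∧ σ'.control.p = 0 ∧ σ'.control.j = 0 ∧ σ'.control.src = 0 ∧
      LowList inp D n σ'.control.jend σ'.control.low ∧ σ'.search.Idle n L ∧
      ∀ u < n, σ'.control.skip u = u := by
  obtain ⟨z1, z2, z3, z4⟩ := hz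
  have loop : ∀ q ≤ n, ∃ σ', BlockRuns (blocks c) V Sz inp (5, σ) q [] (5, σ') ∧ Basic n σ' ∧
      σ'.reg 3 = 2 ^ L ∧ σ'.reg 4 = L ∧ σ'.reg 5 = R ∧ σ'.reg 39 = q ∧ σ'.reg 41 = D ∧
      σ'.search = σ.search ∧ σ'.arr 8 = σ.arr 8 ∧ σ'.arr 9 = σ.arr 9 ∧
      LowList inp D q (σ'.reg 8) (σ'.arr 10) := by
    intro q hq
    induction q with
    | zero =>
      refine ⟨σ, .refl _, hb, g3, g4, g5, g39, g41, rfl, rfl, rfl, ?_⟩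
      rw [g8]
      constructor <;> simp
    | succ q ih =>
      obtain ⟨σ₁, r1, b1, k3, k4, k5, k39, k41, ks, ka8, ka9, kl⟩ := ih (by omega)
      have e2 : inp (inp (q + 1)) = degreeOf inp q := rfl
      have hle := kl.le
      have hwp : collect.wp V Sz inp (fun os l σ' => os = [] ∧ l = 5 ∧ Basic n σ' ∧
          σ'.reg 3 = 2 ^ L ∧ σ'.reg 4 = L ∧ σ'.reg 5 = R ∧ σ'.reg 39 = q + 1 ∧ σ'.reg 41 = D ∧
          σ'.search = σ.search ∧ σ'.arr 8 = σ.arr 8 ∧ σ'.arr 9 = σ.arr 9 ∧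
          LowList inp D (q + 1) (σ'.reg 8) (σ'.arr 10)) σ₁ := by
        simp [collect, b1.reg1, b1.reg2, k3, k4, k5, k39, k41, ka8, ka9, e2]
        refine ⟨fun _ => ⟨by omega, fun hd => ⟨by omega, ?_, ?_, ?_⟩, fun hd => ⟨by omega, by omega,
          by omega, ?_, ?_, ?_⟩⟩, by omega⟩
        · constructor <;> simp [b1.reg0, b1.reg1, b1.reg2, b1.reg6, b1.reg7, b1.reg10]
        · rw [← ks]; simp [search]
        · refine ⟨by omega, fun j hj => (kl.lt j hj).trans (by omega), kl.degree, kl.inj, ?_⟩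
          intro u hu hdu
          refine kl.surj u ?_ hdu
          have : u ≠ q := by rintro rfl; omega
          omega
        · constructor <;> simp [b1.reg0, b1.reg1, b1.reg2, b1.reg6, b1.reg7, b1.reg10]
        · rw [← ks]; simp [search]
        · have hnew : ∀ j < σ₁.reg 8, Function.update (σ₁.arr 10) (σ₁.reg 8) q j = σ₁.arr 10 j :=
            fun j hj => by rw [Function.update_of_ne (by omega)]
          have hcases : ∀ j < σ₁.reg 8 + 1, j < σ₁.reg 8 ∨ j = σ₁.reg 8 := fun j hj => by omega
          refine ⟨by omega, fun j hj => ?_, fun j hj => ?_, fun i hi j hj hij => ?_,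
            fun u hu hdu => ?_⟩
          · rcases hcases j hj with h | rfl
            · rw [hnew j h]; exact (kl.lt j h).trans (by omega)
            · simp
          · rcases hcases j hj with h | rfl
            · rw [hnew j h]; exact kl.degree j h
            · simpa using hd
          · rcases hcases i hi with h | rfl <;> rcases hcases j hj with h' | rfl
            · rw [hnew i h, hnew j h'] at hij
              exact kl.inj i h j h' hij
            · rw [hnew i h, Function.update_self] at hij
              have := kl.lt i h
              omega
            · rw [hnew j h', Function.update_self] at hij
              have := kl.lt j h'
              omega
            · rfl
          · by_cases huq : u = q
            · exact ⟨σ₁.reg 8, by omega, by simp [huq]⟩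
            · obtain ⟨j, hj, h⟩ := kl.surj u (by omega) hdu
              exact ⟨j, by omega, by rw [hnew j hj, h]⟩
      obtain ⟨os, l, σ', r, rfl, rfl, h⟩ :=
        BlockRuns.of_wp (blocks := blocks c) (l := 5) (by simp [blocks]) hwp
      exact ⟨σ', r1.trans_silent r, h⟩
  obtain ⟨σ₁, r1, b1, k3, k4, k5, k39, k41, ks, ka8, ka9, kl⟩ := loop n le_rfl
  have hwp : collect.wp V Sz inp (fun os l σ' => os = [] ∧ l = 6 ∧ σ' = σ₁) σ₁ := by
    simp [collect, b1.reg2, k39]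
  obtain ⟨os, l, σ', r, rfl, rfl, rfl⟩ :=
    BlockRuns.of_wp (blocks := blocks c) (l := 5) (by simp [blocks]) hwp
  refine ⟨σ', r1.trans_silent r, ⟨b1.reg0, b1.reg1, b1.reg2, k3, k4, k5, ?_⟩, b1.reg6, b1.reg7,
    b1.reg10, kl, by rwa [ks], ?_⟩
  · intro l hl
    change σ'.arr 8 l = _
    rw [ka8, ga8 l hl]
  · intro u hu
    change σ'.arr 9 u = _
    rw [ka9, ga9 u hu]

/-- The state after preprocessing. -/
theorem runs_preprocessing (hz : Sizes V Sz n L R inp) (hn : 2 ≤ n) (hinp : inp 0 = n)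
    (hL : L = (c + 1) * ℓ) (h1 : 2 ^ ℓ ≤ 2 * n) (h2 : n < 2 ^ ℓ)
    (hR₀ : R₀ = (∑ u ∈ Finset.range n, degreeOf inp u) / n + 1)
    (hR : R = 2 * (R₀ + (4 * L + 6))) (hV : 2 * n + L < V)
    (hm : ∑ u ∈ Finset.range n, degreeOf inp u < V) (hσ : ∀ r, σ.reg r = 0) :
    ∃ σ', BlockRuns (blocks c) V Sz inp (0, σ) (2 * n + ℓ + L + R₀ + 5) [] (6, σ') ∧
      Constants n L R σ'.control ∧ σ'.control.p = 0 ∧ σ'.control.j = 0 ∧ σ'.control.src = 0 ∧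
      LowList inp (2 * R₀) n σ'.control.jend σ'.control.low ∧ σ'.search.Idle n L ∧
      ∀ u < n, σ'.control.skip u = u := by
  have z1 := hz.cells
  have z2 := hz.lin_lt
  have hℓ : 1 ≤ ℓ := by
    rcases Nat.eq_zero_or_pos ℓ with rfl | h
    · simp at h2; omega
    · exact h
  have hc : c + 1 ≤ L := by rw [hL]; exact Nat.le_mul_of_pos_right _ hℓ
  obtain ⟨σ₁, r1, b1, a4, a8, a36, a37, a38, a40⟩ := runs_entry (c := c) (inp := inp) (V := V)
    (Sz := Sz) (by omega) (by omega) hinp hσ hn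
  obtain ⟨σ₂, r2, b2, c4, c8, c36, c40, c39, ca⟩ := runs_doubling (c := c) (inp := inp) (V := V)
    (Sz := Sz) (by omega) (by omega) (by omega) h1 h2 b1 a4 a8 a36 a37 a38 a40
  rw [← hL] at c4
  obtain ⟨σ₃, r3, b3, d3, d4, d8, d36, d40, d39, da5, da6, da7, da8⟩ :=
    runs_powers (c := c) hz b2 c4 c8 c36 c40 c39 ca
  obtain ⟨σ₄, r4, b4, e3, e4, e8, e36, e40, ei, ea8, ea9⟩ :=
    runs_countEdges (c := c) hz hm b3 d3 d4 d8 d36 d40 d39 da5 da6 da7 da8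
  obtain ⟨σ₅, r5, b5, f3, f4, f5, f8, f39, f41, fi, fa8, fa9⟩ :=
    runs_division (c := c) hz (by omega) hR₀ hR b4 e3 e4 e8 e36 e40 ei ea8 ea9
  obtain ⟨σ₆, r6, h⟩ := runs_collect (c := c) hz b5 f3 f4 f5 f8 f39 f41 fi fa8 fa9
  refine ⟨σ₆, ?_, h⟩
  have := r1.trans_silent (r2.trans_silent (r3.trans_silent (r4.trans_silent (r5.trans_silent r6))))
  rwa [show 1 + (ℓ + 1 + (L + 1 + (n + 1 + (R₀ + (n + 1))))) = 2 * n + ℓ + L + R₀ + 5 by omega]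
    at this

end preprocessing

/-! ## Correctness with respect to the graph -/

/-- An unreached head would be unfinished, so fewer than `n` vertices would be finished. Then
`key_bound` leaves room for one more edge below `n * wmax < 2 ^ L`, and since the edge is relaxed,
the head would have a finite key. -/
theorem Search.Inv.head_lt_of_final {n L src wmax : ℕ} {inp : ℕ → ℕ} {Walk : ℕ → ℕ → Prop}
    {S : Search} (hs : Search.Setting n L src wmax inp Walk)
    (h : Search.Inv n L src wmax inp Walk S) (hf : S.Final) {u : ℕ} (hu : u < n)
    (hlt : S.key u < 2 ^ L) {k : ℕ} (hk : k < degreeOf inp u) :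
    S.key (headOf inp u k) < 2 ^ L := by
  by_contra hge
  have h1 := h.relaxed_of_final hf hu hlt hk
  have h2 := hs.head_lt u hu k hk
  have h3 : S.bd (S.top + 1) < n := by
    by_contra hn
    exact hge (h.finished _ h2 ((h.idx_lt _ h2).trans_le (not_lt.1 hn))).2
  have h4 := h.key_bound u hu hlt
  have h5 := hs.weight_le u hu k hk
  have h6 := hs.lt_pow
  have h7 : (S.bd (S.top + 1) + 1) * wmax ≤ n * wmax := Nat.mul_le_mul_right _ h3
  rw [Nat.succ_mul] at h7
  omega

theorem HasWalk.snoc {V : Type*} {G : Digraph V} {w : V → V → ℕ} {s u v : V} {k : ℕ}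
    (p : HasWalk G w s u k) (h : G.Adj u v) : HasWalk G w s v (k + w u v) := by
  induction p with
  | nil s => simpa [Nat.add_comm] using HasWalk.cons h (HasWalk.nil (w := w) v)
  | cons h' p ih => simpa [Nat.add_assoc] using HasWalk.cons h' (ih h)

theorem wdist_eq_coe {V : Type*} {G : Digraph V} {w : V → V → ℕ} {s t : V} {d : ℕ}
    (h : HasWalk G w s t d) (hle : ∀ k, HasWalk G w s t k → d ≤ k) : wdist G w s t = d :=
  le_antisymm (iInf₂_le (α := ℕ∞) d h) (le_iInf₂ fun k hk => Nat.cast_le.2 (hle k hk))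

theorem wdist_eq_top {V : Type*} {G : Digraph V} {w : V → V → ℕ} {s t : V}
    (h : ∀ k, ¬ HasWalk G w s t k) : wdist G w s t = ⊤ :=
  top_le_iff.1 (le_iInf₂ fun k hk => absurd hk (h k))

/-! ### Reading the encoded graph -/

/-- The memory content `inp` represents the graph. -/
structure EncodesGraph {n : ℕ} (w : Fin n → Fin n → ℕ) (adj : Fin n → List (Fin n))
    (inp : ℕ → ℕ) : Prop where
  size : inp 0 = n
  addr : ∀ v : Fin n, blockAddr inp v = 1 + n + ∑ u ∈ Finset.Iio v, (1 + 2 * (adj u).length)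
  degree : ∀ v : Fin n, degreeOf inp v = (adj v).length
  head : ∀ (v : Fin n) (k : ℕ) (hk : k < (adj v).length), headOf inp v k = ((adj v)[k] : ℕ)
  weight : ∀ (v : Fin n) (k : ℕ) (hk : k < (adj v).length), weightOf inp v k = w v (adj v)[k]

theorem List.getD_flatMap {α β : Type*} (f : α → List β) (d : β) (l : List α) {i j : ℕ}
    (hi : i < l.length) (hj : j < (f l[i]).length) :
    (l.flatMap f).getD (((l.take i).map fun a => (f a).length).sum + j) d = (f l[i]).getD j d := by
  induction l generalizing i with
  | nil => simp at hi
  | cons a l ih =>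
    cases i with
    | zero =>
      simp only [List.getElem_cons_zero] at hj ⊢
      simp [List.getElem?_append_left hj]
    | succ i =>
      simp only [List.getElem_cons_succ, List.length_cons, Nat.add_lt_add_iff_right] at hj hi ⊢
      rw [← ih hi hj]
      simp [Nat.add_assoc, List.getElem?_append_right]

theorem List.getD_flatMap_pair {α : Type*} (f g : α → ℕ) (l : List α) {k : ℕ} (hk : k < l.length) :
    (l.flatMap fun a => [f a, g a]).getD (2 * k) 0 = f l[k] ∧
      (l.flatMap fun a => [f a, g a]).getD (2 * k + 1) 0 = g l[k] := by
  induction l generalizing k with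
  | nil => simp at hk
  | cons a l ih =>
    cases k with
    | zero => simp
    | succ k =>
      have := ih (k := k) (by simpa using hk)
      simpa [Nat.mul_succ] using this

variable {n : ℕ} {w : Fin n → Fin n → ℕ} {adj : Fin n → List (Fin n)}

theorem length_vertexBlock (w : Fin n → Fin n → ℕ) (adj : Fin n → List (Fin n)) (v : Fin n) :
    (vertexBlock w adj v).length = 1 + 2 * (adj v).length := by
  simp [vertexBlock, List.length_flatMap, Nat.add_comm, Nat.mul_comm]

theorem getD_encodeGraph (w : Fin n → Fin n → ℕ) (adj : Fin n → List (Fin n)) (v : Fin n) {j : ℕ}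
    (hj : j < (vertexBlock w adj v).length) :
    (encodeGraph w adj).getD
      (1 + n + ∑ u ∈ Finset.Iio v, (1 + 2 * (adj u).length) + j) 0 =
        (vertexBlock w adj v).getD j 0 := by
  have h1 : ((((List.finRange n).take v).map fun a => (vertexBlock w adj a).length).sum) =
      ∑ u ∈ Finset.Iio v, (1 + 2 * (adj u).length) := by
    rw [List.map_take, ← List.ofFn_eq_map, List.sum_take_ofFn]
    refine Finset.sum_congr ?_ fun u _ => length_vertexBlock w adj u
    ext u; simp
  have h2 := List.getD_flatMap (vertexBlock w adj) 0 (List.finRange n) (i := v) (j := j) (by simp)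
    (by simpa using hj)
  rw [h1] at h2
  simp only [List.getElem_finRange, Fin.cast_mk, Fin.eta] at h2
  rw [← h2, encodeGraph, List.getD_append_right _ _ _ _ (by simp; omega)]
  congr 1
  simp
  omega

theorem encodesGraph_getD (w : Fin n → Fin n → ℕ) (adj : Fin n → List (Fin n)) :
    EncodesGraph w adj fun a => (encodeGraph w adj).getD a 0 := by
  have haddr : ∀ v : Fin n, (encodeGraph w adj).getD (v + 1) 0 =
      1 + n + ∑ u ∈ Finset.Iio v, (1 + 2 * (adj u).length) := by
    intro v
    rw [encodeGraph, List.getD_append _ _ _ _ (by simp), List.getD_cons_succ]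
    simp [length_vertexBlock]
  have hblock : ∀ (v : Fin n) (j : ℕ), j < 1 + 2 * (adj v).length →
      (encodeGraph w adj).getD ((encodeGraph w adj).getD (v + 1) 0 + j) 0 =
        (vertexBlock w adj v).getD j 0 := by
    intro v j hj
    rw [haddr v, getD_encodeGraph w adj v (by rwa [length_vertexBlock])]
  constructor
  · simp [encodeGraph]
  · exact haddr
  · intro v
    have := hblock v 0 (by omega)
    simpa [vertexBlock, degreeOf, blockAddr] using this
  · intro v k hk
    have := hblock v (1 + 2 * k) (by omega)
    rw [headOf, blockAddr, Nat.add_assoc, this, vertexBlock, Nat.add_comm 1, List.getD_cons_succ,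
      (List.getD_flatMap_pair _ _ _ hk).1]
  · intro v k hk
    have := hblock v (1 + (2 * k + 1)) (by omega)
    rw [weightOf, blockAddr, Nat.add_assoc, Nat.add_assoc, this, vertexBlock, Nat.add_comm 1,
      List.getD_cons_succ, (List.getD_flatMap_pair _ _ _ hk).2]

/-- All numbers of the encoding are small. -/
theorem getD_encodeGraph_le {B : ℕ} (hn : n ≤ B)
    (haddr : 1 + n + ∑ u : Fin n, (1 + 2 * (adj u).length) ≤ B)
    (hw : ∀ u, ∀ v ∈ adj u, w u v ≤ B) (a : ℕ) : (encodeGraph w adj).getD a 0 ≤ B := by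
  have hall : ∀ x ∈ encodeGraph w adj, x ≤ B := by
    intro x hx
    simp only [encodeGraph, List.cons_append, List.mem_cons, List.mem_append, List.mem_ofFn,
      List.mem_flatMap] at hx
    rcases hx with rfl | ⟨v, rfl⟩ | ⟨v, -, hx⟩
    · exact hn
    · have := Finset.sum_le_sum_of_subset (f := fun u : Fin n => 1 + 2 * (adj u).length)
        (Finset.subset_univ (Finset.Iio v))
      simp only [length_vertexBlock]
      omega
    simp only [vertexBlock, List.mem_cons, List.mem_flatMap, List.not_mem_nil, or_false] at hx
    rcases hx with rfl | ⟨u, hu, rfl | rfl⟩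
    · have := Finset.single_le_sum (f := fun u : Fin n => 1 + 2 * (adj u).length)
        (fun _ _ => Nat.zero_le _) (Finset.mem_univ v)
      omega
    · exact u.2.le.trans hn
    · exact hw v u hu
  rw [List.getD_eq_getElem?_getD]
  rcases h : (encodeGraph w adj)[a]? with _ | x
  · simp
  · exact hall x (List.mem_of_getElem? h)

/-! ### Keys and lightest edges as distances -/

section distances

variable {G : Digraph (Fin n)} {inp : ℕ → ℕ} {L c src : ℕ} {S : Search}

theorem EncodesGraph.setting (he : EncodesGraph w adj inp) (ha : IsAdjacencyLists G adj)
    (hw : ∀ u v, G.Adj u v → w u v ≤ n ^ c) (hL : n * n ^ c < 2 ^ L) (hsrc : src < n) :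
    Search.Setting n L src (n ^ c) inp
      (fun u k => ∃ hu : u < n, HasWalk G w ⟨src, hsrc⟩ ⟨u, hu⟩ k) := by
  have hhead : ∀ u (hu : u < n), ∀ k (hk : k < degreeOf inp u), ∃ v, G.Adj ⟨u, hu⟩ v ∧
      headOf inp u k = v ∧ weightOf inp u k = w ⟨u, hu⟩ v := by
    intro u hu k hk
    rw [he.degree ⟨u, hu⟩] at hk
    exact ⟨_, ((ha ⟨u, hu⟩).2 _).1 (List.getElem_mem hk), he.head ⟨u, hu⟩ k hk,
      he.weight ⟨u, hu⟩ k hk⟩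
  refine ⟨hsrc, ⟨hsrc, .nil _⟩, fun u hu k hk => ?_, fun u hu k hk => ?_, ?_, hL⟩
  · obtain ⟨v, h1, h2, h3⟩ := hhead u hu k hk
    rw [h2]; exact v.2
  · obtain ⟨v, h1, h2, h3⟩ := hhead u hu k hk
    rw [h3]; exact hw _ _ h1
  · rintro u hu k hk x ⟨_, hx⟩
    obtain ⟨v, h1, h2, h3⟩ := hhead u hu k hk
    rw [h2, h3]
    exact ⟨v.2, hx.snoc h1⟩

theorem EncodesGraph.exists_of_adj (he : EncodesGraph w adj inp) (ha : IsAdjacencyLists G adj)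
    {u v : Fin n} (h : G.Adj u v) :
    ∃ k < degreeOf inp u, headOf inp u k = v ∧ weightOf inp u k = w u v := by
  obtain ⟨k, hk, hv⟩ := List.getElem_of_mem (((ha u).2 v).2 h)
  exact ⟨k, by rwa [he.degree], by rw [he.head u k hk, hv], by rw [he.weight u k hk, hv]⟩

/-- When the search has come to its end, the keys are the distances. -/
theorem EncodesGraph.wdist_eq_distOf (he : EncodesGraph w adj inp) (ha : IsAdjacencyLists G adj)
    (hw : ∀ u v, G.Adj u v → w u v ≤ n ^ c) (hL : n * n ^ c < 2 ^ L) (hsrc : src < n)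
    (h : Search.Inv n L src (n ^ c) inp
      (fun u k => ∃ hu : u < n, HasWalk G w ⟨src, hsrc⟩ ⟨u, hu⟩ k) S) (hf : S.Final) (t : Fin n) :
    wdist G w ⟨src, hsrc⟩ t = distOf L (S.key t) := by
  -- The relaxed edges make the keys a feasible potential; summing along a walk shows that its end
  -- is reached, with a key at most the initial key plus the weight of the walk.
  have hpot : ∀ (s t : Fin n) (k : ℕ), HasWalk G w s t k → S.key s < 2 ^ L →
      S.key t < 2 ^ L ∧ S.key t ≤ S.key s + k := by
    intro s t k p
    induction p with
    | nil s => exact fun hlt => ⟨hlt, by omega⟩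
    | cons hadj p ih =>
      intro hlt
      obtain ⟨k, hk, h1, h2⟩ := he.exists_of_adj ha hadj
      have h3 := h.head_lt_of_final (he.setting ha hw hL hsrc) hf (Fin.is_lt _) hlt hk
      have h4 := h.relaxed_of_final hf (Fin.is_lt _) hlt hk
      rw [h1] at h3 h4
      have := ih h3
      omega
  have h0 : S.key src < 2 ^ L := by rw [h.key_src]; positivity
  unfold distOf
  split_ifs with hlt
  · obtain ⟨_, hwalk⟩ := h.walk t t.2 hlt
    refine wdist_eq_coe hwalk fun k hk => ?_
    have := (hpot _ _ k hk h0).2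
    simpa [h.key_src] using this
  · exact wdist_eq_top fun k hk => hlt (hpot _ _ k hk h0).1

theorem lightestEdge_ne (L : ℕ) (inp : ℕ → ℕ) (u k : ℕ) : (lightestEdge L inp u k).2 ≠ u := by
  induction k with
  | zero => simp only [lightestEdge]; split_ifs <;> omega
  | succ k ih =>
    rw [lightestEdge]
    split_ifs with h
    · exact h.1
    · exact ih

theorem lightestEdge_lt {u k : ℕ} (hn : 2 ≤ n)
    (hhead : ∀ j < k, headOf inp u j < n) : (lightestEdge L inp u k).2 < n := by
  induction k with
  | zero => simp only [lightestEdge]; split_ifs <;> omega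
  | succ k ih =>
    rw [lightestEdge]
    split_ifs with h
    · exact hhead k (by omega)
    · exact ih fun j hj => hhead j (by omega)

theorem lightestEdge_le (L : ℕ) (inp : ℕ → ℕ) {u j k : ℕ} (hj : j < k) (hu : headOf inp u j ≠ u) :
    (lightestEdge L inp u k).1 ≤ weightOf inp u j := by
  induction k with
  | zero => omega
  | succ k ih =>
    rcases Nat.lt_succ_iff_lt_or_eq.1 hj with hj | rfl
    · have := ih hj
      rw [lightestEdge]
      split_ifs with h
      · exact h.2.le.trans this
      · exact this
    · rw [lightestEdge]
      split_ifs with h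
      · exact le_rfl
      · by_contra hlt
        exact h ⟨hu, not_le.1 hlt⟩

theorem lightestEdge_mem {u k : ℕ} (hlt : (lightestEdge L inp u k).1 < 2 ^ L) :
    ∃ j < k, headOf inp u j = (lightestEdge L inp u k).2 ∧
      weightOf inp u j = (lightestEdge L inp u k).1 := by
  induction k with
  | zero => simp [lightestEdge] at hlt
  | succ k ih =>
    rw [lightestEdge] at hlt ⊢
    split_ifs at hlt ⊢ with h
    · exact ⟨k, by omega, rfl, rfl⟩
    · obtain ⟨j, hj, h⟩ := ih hlt
      exact ⟨j, by omega, h⟩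

/-- The distance to the head of the lightest edge is the weight of that edge. -/
theorem EncodesGraph.wdist_lightestEdge (he : EncodesGraph w adj inp) (ha : IsAdjacencyLists G adj)
    (hw : ∀ u v, G.Adj u v → w u v ≤ n ^ c) (hL : n * n ^ c < 2 ^ L) (u t : Fin n)
    (ht : (t : ℕ) = (lightestEdge L inp u (degreeOf inp u)).2) :
    wdist G w u t = distOf L (lightestEdge L inp u (degreeOf inp u)).1 := by
  have hn : 0 < n := u.pos
  have htu : t ≠ u := by
    rintro rfl
    exact lightestEdge_ne L inp _ _ ht.symm
  -- A walk from `u` to another vertex has to leave `u`. Loops made before that only add weight, and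
  -- the edge that leaves is among those compared.
  have hlow : ∀ (s t' : Fin n) (k : ℕ), HasWalk G w s t' k → s = u → t' ≠ u →
      (lightestEdge L inp u (degreeOf inp u)).1 ≤ k ∧
        (lightestEdge L inp u (degreeOf inp u)).1 < 2 ^ L := by
    intro s t' k p
    induction p with
    | nil s => exact fun h h' => absurd h h'
    | @cons s v t' k hadj p ih =>
      rintro rfl hne
      by_cases hv : v = s
      · have := ih hv hne
        omega
      · obtain ⟨j, hj, h1, h2⟩ := he.exists_of_adj ha hadj
        have h3 := lightestEdge_le L inp hj (by rw [h1]; exact fun h => hv (Fin.ext h))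
        have h4 := hw _ _ hadj
        have h5 : n ^ c ≤ n * n ^ c := Nat.le_mul_of_pos_left _ hn
        omega
  unfold distOf
  split_ifs with hlt
  · obtain ⟨j, hj, h1, h2⟩ := lightestEdge_mem hlt
    rw [he.degree] at hj
    have hadj : G.Adj u (adj u)[j] := ((ha u).2 _).1 (List.getElem_mem hj)
    rw [he.head u j hj, ← ht] at h1
    rw [he.weight u j hj, Fin.ext h1] at h2
    rw [Fin.ext h1] at hadj
    refine wdist_eq_coe ?_ fun k hk => (hlow _ _ k hk rfl htu).1
    rw [← h2]
    simpa using HasWalk.cons hadj (HasWalk.nil (w := w) t)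
  -- If no edge beats the initial value `2 ^ L`, all edges of `u` are loops, and the default target
  -- is unreachable.
  · exact wdist_eq_top fun k hk => hlt (hlow _ _ k hk rfl htu).2

theorem IsAdjacencyLists.length_eq (ha : IsAdjacencyLists G adj) (v : Fin n) :
    (adj v).length = {u : Fin n | G.Adj v u}.ncard := by
  rw [← List.toFinset_card_of_nodup (ha v).1, ← Set.ncard_coe_finset]
  congr 1
  ext u
  simp [(ha v).2 u]

theorem EncodesGraph.sum_degree (he : EncodesGraph w adj inp) :
    ∑ u ∈ Finset.range n, degreeOf inp u = ∑ u : Fin n, (adj u).length := by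
  rw [Finset.sum_range]
  exact Finset.sum_congr rfl fun u _ => he.degree u

theorem EncodesGraph.avgDegree_eq (he : EncodesGraph w adj inp) (ha : IsAdjacencyLists G adj) :
    avgDegree G = (∑ u ∈ Finset.range n, degreeOf inp u : ℕ) / (n : ℝ) := by
  rw [he.sum_degree, avgDegree]
  congr 1
  push_cast
  exact Finset.sum_congr rfl fun u _ => by rw [ha.length_eq]

end distances

/-! ## The sequence of rounds -/

/-- The distances, as a function of natural numbers. -/
noncomputable def natDist {n : ℕ} (G : Digraph (Fin n)) (w : Fin n → Fin n → ℕ) (s t : ℕ) : ℕ∞ :=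
  if h : s < n ∧ t < n then wdist G w ⟨s, h.1⟩ ⟨t, h.2⟩ else ⊤

theorem natDist_coe {n : ℕ} (G : Digraph (Fin n)) (w : Fin n → Fin n → ℕ) (s t : Fin n) :
    natDist G w s t = wdist G w s t := by
  rw [natDist, dif_pos ⟨s.2, t.2⟩]

/-- The assumptions on the graph and the parameters of the machine. -/
structure Layout {n : ℕ} (c : ℕ) (G : Digraph (Fin n)) (w : Fin n → Fin n → ℕ)
    (adj : Fin n → List (Fin n)) (inp : ℕ → ℕ) (V Sz L R₀ R : ℕ) : Prop where
  two_le : 2 ≤ n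
  sizes : Sizes V Sz n L R inp
  encodes : EncodesGraph w adj inp
  lists : IsAdjacencyLists G adj
  weight_le : ∀ u v, G.Adj u v → w u v ≤ n ^ c
  lt_pow : n * n ^ c < 2 ^ L
  R₀_eq : R₀ = (∑ u ∈ Finset.range n, degreeOf inp u) / n + 1
  R_eq : R = 2 * (R₀ + (4 * L + 6))

/-- The target of `u` that is emitted in phase `0`, for vertices of degree at most `D`; for the other
vertices, `u` itself. -/
def earlyTarget (L D : ℕ) (inp : ℕ → ℕ) (u : ℕ) : ℕ :=
  if degreeOf inp u ≤ D then (lightestEdge L inp u (degreeOf inp u)).2 else u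

/-- The output of round number `a`. -/
noncomputable def roundOutput {n : ℕ} (G : Digraph (Fin n)) (w : Fin n → Fin n → ℕ) (inp : ℕ → ℕ)
    (L D cnt : ℕ) (low : ℕ → ℕ) (a : ℕ) : List Output :=
  if a < cnt then [(low a, earlyTarget L D inp (low a), natDist G w (low a) (earlyTarget L D inp (low a)))]
  else if (a - cnt) % n = (a - cnt) / n ∨ (a - cnt) % n = earlyTarget L D inp ((a - cnt) / n) then []
  else [((a - cnt) / n, (a - cnt) % n, natDist G w ((a - cnt) / n) ((a - cnt) % n))]

theorem roundOutput_late {n : ℕ} (G : Digraph (Fin n)) (w : Fin n → Fin n → ℕ) (inp : ℕ → ℕ)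
    (L D cnt : ℕ) (low : ℕ → ℕ) (p : ℕ) {j : ℕ} (hj : j < n) :
    roundOutput G w inp L D cnt low (cnt + (p * n + j)) =
      if j = p ∨ j = earlyTarget L D inp p then [] else [(p, j, natDist G w p j)] := by
  have h1 : (p * n + j) % n = j := Nat.mul_add_mod_of_lt hj
  have h2 : (p * n + j) / n = p := by
    rw [Nat.mul_comm, Nat.mul_add_div (by omega), Nat.div_eq_of_lt hj, Nat.add_zero]
  rw [roundOutput, if_neg (by omega), Nat.add_sub_cancel_left, h1, h2]

section rounds

variable {n : ℕ} {c : ℕ} {G : Digraph (Fin n)} {w : Fin n → Fin n → ℕ}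
  {adj : Fin n → List (Fin n)} {inp : ℕ → ℕ} {V Sz L R₀ R cnt D : ℕ} {low : ℕ → ℕ}

/-- The state before round `j` of phase `0`. -/
structure EarlyState (n : ℕ) (inp : ℕ → ℕ) (L R D cnt : ℕ) (low : ℕ → ℕ) (j : ℕ) (σ : ArrState)
    (S₀ : Search) (C : Control) : Prop where
  constants : Constants n L R C
  p_eq : C.p = 0
  j_eq : C.j = j
  jend_eq : C.jend = cnt
  src_eq : C.src = 0
  low_eq : C.low = low
  skip_eq : ∀ u < n, C.skip u = if ∃ i < j, low i = u then earlyTarget L D inp u else u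
  start : Search.Start n L 0 S₀
  holds : Holds ((Search.step n L 0 inp)^[j * R] S₀) C 0 σ

/-- The state before round `j` of phase `p + 1`. -/
structure LateState {n : ℕ} (G : Digraph (Fin n)) (w : Fin n → Fin n → ℕ) (inp : ℕ → ℕ)
    (L R D : ℕ) (p j : ℕ) (σ : ArrState) (S₀ : Search) (C : Control) : Prop where
  constants : Constants n L R C
  p_eq : C.p = p + 1
  j_eq : C.j = j
  jend_eq : C.jend = n
  src_eq : C.src = min (p + 1) (n - 1)
  skip_eq : ∀ u < n, C.skip u = earlyTarget L D inp u
  start : Search.Start n L (min (p + 1) (n - 1)) S₀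
  -- The search of this phase starts on the final keys of the previous one; these are the distances
  -- to be emitted now.
  key_eq : ∀ t < n, distOf L (S₀.key t) = natDist G w p t
  holds : Holds ((Search.step n L (min (p + 1) (n - 1)) inp)^[j * R] S₀) C 0 σ

/-- Before round number `a`, the idealized machine is in the situation `X`. -/
def AtRound (G : Digraph (Fin n)) (w : Fin n → Fin n → ℕ) (inp : ℕ → ℕ) (L R D cnt : ℕ)
    (low : ℕ → ℕ) (a : ℕ) (X : ℕ × ArrState) : Prop :=
  (a < cnt ∧ X.1 = 7 ∧ ∃ S₀ C, EarlyState n inp L R D cnt low a X.2 S₀ C) ∨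
  (∃ p j, p < n ∧ j < n ∧ a = cnt + (p * n + j) ∧ X.1 = 7 ∧
    ∃ S₀ C, LateState G w inp L R D p j X.2 S₀ C) ∨
  (a = cnt + n * n ∧ X.1 = 11)

/-- Markov's inequality: `R₀` exceeds the average degree, so fewer than half of the vertices have
degree above `2 * R₀`. -/
theorem LowList.le_two_mul (hl : LowList inp (2 * R₀) n cnt low) (hn : 0 < n)
    (hR₀ : R₀ = (∑ u ∈ Finset.range n, degreeOf inp u) / n + 1) : n ≤ 2 * cnt := by
  have hm : ∑ u ∈ Finset.range n, degreeOf inp u < n * R₀ := by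
    rw [hR₀]
    exact Nat.lt_mul_div_succ _ hn
  have h1 : ((Finset.range n).filter fun u => degreeOf inp u ≤ 2 * R₀).card ≤ cnt := by
    have : ((Finset.range n).filter fun u => degreeOf inp u ≤ 2 * R₀) ⊆
        (Finset.range cnt).image low := by
      intro u hu
      simp only [Finset.mem_filter, Finset.mem_range] at hu
      obtain ⟨j, hj, h⟩ := hl.surj u hu.1 hu.2
      exact Finset.mem_image.2 ⟨j, Finset.mem_range.2 hj, h⟩
    exact (Finset.card_le_card this).trans (Finset.card_image_le.trans (by simp))
  have h2 := Finset.card_filter_add_card_filter_not (s := Finset.range n)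
    (fun u => degreeOf inp u ≤ 2 * R₀)
  rw [Finset.card_range] at h2
  have h3 : ((Finset.range n).filter fun u => ¬ degreeOf inp u ≤ 2 * R₀).card * (2 * R₀) ≤
      ∑ u ∈ Finset.range n, degreeOf inp u := by
    rw [← smul_eq_mul, ← Finset.sum_const]
    refine (Finset.sum_le_sum fun u hu => ?_).trans
      (Finset.sum_le_sum_of_subset (Finset.filter_subset _ _))
    simp only [Finset.mem_filter, Finset.mem_range] at hu
    omega
  by_contra hlt
  generalize ((Finset.range n).filter fun u => ¬ degreeOf inp u ≤ 2 * R₀).card = x at h2 h3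
  have h4 : n ≤ 2 * x := by omega
  have h5 : n * R₀ ≤ 2 * x * R₀ := Nat.mul_le_mul_right _ h4
  have h6 : 2 * x * R₀ = x * (2 * R₀) := by ring
  omega

namespace Layout

/-- The factor `2` in `R` compensates for phase `0` possibly having only `n / 2` rounds. Later
phases, with `n` rounds, satisfy the hypothesis trivially. -/
theorem steps_le (hy : Layout c G w adj inp V Sz L R₀ R)
    (hc : n ≤ 2 * cnt) :
    ∑ u ∈ Finset.range n, degreeOf inp u + n * (4 * L + 6) ≤ cnt * R := by
  have hm : ∑ u ∈ Finset.range n, degreeOf inp u < n * R₀ := by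
    rw [hy.R₀_eq]
    exact Nat.lt_mul_div_succ _ (by have := hy.two_le; omega)
  have h1 : n * (R₀ + (4 * L + 6)) ≤ 2 * cnt * (R₀ + (4 * L + 6)) := Nat.mul_le_mul_right _ hc
  have h2 : 2 * cnt * (R₀ + (4 * L + 6)) = cnt * R := by rw [hy.R_eq]; ring
  rw [Nat.mul_add n] at h1
  omega

theorem headOf_lt (hy : Layout c G w adj inp V Sz L R₀ R)
    {u k : ℕ} (hu : u < n) (hk : k < degreeOf inp u) : headOf inp u k < n :=
  (hy.encodes.setting hy.lists hy.weight_le hy.lt_pow hu).head_lt u hu k hk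

theorem earlyTarget_lt (hy : Layout c G w adj inp V Sz L R₀ R)
    {u : ℕ} (hu : u < n) : earlyTarget L D inp u < n := by
  unfold earlyTarget
  split_ifs
  · exact lightestEdge_lt hy.two_le fun j hj => hy.headOf_lt hu hj
  · exact hu

theorem natDist_earlyTarget (hy : Layout c G w adj inp V Sz L R₀ R)
    {u : ℕ} (hu : u < n) (hd : degreeOf inp u ≤ D) :
    natDist G w u (earlyTarget L D inp u) =
      distOf L (lightestEdge L inp u (degreeOf inp u)).1 := by
  rw [← hy.encodes.wdist_lightestEdge hy.lists hy.weight_le hy.lt_pow ⟨u, hu⟩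
    ⟨earlyTarget L D inp u, hy.earlyTarget_lt hu⟩ (by exact if_pos hd), natDist,
    dif_pos ⟨hu, hy.earlyTarget_lt hu⟩]

/-- The next phase begins. -/
theorem runs_nextPhase (hy : Layout c G w adj inp V Sz L R₀ R)
    {S₀ : Search} {C : Control} {σ : ArrState} {p src t : ℕ} (hp : p < n)
    (hC : Constants n L R C) (hCp : C.p = p) (hj : C.j + 1 = C.jend) (hjn : C.jend ≤ n)
    (hsrc : src = min p (n - 1)) (hCs : C.src = src)
    (hskip : ∀ u < n, C.skip u = earlyTarget L D inp u) (h₀ : Search.Start n L src S₀)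
    (ht : ∑ u ∈ Finset.range n, degreeOf inp u + n * (4 * L + 6) ≤ t)
    (hh : Holds ((Search.step n L src inp)^[t] S₀) C 0 σ) :
    ∃ σ' S₀' C', BlockRuns (blocks c) V Sz inp (10, σ) 2 [] (7, σ') ∧
      LateState G w inp L R D p 0 σ' S₀' C' := by
  have hn := hy.two_le
  have hsp : src = p := by omega
  subst hsp
  obtain ⟨σ₁, r1, hh1⟩ := runs_nextRound_phase (c := c) hy.sizes hC hh hj hjn (by omega)
  have hset := hy.encodes.setting hy.lists hy.weight_le hy.lt_pow hp
  have hnt : n * 6 ≤ n * (4 * L + 6) := Nat.mul_le_mul_left _ (by omega)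
  have hinv := h₀.inv_iterate hset (t := t) (by omega)
  have hfin := h₀.final_iterate hset ht
  have hC1 : Constants n L R σ₁.control := by
    obtain ⟨h1, h2, h3, h4, h5, h6, h7⟩ := hC
    rw [hh1.control_eq]
    exact ⟨h1, h2, h3, h4, h5, h6, h7⟩
  have hs1 : σ₁.control.src = min (src + 1) (n - 1) := by
    rw [hh1.control_eq]
    simp only [hCp, hCs]
    split_ifs <;> omega
  obtain ⟨σ₂, S₂, r2, hh2, hst, hkey⟩ := runs_setup (c := c) hy.sizes hC1 hs1 (by omega)
    (by rw [hh1.search_eq]; exact hinv.idle)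
  refine ⟨σ₂, S₂, σ₁.control, r1.trans_silent r2, hC1, ?_, ?_, ?_, hs1, ?_, hst, ?_, ?_⟩
  · rw [hh1.control_eq]; simp [hCp]
  · rw [hh1.control_eq]
  · rw [hh1.control_eq]
  · rw [hh1.control_eq]; exact hskip
  · intro t' ht'
    rw [hkey, hh1.search_eq]
    have := hy.encodes.wdist_eq_distOf hy.lists hy.weight_le hy.lt_pow hp hinv hfin ⟨t', ht'⟩
    rw [← this, natDist, dif_pos ⟨hp, ht'⟩]
  · simpa using hh2

/-- The bound on the blocks adds up `R + 1` for the search steps, at most `2 * R₀ + 2` for the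
lightest edge of a vertex of low degree, and at most `2` for passing to the next round or phase. -/
theorem runs_early (hy : Layout c G w adj inp V Sz L R₀ R)
    (hl : LowList inp (2 * R₀) n cnt low) {a : ℕ} (ha : a < cnt) {σ : ArrState}
    {S₀ : Search} {C : Control} (h : EarlyState n inp L R (2 * R₀) cnt low a σ S₀ C) :
    ∃ Y k, BlockRuns (blocks c) V Sz inp (7, σ) k (roundOutput G w inp L (2 * R₀) cnt low a) Y ∧
      k ≤ R + 2 * R₀ + 5 ∧ AtRound G w inp L R (2 * R₀) cnt low (a + 1) Y := by
  have hn := hy.two_le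
  have hset := hy.encodes.setting hy.lists hy.weight_le hy.lt_pow (show 0 < n by omega)
  have hu := hl.lt a ha
  have hd := hl.degree a ha
  have hcn := hl.le
  have het : earlyTarget L (2 * R₀) inp (low a) =
    (lightestEdge L inp (low a) (degreeOf inp (low a))).2 := if_pos hd
  obtain ⟨σ₁, r1, hh1⟩ := runs_round (c := c) hy.sizes h.constants h.src_eq hset h.start h.holds
  obtain ⟨σ₂, r2, hh2⟩ := runs_lightest (c := c) hy.sizes h.constants hh1 h.p_eq (u := low a)
    (by rw [h.j_eq]; omega) (by rw [h.low_eq, h.j_eq]) hu fun k hk => hy.headOf_lt hu hk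
  rw [← het, ← hy.natDist_earlyTarget hu hd] at r2
  rw [← het] at hh2
  have hout : roundOutput G w inp L (2 * R₀) cnt low a = [(low a, earlyTarget L (2 * R₀) inp (low a),
    natDist G w (low a) (earlyTarget L (2 * R₀) inp (low a)))] := if_pos ha
  rw [← hout] at r2
  rw [← Nat.succ_mul] at hh2
  have hC2 : Constants n L R
      { C with skip := Function.update C.skip (low a) (earlyTarget L (2 * R₀) inp (low a)) } := by
    obtain ⟨h1, h2, h3, h4, h5, h6, h7⟩ := h.constants
    exact ⟨h1, h2, h3, h4, h5, h6, h7⟩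
  have hskip : ∀ u < n, Function.update C.skip (low a) (earlyTarget L (2 * R₀) inp (low a)) u =
      if ∃ i < a + 1, low i = u then earlyTarget L (2 * R₀) inp u else u := by
    intro u hu
    rw [Function.update_apply]
    split_ifs with h1 h2 h2
    · rw [h1]
    · exact absurd ⟨a, by omega, h1.symm⟩ h2
    · obtain ⟨i, hi, rfl⟩ := h2
      have : i ≠ a := by rintro rfl; exact h1 rfl
      rw [h.skip_eq _ hu, if_pos ⟨i, by omega, rfl⟩]
    · rw [h.skip_eq _ hu, if_neg]
      rintro ⟨i, hi, h3⟩
      exact h2 ⟨i, by omega, h3⟩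
  by_cases hend : a + 1 < cnt
  · obtain ⟨σ₃, r3, hh3⟩ := runs_nextRound_same (c := c) hy.sizes hC2 hh2
      (by simp only [h.j_eq, h.jend_eq]; exact hend) (by simp only [h.jend_eq]; exact hcn)
    refine ⟨_, _, r1.trans_silent (List.append_nil _ ▸ r2.trans r3), by omega,
      Or.inl ⟨hend, rfl, S₀, _, ?_, ?_, ?_, ?_, ?_, ?_, ?_, h.start, hh3⟩⟩
    · obtain ⟨h1, h2, h3, h4, h5, h6, h7⟩ := h.constants
      exact ⟨h1, h2, h3, h4, h5, h6, h7⟩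
    · exact h.p_eq
    · simp only [h.j_eq]
    · exact h.jend_eq
    · exact h.src_eq
    · exact h.low_eq
    · exact hskip
  · have hcnt : cnt = a + 1 := by omega
    have hskip' : ∀ u < n, Function.update C.skip (low a) (earlyTarget L (2 * R₀) inp (low a)) u =
        earlyTarget L (2 * R₀) inp u := by
      intro u hu
      rw [hskip u hu]
      split_ifs with h1
      · rfl
      · rw [earlyTarget, if_neg]
        intro hdu
        obtain ⟨i, hi, h2⟩ := hl.surj u hu hdu
        exact h1 ⟨i, by omega, h2⟩
    obtain ⟨σ₃, S₃, C₃, r3, hh3⟩ := hy.runs_nextPhase (D := 2 * R₀) (p := 0) (by omega) hC2 h.p_eq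
      (by simp only [h.j_eq, h.jend_eq]; omega) (by simp only [h.jend_eq]; exact hcn)
      (by omega) h.src_eq hskip' h.start
      (by rw [← Nat.add_one, ← hcnt]; exact hy.steps_le (hl.le_two_mul (by omega) hy.R₀_eq)) hh2
    exact ⟨_, _, r1.trans_silent (List.append_nil _ ▸ r2.trans r3), by omega,
      Or.inr (Or.inl ⟨0, 0, by omega, by omega, by omega, rfl, S₃, C₃, hh3⟩)⟩

theorem runs_late (hy : Layout c G w adj inp V Sz L R₀ R) {p j : ℕ} (hp : p < n) (hj : j < n)
    {σ : ArrState} {S₀ : Search} {C : Control} (h : LateState G w inp L R (2 * R₀) p j σ S₀ C) :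
    ∃ Y k, BlockRuns (blocks c) V Sz inp (7, σ) k
        (roundOutput G w inp L (2 * R₀) cnt low (cnt + (p * n + j))) Y ∧
      k ≤ R + 2 * R₀ + 5 ∧ AtRound G w inp L R (2 * R₀) cnt low (cnt + (p * n + j) + 1) Y := by
  have hn := hy.two_le
  have hsn : min (p + 1) (n - 1) < n := by omega
  have hset := hy.encodes.setting hy.lists hy.weight_le hy.lt_pow hsn
  have hR : 1 ≤ R := by rw [hy.R_eq]; omega
  obtain ⟨σ₁, r1, hh1⟩ := runs_round (c := c) hy.sizes h.constants h.src_eq hset h.start h.holds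
  rw [← Nat.succ_mul] at hh1
  obtain ⟨σ₂, r2, hh2⟩ := runs_emitNext (c := c) hy.sizes h.constants hh1 (by rw [h.p_eq]; omega)
    (by rw [h.p_eq]; omega) (by rw [h.j_eq]; exact hj)
  -- When target `j` is due, `(j + 1) * R > j` steps have been made, so its old key has reached the
  -- buffer.
  rw [h.p_eq, h.j_eq, Nat.add_sub_cancel, h.skip_eq p hp, h.start.buf_iterate hset hj (by nlinarith),
    h.key_eq j hj, ← roundOutput_late G w inp L (2 * R₀) cnt low p hj] at r2
  by_cases hend : j + 1 < n
  · obtain ⟨σ₃, r3, hh3⟩ := runs_nextRound_same (c := c) hy.sizes h.constants hh2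
      (by rw [h.j_eq, h.jend_eq]; exact hend) h.jend_eq.le
    refine ⟨_, _, r1.trans_silent (List.append_nil _ ▸ r2.trans r3), by omega,
      Or.inr (Or.inl ⟨p, j + 1, hp, hend, by omega, rfl, S₀, { C with j := C.j + 1 }, ?_, h.p_eq, ?_,
        h.jend_eq, h.src_eq, h.skip_eq, h.start, h.key_eq, hh3⟩)⟩
    · obtain ⟨h1, h2, h3, h4, h5, h6, h7⟩ := h.constants
      exact ⟨h1, h2, h3, h4, h5, h6, h7⟩
    · simp only [h.j_eq]
  · have hjn : j + 1 = n := by omega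
    have hadd : p * n + j + 1 = (p + 1) * n := by rw [Nat.succ_mul]; omega
    by_cases hpn : p + 1 < n
    · obtain ⟨σ₃, S₃, C₃, r3, hh3⟩ := hy.runs_nextPhase (D := 2 * R₀) (p := p + 1) hpn h.constants
        h.p_eq (by rw [h.j_eq, h.jend_eq]; exact hjn) h.jend_eq.le rfl h.src_eq h.skip_eq h.start
        (by rw [Nat.succ_eq_add_one, hjn]; exact hy.steps_le (by omega)) hh2
      exact ⟨_, _, r1.trans_silent (List.append_nil _ ▸ r2.trans r3), by omega,
        Or.inr (Or.inl ⟨p + 1, 0, hpn, by omega, by omega, rfl, S₃, C₃, hh3⟩)⟩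
    · have hpn' : p + 1 = n := by omega
      obtain ⟨σ₃, r3⟩ := runs_nextRound_end (c := c) hy.sizes h.constants hh2
        (by rw [h.j_eq, h.jend_eq]; exact hjn) h.jend_eq.le (by rw [h.p_eq]; exact hpn')
      refine ⟨_, _, r1.trans_silent (List.append_nil _ ▸ r2.trans r3), by omega,
        Or.inr (Or.inr ⟨?_, rfl⟩)⟩
      rw [hpn'] at hadd
      omega

theorem runs_atRound (hy : Layout c G w adj inp V Sz L R₀ R)
    (hl : LowList inp (2 * R₀) n cnt low) {a : ℕ} (ha : a < cnt + n * n)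
    {X : ℕ × ArrState} (h : AtRound G w inp L R (2 * R₀) cnt low a X) :
    ∃ Y k, BlockRuns (blocks c) V Sz inp X k (roundOutput G w inp L (2 * R₀) cnt low a) Y ∧
      k ≤ R + 2 * R₀ + 5 ∧ AtRound G w inp L R (2 * R₀) cnt low (a + 1) Y := by
  obtain ⟨l, σ⟩ := X
  rcases h with ⟨h1, rfl, S₀, C, h⟩ | ⟨p, j, hp, hj, rfl, rfl, S₀, C, h⟩ | ⟨h1, -⟩
  · exact hy.runs_early hl h1 h
  · exact hy.runs_late hp hj h
  · omega

theorem mem_roundOutput (hy : Layout c G w adj inp V Sz L R₀ R)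
    (hl : LowList inp (2 * R₀) n cnt low) (o : Output) :
    (∃ a < cnt + n * n, o ∈ roundOutput G w inp L (2 * R₀) cnt low a) ↔ o ∈ noSelfSolutions G w := by
  have hn := hy.two_le
  constructor
  · rintro ⟨a, ha, ho⟩
    unfold roundOutput at ho
    split_ifs at ho with h1 h2
    · rw [List.mem_singleton] at ho
      have hu := hl.lt a h1
      refine ⟨⟨low a, hu⟩, ⟨_, hy.earlyTarget_lt hu⟩, ?_, by rw [← natDist_coe]; exact ho⟩
      rw [Ne, Fin.mk.injEq, earlyTarget, if_pos (hl.degree a h1)]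
      exact (lightestEdge_ne _ _ _ _).symm
    · simp at ho
    · rw [List.mem_singleton] at ho
      rw [not_or] at h2
      refine ⟨⟨(a - cnt) / n, ?_⟩, ⟨(a - cnt) % n, Nat.mod_lt _ (by omega)⟩, ?_,
        by rw [← natDist_coe]; exact ho⟩
      · exact Nat.div_lt_of_lt_mul (by omega)
      · rw [Ne, Fin.mk.injEq]
        exact fun h => h2.1 h.symm
  · rintro ⟨s, t, hst, rfl⟩
    by_cases ht : (t : ℕ) = earlyTarget L (2 * R₀) inp s
    -- For a vertex of high degree the early target is the vertex itself, so `s ≠ t` forces low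
    -- degree, and the pair belongs to phase `0`.
    · have hd : degreeOf inp s ≤ 2 * R₀ := by
        by_contra hd
        rw [earlyTarget, if_neg hd] at ht
        exact hst (Fin.ext ht.symm)
      obtain ⟨a, ha, has⟩ := hl.surj s s.2 hd
      refine ⟨a, by omega, ?_⟩
      rw [roundOutput, if_pos ha, has, ← ht, natDist_coe]
      simp
    · refine ⟨cnt + (s * n + t), ?_, ?_⟩
      · have : (s + 1) * n ≤ n * n := Nat.mul_le_mul_right _ s.2
        rw [Nat.succ_mul] at this
        omega
      · rw [roundOutput_late _ _ _ _ _ _ _ _ t.2, if_neg]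
        · rw [natDist_coe]; simp
        · rw [not_or]
          exact ⟨fun h => hst (Fin.ext h.symm), ht⟩

theorem _root_.LowList.nodup_roundOutput (hl : LowList inp (2 * R₀) n cnt low) :
    ((List.range (cnt + n * n)).flatMap (roundOutput G w inp L (2 * R₀) cnt low)).Nodup := by
  -- The pair emitted in phase `0` is precisely the one left out in the phase of its first
  -- component.
  have hmix : ∀ a b, a < cnt → ¬ b < cnt → ∀ o,
      o ∈ roundOutput G w inp L (2 * R₀) cnt low a →
      o ∈ roundOutput G w inp L (2 * R₀) cnt low b → False := by
    intro a b ha hb o h1 h2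
    rw [roundOutput, if_pos ha, List.mem_singleton] at h1
    rw [roundOutput, if_neg hb] at h2
    split_ifs at h2 with h3
    · simp at h2
    · rw [List.mem_singleton, h1, Prod.mk.injEq, Prod.mk.injEq] at h2
      apply h3
      right
      rw [← h2.1, ← h2.2.1]
  refine List.nodup_flatMap.2 ⟨fun a _ => ?_, List.nodup_range.imp ?_⟩
  · unfold roundOutput
    split_ifs <;> simp
  · intro a b hab
    refine fun o h1 h2 => hab ?_
    by_cases ha : a < cnt <;> by_cases hb : b < cnt
    · rw [roundOutput, if_pos ha, List.mem_singleton] at h1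
      rw [roundOutput, if_pos hb, List.mem_singleton, h1, Prod.mk.injEq] at h2
      exact hl.inj a ha b hb h2.1
    · exact (hmix a b ha hb o h1 h2).elim
    · exact (hmix b a hb ha o h2 h1).elim
    · rw [roundOutput, if_neg ha] at h1
      rw [roundOutput, if_neg hb] at h2
      split_ifs at h1 h2
      all_goals try simp at h1 h2; done
      rw [List.mem_singleton] at h1
      rw [List.mem_singleton, h1, Prod.mk.injEq, Prod.mk.injEq] at h2
      have e1 := Nat.div_add_mod (a - cnt) n
      rw [h2.1, h2.2.1, Nat.div_add_mod] at e1
      omega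

/-- There are no seven successive rounds without output. -/
theorem exists_roundOutput_ne_nil (hy : Layout c G w adj inp V Sz L R₀ R)
    {a : ℕ} (hl : LowList inp (2 * R₀) n cnt low)
    (ha : a + 7 ≤ cnt + n * n) :
    ∃ i < 7, roundOutput G w inp L (2 * R₀) cnt low (a + i) ≠ [] := by
  have hn := hy.two_le
  have hcn := hl.le
  by_cases hac : a < cnt
  · exact ⟨0, by omega, by simp [roundOutput, hac]⟩
  -- For `n = 2` there are only four rounds after phase `0`, so seven successive ones do not fit.
  have hn3 : 3 ≤ n := by
    by_contra h
    obtain rfl : n = 2 := by omega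
    omega
  -- Within one phase only two values of `j` are silent, so one of three consecutive rounds is not.
  have key : ∀ p j i, a + i = cnt + (p * n + j) → j + 2 < n → i < 5 →
      ∃ i < 7, roundOutput G w inp L (2 * R₀) cnt low (a + i) ≠ [] := by
    intro p j i hi hj hi5
    by_contra hall
    have hsilent : ∀ k < 3, j + k = p ∨ j + k = earlyTarget L (2 * R₀) inp p := by
      intro k hk
      by_contra hne
      refine hall ⟨i + k, by omega, ?_⟩
      rw [← Nat.add_assoc, hi, show cnt + (p * n + j) + k = cnt + (p * n + (j + k)) by omega,
        roundOutput_late _ _ _ _ _ _ _ _ (by omega), if_neg hne]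
      simp
    have h0 := hsilent 0 (by omega)
    have h1 := hsilent 1 (by omega)
    have h2 := hsilent 2 (by omega)
    omega
  have hdm := Nat.div_add_mod (a - cnt) n
  have hlt := Nat.mod_lt (a - cnt) (show 0 < n by omega)
  rw [Nat.mul_comm] at hdm
  by_cases hj : (a - cnt) % n + 2 < n
  · exact key ((a - cnt) / n) _ 0 (by omega) hj (by omega)
  -- At most two rounds of the current phase are left; the first three rounds of the next one are
  -- used instead.
  · have : ((a - cnt) / n + 1) * n = (a - cnt) / n * n + n := Nat.succ_mul _ _
    exact key ((a - cnt) / n + 1) 0 (n - (a - cnt) % n) (by omega) (by omega) (by omega)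

end Layout

end rounds

/-! ## Enumeration by rounds -/

theorem Config.Halted.output_eq_none {W : ℕ} {P : Program} {s : Config W} (h : s.Halted P) :
    s.output P = none := by
  unfold Config.output
  rw [show s.instr P = .halt from h]

theorem Config.Halted.accessed_eq_none {W : ℕ} {P : Program} {s : Config W} (h : s.Halted P) :
    s.accessed P = none := by
  unfold Config.accessed
  rw [show s.instr P = .halt from h]

section

variable {W : ℕ} {P : Program} {inp M : BitVec W → BitVec W} {S : ℕ}

theorem Runs.iterate_of_ge {s s' : Config W} {k t : ℕ} {os : List Output}
    (h : Runs P inp S s k os s') (hh : s'.Halted P) (ht : k ≤ t) :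
    (Config.next P inp)^[t] s = s' := by
  obtain ⟨t, rfl⟩ := Nat.exists_eq_add_of_le' ht
  rw [Function.iterate_add_apply, h.iterate_eq, hh.iterate]

theorem enumerates_of_runs {s' : Config W} {k : ℕ} {os : List Output} {A : Set Output}
    (h : Runs P inp S ⟨0, fun _ => 0, M⟩ k os s') (hh : s'.Halted P) (hn : os.Nodup)
    (hA : ∀ o, o ∈ os ↔ o ∈ A) : Enumerates P inp M A := by
  simp only [Enumerates, run_eq_iterate]
  have hlt : ∀ t o, ((Config.next P inp)^[t] ⟨0, fun _ => 0, M⟩).output P = some o → t < k := by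
    intro t o ho
    by_contra hge
    rw [h.iterate_of_ge hh (not_lt.1 hge), hh.output_eq_none] at ho
    exact absurd ho (by simp)
  refine ⟨⟨k, by rwa [h.iterate_eq]⟩, fun t o ho => ?_, fun o ho => ?_⟩
  · exact (hA o).1 ((h.output_iff o).1 ⟨t, hlt t o ho, ho⟩)
  · obtain ⟨t, ht, hto⟩ := (h.output_iff o).2 ((hA o).2 ho)
    exact ⟨t, hto, fun t' ht' => h.output_unique hn (hlt _ _ ht') ht ht' hto⟩

theorem spaceUsed_le_of_runs {s' : Config W} {k : ℕ} {os : List Output}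
    (h : Runs P inp S ⟨0, fun _ => 0, M⟩ k os s') (hh : s'.Halted P) : spaceUsed P inp M ≤ S := by
  refine csSup_le' ?_
  rintro _ ⟨t, a, ha, rfl⟩
  rw [run_eq_iterate] at ha
  refine h.accessed_lt (i := t) ?_ ha
  by_contra hge
  rw [h.iterate_of_ge hh (not_lt.1 hge), hh.accessed_eq_none] at ha
  exact absurd ha (by simp)

theorem lt_spaceUsed {t : ℕ} {a : BitVec W} (h : (run P inp M t).accessed P = some a) :
    a.toNat < spaceUsed P inp M := by
  refine le_csSup (s := {S : ℕ | ∃ (t : ℕ) (a : BitVec W),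
    (run P inp M t).accessed P = some a ∧ S = a.toNat + 1}) ⟨2 ^ W, ?_⟩ ⟨t, a, h, rfl⟩
  rintro _ ⟨t, a, -, rfl⟩
  exact a.isLt

/-- The machine works in `A` rounds of at most `D` steps each, round `a` making the outputs `out a`;
in `q` successive rounds, there is an output. -/
structure Rounds (P : Program) (inp : BitVec W → BitVec W) (S A D q : ℕ) (out : ℕ → List Output)
    (I : ℕ → Config W → Prop) : Prop where
  round : ∀ a < A, ∀ s, I a s → ∃ k s', Runs P inp S s k (out a) s' ∧ k ≤ D ∧ I (a + 1) s'
  halted : ∀ s, I A s → s.Halted P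
  gap : ∀ a, a + q ≤ A → ∃ i < q, out (a + i) ≠ []

namespace Rounds

variable {A D q : ℕ} {out : ℕ → List Output} {I : ℕ → Config W → Prop}

theorem runs_all (h : Rounds P inp S A D q out I) {b a : ℕ} (hab : a + b = A) {s : Config W}
    (hs : I a s) :
    ∃ k s', Runs P inp S s k ((List.range' a b).flatMap out) s' ∧ s'.Halted P := by
  induction b generalizing a s with
  | zero =>
    obtain rfl : a = A := by omega
    exact ⟨0, s, .refl s, h.halted s hs⟩
  | succ b ih =>
    obtain ⟨k, s₁, r, -, h1⟩ := h.round a (by omega) s hs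
    obtain ⟨k', s₂, r', h2⟩ := ih (by omega) h1
    exact ⟨_, s₂, by simpa [List.range'_succ] using r.trans r', h2⟩

theorem event_of_gap (h : Rounds P inp S A D q out I) {r a : ℕ} (ha : a ≤ A) {s : Config W}
    (hs : I a s) (hr : A < a + r ∨ ∃ i < r, out (a + i) ≠ []) :
    ∃ t ≤ D * r, ((Config.next P inp)^[t] s).output P ≠ none ∨
      ((Config.next P inp)^[t] s).Halted P := by
  induction r generalizing a s with
  | zero => simp at hr; omega
  | succ r ih =>
    rw [Nat.mul_succ]
    rcases ha.eq_or_lt with rfl | ha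
    · exact ⟨0, by omega, Or.inr (h.halted s hs)⟩
    obtain ⟨k, s₁, r1, hk, h1⟩ := h.round a ha s hs
    by_cases hne : out a = []
    · obtain ⟨t, ht, he⟩ := ih (a := a + 1) ha h1 (by
        rcases hr with hr | ⟨i, hi, hi'⟩
        · left; omega
        · right
          rcases i with _ | i
          · exact absurd hne hi'
          · exact ⟨i, by omega, by rwa [Nat.add_right_comm]⟩)
      refine ⟨t + k, by omega, ?_⟩
      rwa [Function.iterate_add_apply, r1.iterate_eq]
    · obtain ⟨i, hi, he⟩ := r1.event_of_ne_nil hne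
      exact ⟨i, by omega, Or.inl he⟩

theorem event (h : Rounds P inp S A D q out I) {a : ℕ} (ha : a ≤ A) {s : Config W} (hs : I a s) :
    ∃ t ≤ D * q, ((Config.next P inp)^[t] s).output P ≠ none ∨
      ((Config.next P inp)^[t] s).Halted P := by
  refine h.event_of_gap ha hs ?_
  rcases Nat.lt_or_ge A (a + q) with hlt | hge
  · exact Or.inl hlt
  · exact Or.inr (h.gap a hge)

/-- At time `τ` a round may be under way. It ends within `D` steps, and an output or the end comes
within `q` further rounds; hence `q + 1`. -/
theorem event_after (h : Rounds P inp S A D q out I) {b a : ℕ} (hab : a + b = A) {s : Config W}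
    (hs : I a s) (τ : ℕ) :
    ∃ t ≥ τ, t ≤ τ + D * (q + 1) ∧ (((Config.next P inp)^[t] s).output P ≠ none ∨
      ((Config.next P inp)^[t] s).Halted P) := by
  rw [Nat.mul_succ]
  induction b generalizing a s τ with
  | zero =>
    obtain rfl : a = A := by omega
    have := h.halted s hs
    exact ⟨τ, le_rfl, by omega, Or.inr (by rwa [this.iterate])⟩
  | succ b ih =>
    obtain ⟨k, s₁, r1, hk, h1⟩ := h.round a (by omega) s hs
    rcases Nat.lt_or_ge τ k with hτ | hτ
    · obtain ⟨t, ht, he⟩ := h.event (a := a + 1) (by omega) h1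
      refine ⟨t + k, by omega, by omega, ?_⟩
      rwa [Function.iterate_add_apply, r1.iterate_eq]
    · obtain ⟨t, ht, ht', he⟩ := ih (by omega) h1 (τ - k)
      refine ⟨t + k, by omega, by omega, ?_⟩
      rwa [Function.iterate_add_apply, r1.iterate_eq]

theorem hasDelay (h : Rounds P inp S A D q out I) {k : ℕ} {s : Config W}
    (r : Runs P inp S ⟨0, fun _ => 0, M⟩ k [] s) (hs : I 0 s) {p d : ℝ} (hp : (k : ℝ) ≤ p)
    (hd : ((D * (q + 1) : ℕ) : ℝ) ≤ d) : HasDelay P inp M p d := by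
  refine ⟨k, hp, fun t ht => ?_, fun τ hτ => ?_⟩
  · rw [run_eq_iterate]
    by_contra hne
    obtain ⟨o, ho⟩ := Option.ne_none_iff_exists'.1 hne
    simpa using (r.output_iff o).1 ⟨t, ht, ho⟩
  · obtain ⟨t, ht, ht', he⟩ := h.event_after (Nat.zero_add A) hs (τ - k)
    refine ⟨t + k, by omega, ?_, ?_⟩
    · have : t + k ≤ τ + D * (q + 1) := by omega
      have : ((t + k : ℕ) : ℝ) ≤ τ + (D * (q + 1) : ℕ) := by exact_mod_cast this
      linarith
    · simp only [run_eq_iterate]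
      rwa [Function.iterate_add_apply, r.iterate_eq]

/-- An enumeration by rounds, after preprocessing. -/
theorem enumerates (h : Rounds P inp S A D q out I) {k : ℕ} {s : Config W}
    (r : Runs P inp S ⟨0, fun _ => 0, M⟩ k [] s) (hs : I 0 s) {Z : Set Output}
    (hn : ((List.range A).flatMap out).Nodup) (hZ : ∀ o, (∃ a < A, o ∈ out a) ↔ o ∈ Z) :
    Enumerates P inp M Z ∧ spaceUsed P inp M ≤ S := by
  obtain ⟨k', s', r', hh⟩ := h.runs_all (Nat.zero_add A) hs
  rw [← List.range_eq_range'] at r'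
  have := r.trans r'
  rw [List.nil_append] at this
  refine ⟨enumerates_of_runs this hh hn fun o => ?_, spaceUsed_le_of_runs this hh⟩
  rw [← hZ]
  simp

end Rounds

end

/-- The program accesses cell `16 * n` of the memory. -/
theorem lt_spaceUsed_link {c n W Sz : ℕ} {inp M : BitVec W → BitVec W} {inp' : ℕ → ℕ}
    (hinp : ∀ a, (inp a).toNat = inp' a.toNat) (hn : inp' 0 = n) (hSz : 16 * Sz ≤ 2 ^ W)
    (hnS : n < Sz) : 16 * n < spaceUsed (link (blocks c)) inp M := by
  have hat := isAt_link (blocks c) (l := 0) (by simp [blocks])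
  have h0 : blockOffset (blocks c) 0 = 0 := by simp [blockOffset]
  rw [h0] at hat
  have hat1 := hat.left (l := (Op.const 1 1).compile)
  have hat2 := hat.right (l := (Op.const 1 1).compile)
  obtain ⟨s1, r1, hpc1, hrep1⟩ := Op.runs (inp := inp) hinp hSz (Op.const 1 1) (rep_init M)
    (by simp only [Op.Safe]; omega) hat1
  have hat2' := hat2.left (l := (Op.input 2 0).compile)
  have hat3 := hat2.right (l := (Op.input 2 0).compile)
  obtain ⟨s2, r2, hpc2, hrep2⟩ := Op.runs (inp := inp) hinp hSz (Op.input 2 0) hrep1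
    trivial (by rw [hpc1]; simpa using hat2')
  have hat4 := hat3.left (l := (Op.load 19 0 2).compile)
  have hreg : ((Op.input 2 0).apply inp' ((Op.const 1 1).apply inp' ⟨fun _ => 0, fun k i =>
      (M (BitVec.ofNat W (16 * i + k))).toNat⟩)).reg 2 = n := by
    simp [Op.apply, hn]
  rw [Nat.zero_add, ← hpc1.trans (Nat.zero_add _), ← hpc2] at hat4
  obtain ⟨s3, r3, hpc3, hx, hrep3⟩ := runs_address (S := Sz) (inp := inp) hrep2
    (IsAt.left (l' := [.load (19 + 2) 0]) hat4)
  have hlt : 16 * n < 2 ^ W := by omega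
  have h3 : s3.instr (link (blocks c)) = .load 21 0 := by
    rw [Config.instr, hpc3]
    exact (IsAt.right (l := [.add 0 4 4, .add 0 0 0, .add 0 0 0, .add 0 0 0, .const 1 0,
      .add 0 0 1]) hat4).head
  have hr := ((r1.trans r2).trans r3).iterate_eq
  rw [← run_eq_iterate] at hr
  have := lt_spaceUsed (P := link (blocks c)) (inp := inp) (M := M) (a := s3.reg 0)
    (by rw [hr]; simp [Config.accessed, h3])
  rw [hx, hreg, Nat.add_zero] at this
  simpa [Nat.mod_eq_of_lt hlt] using this

/-! ### Word size and numerical bounds -/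

section parameters

theorem log_add_one_le {n : ℕ} (hn : 1 ≤ n) : Nat.log 2 n + 1 ≤ n :=
  (Nat.lt_pow_self one_lt_two).trans_le (Nat.pow_log_le_self 2 (by omega))

theorem two_pow_log_le {n : ℕ} (hn : 1 ≤ n) : 2 ^ (Nat.log 2 n + 1) ≤ 2 * n := by
  have := Nat.pow_log_le_self 2 (x := n) (by omega)
  rw [pow_succ]
  omega

/-- With `T = 2 ^ (Nat.log 2 n + 1)`, which exceeds `n` and is at least `2`, the factors are at most
`T ^ 7`, `T ^ (c + 1)` and `T ^ 2`. Their product `T ^ (c + 10)` is below `T ^ (c + 20) ≤ 2 ^ W`. -/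
theorem lt_two_pow_of_le {c n W x : ℕ} (hW : (c + 20) * (Nat.log 2 n + 1) ≤ W) (hx : x ≤ 128 * (c + 1) * n ^ 2) : x < 2 ^ W := by
  have hT : n < 2 ^ (Nat.log 2 n + 1) := Nat.lt_pow_succ_log_self one_lt_two n
  have hT2 : 2 ≤ 2 ^ (Nat.log 2 n + 1) := by
    have := Nat.one_le_two_pow (n := Nat.log 2 n)
    rw [pow_succ]
    omega
  have hWT : (2 ^ (Nat.log 2 n + 1)) ^ (c + 20) ≤ 2 ^ W := by
    rw [← pow_mul, Nat.mul_comm]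
    exact Nat.pow_le_pow_right (by norm_num) hW
  generalize 2 ^ (Nat.log 2 n + 1) = T at *
  have h1 : 128 ≤ T ^ 7 := le_trans (by norm_num) (Nat.pow_le_pow_left hT2 7)
  have h2 : c + 1 ≤ T ^ (c + 1) := (Nat.lt_pow_self hT2).le
  have h3 : n ^ 2 ≤ T ^ 2 := Nat.pow_le_pow_left hT.le 2
  have h4 : 128 * (c + 1) * n ^ 2 ≤ T ^ 7 * T ^ (c + 1) * T ^ 2 :=
    Nat.mul_le_mul (Nat.mul_le_mul h1 h2) h3
  have h5 : T ^ 7 * T ^ (c + 1) * T ^ 2 = T ^ (c + 10) := by ring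
  have h6 : T ^ (c + 10) < T ^ (c + 20) := Nat.pow_lt_pow_right hT2 (by omega)
  omega

theorem pow_lt_two_pow {c n W : ℕ} (hW : (c + 20) * (Nat.log 2 n + 1) ≤ W) : n ^ c < 2 ^ W := by
  have hT : n < 2 ^ (Nat.log 2 n + 1) := Nat.lt_pow_succ_log_self one_lt_two n
  calc n ^ c ≤ (2 ^ (Nat.log 2 n + 1)) ^ c := Nat.pow_le_pow_left hT.le c
    _ = 2 ^ (c * (Nat.log 2 n + 1)) := by rw [← pow_mul, Nat.mul_comm]
    _ < 2 ^ W := Nat.pow_lt_pow_right (by norm_num) (lt_of_lt_of_le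
      (Nat.mul_lt_mul_of_pos_right (by omega) (by omega)) hW)

theorem sum_length_le {n : ℕ} {G : Digraph (Fin n)} {adj : Fin n → List (Fin n)}
    (ha : IsAdjacencyLists G adj) : ∑ u : Fin n, (adj u).length ≤ n ^ 2 := by
  refine (Finset.sum_le_card_nsmul Finset.univ _ n fun u _ => ?_).trans ?_
  · simpa using (ha u).1.length_le_card
  · simp [sq]

theorem inputMemory_toNat {c n W : ℕ} {G : Digraph (Fin n)} {w : Fin n → Fin n → ℕ}
    {adj : Fin n → List (Fin n)} (hn : 1 ≤ n) (hW : (c + 20) * (Nat.log 2 n + 1) ≤ W)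
    (ha : IsAdjacencyLists G adj) (hw : ∀ u v, G.Adj u v → w u v ≤ n ^ c) (a : BitVec W) :
    (inputMemory W (encodeGraph w adj) a).toNat = (encodeGraph w adj).getD a.toNat 0 := by
  have hnn : n ≤ n ^ 2 := by nlinarith
  have h1 : ∀ x, x ≤ 128 * n ^ 2 → x ≤ 2 ^ W - 1 := fun x hx =>
    Nat.le_sub_one_of_lt (lt_two_pow_of_le hW (by nlinarith))
  have hm := sum_length_le ha
  have := getD_encodeGraph_le (w := w) (adj := adj) (B := 2 ^ W - 1) (h1 n (by omega))
    (h1 _ (by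
      rw [Finset.sum_add_distrib, ← Finset.mul_sum]
      simp only [Finset.sum_const, Finset.card_univ, Fintype.card_fin, smul_eq_mul, mul_one]
      omega))
    (fun u v hv => Nat.le_sub_one_of_lt ((hw u v (((ha u).2 v).1 hv)).trans_lt (pow_lt_two_pow hW)))
    a.toNat
  have hpos := Nat.two_pow_pos W
  rw [inputMemory, BitVec.toNat_ofNat, Nat.mod_eq_of_lt (by omega)]

variable {c n W : ℕ} {G : Digraph (Fin n)} {w : Fin n → Fin n → ℕ} {adj : Fin n → List (Fin n)}
  {inp : ℕ → ℕ} {L R₀ R : ℕ}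

theorem EncodesGraph.layout (he : EncodesGraph w adj inp) (hn : 2 ≤ n)
    (hW : (c + 20) * (Nat.log 2 n + 1) ≤ W) (ha : IsAdjacencyLists G adj)
    (hw : ∀ u v, G.Adj u v → w u v ≤ n ^ c) (hL : L = (c + 1) * (Nat.log 2 n + 1))
    (hR₀ : R₀ = (∑ u ∈ Finset.range n, degreeOf inp u) / n + 1)
    (hR : R = 2 * (R₀ + (4 * L + 6))) :
    Layout c G w adj inp (2 ^ W) (n + L + 4) L R₀ R := by
  have hnn : n * 2 ≤ n ^ 2 := by nlinarith
  have hm := sum_length_le ha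
  have hlog := log_add_one_le (n := n) (by omega)
  have hLn : L ≤ (c + 1) * n := by rw [hL]; exact Nat.mul_le_mul_left _ hlog
  have hcn : (c + 1) * n ≤ (c + 1) * n ^ 2 := Nat.mul_le_mul_left _ (by omega)
  have hcn2 : n ^ 2 ≤ (c + 1) * n ^ 2 := Nat.le_mul_of_pos_left _ (by omega)
  have hbig : ∀ x, x ≤ 128 * ((c + 1) * n ^ 2) → x < 2 ^ W := fun x hx =>
    lt_two_pow_of_le (c := c) hW (by rwa [Nat.mul_assoc])
  have hR₀n : R₀ ≤ n + 1 := by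
    rw [hR₀, he.sum_degree]
    have := Nat.div_le_of_le_mul (m := ∑ u : Fin n, (adj u).length) (n := n) (k := n)
      (by rw [← sq]; exact hm)
    omega
  refine ⟨hn, ⟨le_rfl, ?_, hbig _ (by omega), fun u hu => hbig _ ?_⟩, he, ha, hw, ?_, hR₀, hR⟩
  · refine Nat.pow_lt_pow_right (by norm_num) (lt_of_lt_of_le ?_ hW)
    rw [hL]
    exact Nat.mul_lt_mul_of_pos_right (by omega) (by omega)
  · have h1 := he.addr ⟨u, hu⟩
    have h2 := he.degree ⟨u, hu⟩
    simp only at h1 h2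
    have h3 : ∑ u' ∈ Finset.Iio (⟨u, hu⟩ : Fin n), (1 + 2 * (adj u').length) +
        (1 + 2 * (adj ⟨u, hu⟩).length) ≤ ∑ u' : Fin n, (1 + 2 * (adj u').length) := by
      have := Finset.sum_insert (f := fun u' : Fin n => 1 + 2 * (adj u').length)
        (a := ⟨u, hu⟩) (s := Finset.Iio ⟨u, hu⟩) (by simp)
      rw [Nat.add_comm, ← this]
      exact Finset.sum_le_sum_of_subset (Finset.subset_univ _)
    rw [Finset.sum_add_distrib (s := Finset.univ), ← Finset.mul_sum] at h3
    simp only [Finset.sum_const, Finset.card_univ, Fintype.card_fin, smul_eq_mul, mul_one] at h3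
    omega
  · rw [← pow_succ', hL, Nat.mul_comm, pow_mul]
    exact Nat.pow_lt_pow_left (Nat.lt_pow_succ_log_self one_lt_two n) (by omega)

/-- A round has at most `4 * ⌊m / n⌋ + 8 * L + 21` blocks, where `m` is the number of edges. For `n
≥ 2` the natural logarithm is at least `1 / 2`, so it absorbs the constant, and `Nat.log 2 n + 1` is
at most four times it. -/
theorem EncodesGraph.round_length_le (he : EncodesGraph w adj inp) (hn : 2 ≤ n)
    (ha : IsAdjacencyLists G adj) (hL : L = (c + 1) * (Nat.log 2 n + 1))
    (hR₀ : R₀ = (∑ u ∈ Finset.range n, degreeOf inp u) / n + 1)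
    (hR : R = 2 * (R₀ + (4 * L + 6))) :
    ((R + 2 * R₀ + 5 : ℕ) : ℝ) ≤ (32 * c + 80) * (avgDegree G + Real.log n) := by
  have havg : (((∑ u ∈ Finset.range n, degreeOf inp u) / n : ℕ) : ℝ) ≤ avgDegree G := by
    rw [he.avgDegree_eq ha]
    exact Nat.cast_div_le
  have havg0 : (0 : ℝ) ≤ avgDegree G := (Nat.cast_nonneg _).trans havg
  have hlog2 : (1 / 2 : ℝ) ≤ Real.log 2 := by have := Real.log_two_gt_d9; linarith
  have hn' : (2 : ℝ) ≤ n := by exact_mod_cast hn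
  have hlogn : (1 / 2 : ℝ) ≤ Real.log n :=
    hlog2.trans (Real.log_le_log (by norm_num) hn')
  have hpow : (Nat.log 2 n : ℝ) * Real.log 2 ≤ Real.log n := by
    rw [← Real.log_pow]
    refine Real.log_le_log (by positivity) ?_
    exact_mod_cast Nat.pow_log_le_self 2 (x := n) (by omega)
  have hlog : (Nat.log 2 n : ℝ) ≤ 2 * Real.log n := by
    have : (0 : ℝ) ≤ Nat.log 2 n := Nat.cast_nonneg _
    nlinarith
  have hc : (0 : ℝ) ≤ c := Nat.cast_nonneg _
  have hexp : ((R + 2 * R₀ + 5 : ℕ) : ℝ) =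
      4 * (((∑ u ∈ Finset.range n, degreeOf inp u) / n : ℕ) : ℝ) +
        8 * ((c + 1) * (Nat.log 2 n + 1)) + 21 := by
    rw [hR, hR₀, hL]
    push_cast
    ring
  rw [hexp]
  generalize (((∑ u ∈ Finset.range n, degreeOf inp u) / n : ℕ) : ℝ) = x at *
  have h1 : (c + 1 : ℝ) * (Nat.log 2 n + 1) ≤ (c + 1) * (4 * Real.log n) :=
    mul_le_mul_of_nonneg_left (by linarith) (by linarith)
  have h2 : 0 ≤ (c : ℝ) * avgDegree G := mul_nonneg hc havg0
  nlinarith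

end parameters

/-! ### Choice of constants and assembly -/

theorem mainTheorem8 (c : ℕ) :
    ∃ (P : Program) (K C : ℕ), ∀ (n W : ℕ), 1 ≤ n → K * (Nat.log 2 n + 1) ≤ W →
      ∀ (G : Digraph (Fin n)) (w : Fin n → Fin n → ℕ), (∀ u v, G.Adj u v → w u v ≤ n ^ c) →
      ∀ (adj : Fin n → List (Fin n)), IsAdjacencyLists G adj →
      ∀ (M : BitVec W → BitVec W),
        Enumerates P (inputMemory W (encodeGraph w adj)) M (noSelfSolutions G w) ∧
        HasDelay P (inputMemory W (encodeGraph w adj)) M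
          (C * n) (C * (avgDegree G + Real.log n)) ∧
        spaceUsed P (inputMemory W (encodeGraph w adj)) M ≤ C * n ∧
        n ≤ C * spaceUsed P (inputMemory W (encodeGraph w adj)) M := by
  set P := link (blocks c) with hP
  -- The first summand is for the delay: `7 + 1` rounds, `P.length` steps per block, and the bound
  -- on the blocks of a round. The second is for the space: sixteen arrays of `n + L + 4 ≤ (c + 6) *
  -- n` cells.
  refine ⟨P, c + 20, 8 * P.length * (32 * c + 80) + 16 * (c + 6), ?_⟩
  intro n W hn hW G w hw adj ha M
  have hinp := inputMemory_toNat hn hW ha hw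
  have he := encodesGraph_getD w adj
  set inp : ℕ → ℕ := fun a => (encodeGraph w adj).getD a 0 with hinp'
  set L := (c + 1) * (Nat.log 2 n + 1) with hL
  have hlog := log_add_one_le hn
  have hLn : L ≤ (c + 1) * n := Nat.mul_le_mul_left _ hlog
  have hcn : 1 ≤ (c + 1) * n := Nat.mul_pos (by omega) (by omega)
  have hnn : n ≤ n ^ 2 := by nlinarith
  have hcn2 : (c + 1) * n ≤ (c + 1) * n ^ 2 := Nat.mul_le_mul_left _ hnn
  have hcn3 : n ^ 2 ≤ (c + 1) * n ^ 2 := Nat.le_mul_of_pos_left _ (by omega)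
  have hcn4 : c + 1 ≤ (c + 1) * n := Nat.le_mul_of_pos_right _ (by omega)
  have hbig : ∀ x, x ≤ 128 * ((c + 1) * n ^ 2) → x < 2 ^ W := fun x hx =>
    lt_two_pow_of_le (c := c) hW (by rwa [Nat.mul_assoc])
  have hSz : 16 * (n + L + 4) ≤ 2 ^ W := (hbig _ (by omega)).le
  have hlow : n ≤ (8 * P.length * (32 * c + 80) + 16 * (c + 6)) *
      spaceUsed P (inputMemory W (encodeGraph w adj)) M := by
    have := lt_spaceUsed_link (c := c) (M := M) hinp he.size hSz (by omega)
    rw [← hP] at this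
    exact (show n ≤ spaceUsed P (inputMemory W (encodeGraph w adj)) M by omega).trans
      (Nat.le_mul_of_pos_left _ (by omega))
  have hspace : 16 * (n + L + 4) ≤ (8 * P.length * (32 * c + 80) + 16 * (c + 6)) * n := by
    have : 16 * (n + L + 4) ≤ 16 * (c + 6) * n := by nlinarith
    rw [Nat.add_mul]
    omega
  rcases hn.eq_or_lt with rfl | hn2
  · obtain ⟨σ, r⟩ := runs_entry_one (c := c) (V := 2 ^ W) (Sz := 1 + L + 4) (inp := inp)
      (σ := ⟨fun _ => 0, fun k i => (M (BitVec.ofNat W (16 * i + k))).toNat⟩)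
      (hbig _ (by omega)) (by omega) he.size fun _ => rfl
    obtain ⟨k, s, hr, -, hk, hpc, -⟩ := r.runs hinp hSz (by simp [blockOffset]) (rep_init M)
    -- For `n = 1` the logarithm vanishes and the average degree may be `0`, so the delay bound may
    -- be `0`. The whole run counts as preprocessing, followed by no rounds.
    have hrounds : Rounds P (inputMemory W (encodeGraph w adj)) (16 * (1 + L + 4)) 0 0 1
        (fun _ => []) (fun _ s => s.Halted P) :=
      ⟨fun a ha => absurd ha (by omega), fun _ h => h, fun a ha => by omega⟩
    have hh : s.Halted P := halted_of_block (l := 11) (by simp [blocks]) (by simp [blocks]) hpc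
    obtain ⟨h1, h2⟩ := hrounds.enumerates (Z := noSelfSolutions G w) hr hh (by simp) (by
      intro o
      simp only [not_lt_zero, false_and, exists_false, false_iff]
      rintro ⟨s, t, hst, -⟩
      exact hst (Subsingleton.elim s t))
    refine ⟨h1, hrounds.hasDelay hr hh ?_ ?_, h2.trans hspace, hlow⟩
    · have : k ≤ (8 * P.length * (32 * c + 80) + 16 * (c + 6)) * 1 := by
        rw [← hP] at hk
        nlinarith
      exact_mod_cast this
    · have h3 : 0 ≤ avgDegree G := by unfold avgDegree; positivity
      simp only [Nat.zero_mul, Nat.cast_zero, Nat.cast_one, Real.log_one, add_zero]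
      generalize P.length = l
      positivity
  · set R₀ := (∑ u ∈ Finset.range n, degreeOf inp u) / n + 1 with hR₀
    set R := 2 * (R₀ + (4 * L + 6)) with hR
    have hy := he.layout hn2 hW ha hw hL hR₀ hR
    have hm : ∑ u ∈ Finset.range n, degreeOf inp u ≤ n ^ 2 := by
      rw [he.sum_degree]; exact sum_length_le ha
    have hR₀n : R₀ ≤ n + 1 := by
      have := Nat.div_le_of_le_mul (m := ∑ u ∈ Finset.range n, degreeOf inp u) (n := n) (k := n)
        (by rw [← sq]; exact hm)
      omega
    obtain ⟨σ₁, r1, hC, hp, hj, hsrc, hl, hidle, hskip⟩ := runs_preprocessing (c := c)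
      (σ := ⟨fun _ => 0, fun k i => (M (BitVec.ofNat W (16 * i + k))).toNat⟩) hy.sizes hn2 he.size
      hL (two_pow_log_le hn) (Nat.lt_pow_succ_log_self one_lt_two n) hR₀ hR (hbig _ (by omega))
      (hbig _ (by omega)) fun _ => rfl
    obtain ⟨σ₂, S₂, r2, hh2, hst, -⟩ := runs_setup (c := c) hy.sizes hC hsrc (by omega) hidle
    generalize hcnt : σ₁.control.jend = cnt at hl
    generalize hlw : σ₁.control.low = low at hl
    have hcnt2 := hl.le_two_mul (by omega) hR₀
    have hat0 : AtRound G w inp L R (2 * R₀) cnt low 0 (7, σ₂) :=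
      Or.inl ⟨by omega, rfl, S₂, _, hC, hp, hj, hcnt, hsrc, hlw, fun u hu => by simp [hskip u hu],
        hst, by simpa using hh2⟩
    obtain ⟨k, s, hr, -, hk, hpc, hrep⟩ := (r1.trans_silent r2).runs hinp hSz
      (by simp [blockOffset]) (rep_init M)
    have hrounds : Rounds P (inputMemory W (encodeGraph w adj)) (16 * (n + L + 4)) (cnt + n * n)
        (P.length * (R + 2 * R₀ + 5)) 7 (roundOutput G w inp L (2 * R₀) cnt low)
        (fun a s => ∃ X, AtRound G w inp L R (2 * R₀) cnt low a X ∧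
          s.pc = blockOffset (blocks c) X.1 ∧ Represents s X.2) := by
      refine ⟨?_, ?_, fun a ha => hy.exists_roundOutput_ne_nil hl ha⟩
      · rintro a ha s ⟨X, hX, hpc, hrep⟩
        obtain ⟨Y, k, r, hk, hY⟩ := hy.runs_atRound hl ha hX
        obtain ⟨k', s', hr, -, hk', hpc', hrep'⟩ := r.runs hinp hSz hpc hrep
        exact ⟨k', s', hr, hk'.trans (Nat.mul_le_mul_left _ hk), Y, hY, hpc', hrep'⟩
      · rintro s ⟨X, hX, hpc, -⟩
        have hX1 : X.1 = 11 := by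
          rcases hX with ⟨h, -⟩ | ⟨p, j, hp, hj, h, -⟩ | ⟨-, h⟩
          · omega
          · have : (p + 1) * n ≤ n * n := Nat.mul_le_mul_right _ hp
            rw [Nat.succ_mul] at this
            omega
          · exact h
        exact halted_of_block (l := 11) (by simp [blocks]) (by simp [blocks]) (hX1 ▸ hpc)
    have hI := show ∃ X, AtRound G w inp L R (2 * R₀) cnt low 0 X ∧
      s.pc = blockOffset (blocks c) X.1 ∧ Represents s X.2 from ⟨_, hat0, hpc, hrep⟩
    obtain ⟨h1, h2⟩ := hrounds.enumerates (Z := noSelfSolutions G w) hr hI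
      hl.nodup_roundOutput (hy.mem_roundOutput hl)
    refine ⟨h1, hrounds.hasDelay hr hI ?_ ?_, h2.trans hspace, hlow⟩
    · have h3 : 2 * n + (Nat.log 2 n + 1) + L + R₀ + 5 + 1 ≤ (c + 12) * n := by nlinarith
      have h4 : k ≤ (8 * P.length * (32 * c + 80) + 16 * (c + 6)) * n :=
        calc k ≤ P.length * ((c + 12) * n) := hk.trans (Nat.mul_le_mul_left _ h3)
          _ ≤ P.length * ((8 * (32 * c + 80)) * n) := by gcongr; omega
          _ ≤ _ := by rw [Nat.add_mul]; refine Nat.le_add_right_of_le (le_of_eq ?_); ring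
      exact_mod_cast h4
    · have h3 := he.round_length_le hn2 ha hL hR₀ hR
      have h4 : 0 ≤ avgDegree G + Real.log n := by
        have : (1 : ℝ) ≤ n := by exact_mod_cast hn
        have := Real.log_nonneg this
        have : 0 ≤ avgDegree G := by unfold avgDegree; positivity
        positivity
      calc ((P.length * (R + 2 * R₀ + 5) * (7 + 1) : ℕ) : ℝ)
          = 8 * P.length * ((R + 2 * R₀ + 5 : ℕ) : ℝ) := by push_cast; ring
        _ ≤ 8 * P.length * ((32 * c + 80) * (avgDegree G + Real.log n)) :=
          mul_le_mul_of_nonneg_left h3 (by generalize P.length = l; positivity)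
        _ ≤ _ := by
          push_cast
          rw [← mul_assoc]
          refine mul_le_mul_of_nonneg_right ?_ h4
          have : (0 : ℝ) ≤ 16 * (c + 6) := by positivity
          linarith
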